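/- Let $\Gamma$ be a subgroup of $\mathrm{SL}(2,\mathbb C)$ and let $R$ be a commutative $\mathbb C$-algebra of functions of one complex variable $z$, which is a domain, such that $R$ is stable under $\partial_z$, $\Gamma$ acts on $R$ on the right by $(f\cdot\gamma)(z)=f\left(\frac{az+b}{cz+d}\right)$, and $s_\gamma:z\mapsto cz+d$ is an invertible element of $R$ for every $\gamma=\begin{pmatrix}a&b\\c&d\end{pmatrix}\in\Gamma$. Put $\delta=-\frac12\partial_z$ and let $C=R((y;\delta))_2$ be the ring of Laurent series $\sum_{i\ge i_0}f_iy^i$ ($i_0\in\mathbb Z$, $f_i\in R$) with the product determined by $$y^{i}f=\sum_{u\ge 0}\Big(\prod_{j=1}^{u}\frac{2(j-1)+i}{j}\Big)\delta^u(f)\,y^{i+2u}\qquad(i\in\mathbb Z,\ f\in R).$$ For every $\gamma\in\Gamma$ there is a unique ring automorphism $q\mapsto q\cdot\gamma$ of $C$ that extends the action of $\gamma$ on $R$ and sends $y$ to a square root of $y^2(cz+d)^{-2}$ of the form $(cz+d)^{-1}y+\cdots$. For an integer $k\ge 0$ let $C_k^\Gamma$ be the space of those $q\in C$ with no term $y^i$,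 $i<k$, such that $q\cdot\gamma=q$ for all $\gamma\in\Gamma$. For $j\ge 0$ let $M_j=\{f\in R:\ f\cdot\gamma=s_\gamma^{\,j}f\text{ for all }\gamma\in\Gamma\}$. For an integer $m\ge1$ let $\mathcal J_{k,m}$ be the space of (formal) algebraic Jacobi forms on $R$ of weight $k$ and index $m$, that is, of expansions $\Phi(z,Z)=\sum_{\nu\ge0}X_\nu(z)Z^\nu$ with $X_\nu\in R$ such that, as power series in $Z$, $$\Phi\Big(\frac{az+b}{cz+d},\frac{Z}{cz+d}\Big)=(cz+d)^k\,e^{2\pi i m cZ^2/(cz+d)}\,\Phi(z,Z)\qquad\text{for all }\gamma\in\Gamma .$$ If $k=0$, assume moreover that there is $\varphi\in R$ with $\varphi\cdot\gamma=(cz+d)^2\varphi+c(cz+d)$ for all $\gamma\in\Gamma$ (for instance a multiple of the Eisenstein series $E_2$, or of $\chi'/\chi$ for an invertible modular form $\chi\in R$ of nonzero weight). Then $C_k^\Gamma$ and $\mathcal J_{k,m}$ are isomorphic complex vector spaces. More precisely, the map $\Psi:\prod_{j\ge k}M_j\to C_k^\Gamma$, $\Psi((f_j)_j)=\sum_j\psi_j(f_j)$,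 with $$\psi_j(f)=\sum_{n\ge0}\frac{(-1)^n}{4^n n!}\Big(\prod_{i=0}^{n-1}\frac{(j+2i)(j+2i+2)}{j+i}\Big)f^{(n)}y^{j+2n}$$ (for $j=0$ and $n\ge 1$ the factor $i=0$ is read as $j+2$, that is, as $2$), is a linear isomorphism; there is a linear isomorphism $\Theta:\prod_{j\ge k}M_j\to\mathcal J_{k,m}$ such that, if $f_j=0$ for all $j<k+n$, then the coefficient of $Z^n$ in $\Theta((f_j)_j)$ is $f_{k+n}$; for $k\ge1$ one may take $$\Theta((f_j)_j)=\sum_{j\ge k}Z^{j-k}\sum_{n\ge0}\frac{(2\pi i m)^n(j-1)!}{n!\,(j+n-1)!}f_j^{(n)}Z^{2n}.$$ Let $T=\Theta\circ\Psi^{-1}:C_k^\Gamma\to\mathcal J_{k,m}$. Then $C_k^\Gamma$ is closed under the product of $C$, and $F\star G=T\big(T^{-1}(F)\cdot T^{-1}(G)\big)$ is a bilinear associative product on $\mathcal J_{k,m}$, with a unit if $k=0$. This product is in general noncommutative: it is not commutative as soon as there are $f\in M_a$, $g\in M_b$ with $a,b\ge k$ and $a f g'-b f'g\neq0$. -/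

import Mathlib

section Coefficients
open Finset

/-- The coefficient `∏_{j=1}^{u} (2(j-1)+i)/j` of `δ^u(f) y^{i+2u}` in `y^i f`. -/
noncomputable def quadCoeff (i : ℤ) (u : ℕ) : ℂ :=
  ∏ j ∈ range u, ((2 * (j : ℂ) + (i : ℂ)) / ((j : ℂ) + 1))

theorem quadCoeff_zero_right (i : ℤ) : quadCoeff i 0 = 1 := by simp [quadCoeff]

theorem quadCoeff_zero_left (u : ℕ) : quadCoeff 0 (u + 1) = 0 := by
  simp [quadCoeff, Finset.prod_range_succ']

theorem quadCoeff_succ (i : ℤ) (u : ℕ) :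
    ((u : ℂ) + 1) * quadCoeff i (u + 1) = (2 * (u : ℂ) + i) * quadCoeff i u := by
  have h : ((u : ℂ) + 1) ≠ 0 := by exact_mod_cast Nat.succ_ne_zero u
  rw [quadCoeff, Finset.prod_range_succ, ← quadCoeff]
  field_simp

theorem quadCoeff_vandermonde (i j : ℤ) (n : ℕ) :
    quadCoeff (i + j) n = ∑ x ∈ antidiagonal n, quadCoeff i x.1 * quadCoeff j x.2 := by
  induction n with
  | zero => simp [quadCoeff_zero_right]
  | succ n ih =>
    have h : ((n : ℂ) + 1) ≠ 0 := by exact_mod_cast Nat.succ_ne_zero n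
    apply mul_left_cancel₀ h
    rw [quadCoeff_succ, ih]
    have e1 : ((n : ℂ) + 1) * ∑ x ∈ antidiagonal (n + 1), quadCoeff i x.1 * quadCoeff j x.2
        = (∑ x ∈ antidiagonal (n + 1), (x.1 : ℂ) * (quadCoeff i x.1 * quadCoeff j x.2))
          + ∑ x ∈ antidiagonal (n + 1), (x.2 : ℂ) * (quadCoeff i x.1 * quadCoeff j x.2) := by
      rw [Finset.mul_sum, ← Finset.sum_add_distrib]
      refine Finset.sum_congr rfl fun x hx => ?_
      have : (x.1 : ℂ) + x.2 = n + 1 := by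
        have := Finset.HasAntidiagonal.mem_antidiagonal.mp hx
        exact_mod_cast this
      rw [← add_mul, this]
    rw [e1, Finset.Nat.sum_antidiagonal_succ, Finset.Nat.sum_antidiagonal_succ']
    simp only [Nat.cast_zero, zero_mul, zero_add, Nat.cast_add, Nat.cast_one]
    rw [← Finset.sum_add_distrib, Finset.mul_sum]
    refine Finset.sum_congr rfl fun x hx => ?_
    have hx' : (x.1 : ℂ) + x.2 = n := by exact_mod_cast Finset.HasAntidiagonal.mem_antidiagonal.mp hx
    have a1 := quadCoeff_succ i x.1
    have a2 := quadCoeff_succ j x.2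
    have : (2 * (n : ℂ) + ((i + j : ℤ) : ℂ)) = (2 * (x.1 : ℂ) + i) + (2 * (x.2 : ℂ) + j) := by
      push_cast; rw [← hx']; ring
    rw [this]
    linear_combination (-quadCoeff j x.2) * a1 - quadCoeff i x.1 * a2

theorem quadCoeff_add_right (i : ℤ) (u a : ℕ) :
    quadCoeff i (u + a) * ((u + a).choose u : ℂ) = quadCoeff i u * quadCoeff (i + 2 * u) a := by
  induction a with
  | zero => simp [quadCoeff_zero_right]
  | succ a ih =>
    have h1 : ((a : ℂ) + 1) ≠ 0 := by exact_mod_cast Nat.succ_ne_zero a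
    apply mul_left_cancel₀ h1
    have h2 := quadCoeff_succ i (u + a)
    have h3 := quadCoeff_succ (i + 2 * u) a
    have h4 : ((u : ℂ) + a + 1) * ((u + a).choose u : ℂ)
        = ((u + (a + 1)).choose u : ℂ) * ((a : ℂ) + 1) := by
      have := Nat.add_one_mul_choose_eq (u + a) a
      rw [Nat.choose_symm_add, ← add_assoc]
      have e : (u + a + 1).choose u = (u + a + 1).choose (a + 1) := by
        rw [← Nat.choose_symm_of_eq_add (by ring : u + a + 1 = u + (a + 1))]
      rw [e]
      exact_mod_cast this
    have h5 : ((u : ℂ) + a + 1) ≠ 0 := by exact_mod_cast Nat.succ_ne_zero (u + a)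
    push_cast at h2 h3
    rw [← add_assoc] at *
    linear_combination quadCoeff i (u + a + 1) * (-h4)
      + ((u + a).choose u : ℂ) * h2 + (2 * (u + a : ℂ) + i) * ih - quadCoeff i u * h3

end Coefficients

section Leibniz
open Finset
variable {R : Type*} [CommRing R] [Algebra ℂ R]

theorem derivation_pow_mul (δ : Derivation ℂ R R) (n : ℕ) (f g : R) :
    ((δ : R →ₗ[ℂ] R) ^ n) (f * g) = ∑ x ∈ antidiagonal n,
      ((n.choose x.1 : ℂ)) • (((δ : R →ₗ[ℂ] R) ^ x.1) f * ((δ : R →ₗ[ℂ] R) ^ x.2) g) := by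
  induction n with
  | zero => simp
  | succ n ih =>
    have := Finset.sum_antidiagonal_choose_succ_nsmul
      (fun a b => (((δ : R →ₗ[ℂ] R) ^ a) f * ((δ : R →ₗ[ℂ] R) ^ b) g)) n
    simp only [Nat.cast_smul_eq_nsmul] at ih ⊢
    rw [this, pow_succ', Module.End.mul_apply, ih, map_sum, ← Finset.sum_add_distrib]
    refine Finset.sum_congr rfl fun x hx => ?_
    rw [map_nsmul, pow_succ', pow_succ', Module.End.mul_apply, Module.End.mul_apply]
    simp only [Derivation.coeFn_coe, Derivation.leibniz, smul_eq_mul, nsmul_add, mul_comm]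
    have e : n.choose x.1 = n.choose x.2 := (Nat.choose_symm_of_eq_add (by have := Finset.HasAntidiagonal.mem_antidiagonal.mp hx; omega))
    rw [e]
end Leibniz

section Ring
open Finset
variable {R : Type*} [CommRing R] [Algebra ℂ R]

/-- Two-sided sequences `(f_i)_{i ∈ ℤ}` of elements of `R` with `f_i = 0` for `i` small enough:
the left `R`-module of Laurent series `∑ f_i y^i`. -/
def laurentSubmodule (R : Type*) [CommRing R] [Algebra ℂ R] : Submodule ℂ (ℤ → R) where
  carrier := {p | ∃ a : ℤ, ∀ i < a, p i = 0}
  zero_mem' := ⟨0, fun _ _ => rfl⟩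
  add_mem' := by
    rintro p q ⟨a, ha⟩ ⟨b, hb⟩
    refine ⟨min a b, fun i hi => ?_⟩
    simp [ha i (lt_of_lt_of_le hi (min_le_left _ _)), hb i (lt_of_lt_of_le hi (min_le_right _ _))]
  smul_mem' := by
    rintro c p ⟨a, ha⟩
    exact ⟨a, fun i hi => by simp [ha i hi]⟩

/-- The underlying space of the ring `C = R((y; δ))₂` of quadratic formal pseudodifferential
operators in the derivation `δ`; an element is a Laurent series `∑_{i ≥ a} f_i y^i`. -/
def QPDO (_δ : Derivation ℂ R R) : Type _ := laurentSubmodule R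

namespace QPDO
variable {δ : Derivation ℂ R R}

noncomputable instance : AddCommGroup (QPDO δ) := inferInstanceAs (AddCommGroup (laurentSubmodule R))
noncomputable instance : Module ℂ (QPDO δ) := inferInstanceAs (Module ℂ (laurentSubmodule R))

/-- The coefficient `f_i` of `q = ∑ f_i y^i`. -/
def coeff (q : QPDO δ) (i : ℤ) : R := q.1 i

theorem exists_lower (q : QPDO δ) : ∃ a : ℤ, ∀ i < a, q.coeff i = 0 := q.2

@[ext] theorem ext {p q : QPDO δ} (h : ∀ i, p.coeff i = q.coeff i) : p = q :=
  Subtype.ext (funext h)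

@[simp] theorem coeff_zero (i : ℤ) : (0 : QPDO δ).coeff i = 0 := rfl
@[simp] theorem coeff_add (p q : QPDO δ) (i : ℤ) : (p + q).coeff i = p.coeff i + q.coeff i := rfl
@[simp] theorem coeff_neg (p : QPDO δ) (i : ℤ) : (-p).coeff i = -p.coeff i := rfl
@[simp] theorem coeff_sub (p q : QPDO δ) (i : ℤ) : (p - q).coeff i = p.coeff i - q.coeff i := rfl
@[simp] theorem coeff_smul (c : ℂ) (p : QPDO δ) (i : ℤ) : (c • p).coeff i = c • p.coeff i := rfl

/-- The monomial `f y^i`. -/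
noncomputable def monomial (δ : Derivation ℂ R R) (i : ℤ) (f : R) : QPDO δ :=
  ⟨Pi.single i f, i, fun _ hj => by simp [hj.ne]⟩

theorem coeff_monomial (i j : ℤ) (f : R) :
    (monomial δ i f).coeff j = if j = i then f else 0 := by
  simp only [coeff, monomial, Pi.single_apply]

/-- The `(i, u)` contribution to the coefficient of `y^N` in a product: it comes from
`f_i y^i · g_j y^j = ∑_u quadCoeff i u • f_i δ^u(g_j) y^{i+j+2u}` with `i + j + 2u = N`. -/
noncomputable def mulTerm (p q : QPDO δ) (N : ℤ) (x : ℤ × ℕ) : R :=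
  quadCoeff x.1 x.2 • (p.coeff x.1 * ((δ : R →ₗ[ℂ] R) ^ x.2) (q.coeff (N - x.1 - 2 * x.2)))

theorem mulTerm_ne_zero {p q : QPDO δ} {N a b : ℤ} (ha : ∀ i < a, p.coeff i = 0)
    (hb : ∀ i < b, q.coeff i = 0) {x : ℤ × ℕ} (hx : mulTerm p q N x ≠ 0) :
    a ≤ x.1 ∧ b ≤ N - x.1 - 2 * x.2 := by
  constructor
  · by_contra! h
    exact hx (by simp [mulTerm, ha _ h])
  · by_contra! h
    exact hx (by simp [mulTerm, hb _ h])

theorem mulTerm_support_finite (p q : QPDO δ) (N : ℤ) :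
    (Function.support (mulTerm p q N)).Finite := by
  obtain ⟨a, ha⟩ := p.exists_lower
  obtain ⟨b, hb⟩ := q.exists_lower
  refine ((Set.finite_Icc a (N - b)).prod (Set.finite_Iic (N - a - b).toNat)).subset ?_
  intro x hx
  obtain ⟨h1, h2⟩ := mulTerm_ne_zero ha hb hx
  simp only [Set.mem_prod, Set.mem_Icc, Set.mem_Iic]
  omega

/-- The product of `C = R((y; δ))₂`; each coefficient is a finite sum. -/
noncomputable instance : Mul (QPDO δ) where
  mul p q := ⟨fun N => ∑ᶠ x, mulTerm p q N x, by
    obtain ⟨a, ha⟩ := p.exists_lower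
    obtain ⟨b, hb⟩ := q.exists_lower
    refine ⟨a + b, fun N hN => ?_⟩
    show ∑ᶠ x, mulTerm p q N x = 0
    rw [finsum_eq_zero_of_forall_eq_zero]
    intro x
    by_contra hx
    obtain ⟨h1, h2⟩ := mulTerm_ne_zero ha hb hx
    omega⟩

theorem coeff_mul (p q : QPDO δ) (N : ℤ) : (p * q).coeff N = ∑ᶠ x, mulTerm p q N x := rfl

theorem coeff_mul_eq_zero {p q : QPDO δ} {a b : ℤ} (ha : ∀ i < a, p.coeff i = 0)
    (hb : ∀ i < b, q.coeff i = 0) : ∀ N < a + b, (p * q).coeff N = 0 := by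
  intro N hN
  rw [coeff_mul, finsum_eq_zero_of_forall_eq_zero]
  intro x
  by_contra hx
  obtain ⟨h1, h2⟩ := mulTerm_ne_zero ha hb hx
  omega

protected theorem add_mul (p q r : QPDO δ) : (p + q) * r = p * r + q * r := by
  ext N
  rw [coeff_add, coeff_mul, coeff_mul, coeff_mul,
    ← finsum_add_distrib (mulTerm_support_finite p r N) (mulTerm_support_finite q r N)]
  exact finsum_congr fun x => by simp [mulTerm, add_mul]

protected theorem mul_add (p q r : QPDO δ) : p * (q + r) = p * q + p * r := by
  ext N
  rw [coeff_add, coeff_mul, coeff_mul, coeff_mul,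
    ← finsum_add_distrib (mulTerm_support_finite p q N) (mulTerm_support_finite p r N)]
  exact finsum_congr fun x => by simp [mulTerm, mul_add]

noncomputable instance : NonUnitalNonAssocRing (QPDO δ) where
  left_distrib := QPDO.mul_add
  right_distrib := QPDO.add_mul
  zero_mul p := by
    ext N
    rw [coeff_mul, finsum_eq_zero_of_forall_eq_zero]
    · rfl
    · intro x
      simp [mulTerm]
  mul_zero p := by
    ext N
    rw [coeff_mul, finsum_eq_zero_of_forall_eq_zero]
    · rfl
    · intro x
      simp [mulTerm]

theorem coeff_monomial_mul (i : ℤ) (f : R) (q : QPDO δ) (N : ℤ) :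
    (monomial δ i f * q).coeff N =
      ∑ᶠ u : ℕ, quadCoeff i u • (f * ((δ : R →ₗ[ℂ] R) ^ u) (q.coeff (N - i - 2 * u))) := by
  rw [coeff_mul]
  have hinj : Set.InjOn (fun u : ℕ => ((i, u) : ℤ × ℕ)) (Set.univ) := by
    intro a _ b _ h; simpa using h
  rw [← finsum_mem_univ, ← finsum_mem_univ
    (f := fun u : ℕ => quadCoeff i u • (f * ((δ : R →ₗ[ℂ] R) ^ u) (q.coeff (N - i - 2 * u))))]
  have h1 := finsum_mem_image (f := mulTerm (monomial δ i f) q N) hinj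
  have h2 : (∑ᶠ u ∈ (Set.univ : Set ℕ), mulTerm (monomial δ i f) q N (i, u)) =
      ∑ᶠ u ∈ (Set.univ : Set ℕ),
        quadCoeff i u • (f * ((δ : R →ₗ[ℂ] R) ^ u) (q.coeff (N - i - 2 * u))) :=
    finsum_congr fun u => by simp [mulTerm, coeff_monomial]
  rw [← h2, ← h1]
  refine finsum_mem_inter_support_eq _ _ _ ?_
  ext x
  simp only [Set.image_univ, Set.mem_inter_iff, Set.mem_range, Function.mem_support, Set.mem_univ,
    true_and, iff_and_self]
  intro hx
  have : x.1 = i := by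
    by_contra h
    exact hx (by simp [mulTerm, coeff_monomial, h])
  exact ⟨x.2, by rw [← this]⟩

theorem coeff_mul_monomial (j : ℤ) (g : R) (p : QPDO δ) (N : ℤ) :
    (p * monomial δ j g).coeff N =
      ∑ᶠ u : ℕ, quadCoeff (N - j - 2 * u) u •
        (p.coeff (N - j - 2 * u) * ((δ : R →ₗ[ℂ] R) ^ u) g) := by
  rw [coeff_mul]
  have hinj : Set.InjOn (fun u : ℕ => ((N - j - 2 * u, u) : ℤ × ℕ)) (Set.univ) := by
    intro a _ b _ h
    exact (Prod.ext_iff.mp h).2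
  rw [← finsum_mem_univ, ← finsum_mem_univ
    (f := fun u : ℕ => quadCoeff (N - j - 2 * u) u •
        (p.coeff (N - j - 2 * u) * ((δ : R →ₗ[ℂ] R) ^ u) g))]
  have h1 := finsum_mem_image (f := mulTerm p (monomial δ j g) N) hinj
  have h2 : (∑ᶠ u ∈ (Set.univ : Set ℕ), mulTerm p (monomial δ j g) N (N - j - 2 * u, u)) =
      ∑ᶠ u ∈ (Set.univ : Set ℕ), quadCoeff (N - j - 2 * u) u •
        (p.coeff (N - j - 2 * u) * ((δ : R →ₗ[ℂ] R) ^ u) g) :=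
    finsum_congr fun u => by
      simp [mulTerm, coeff_monomial, show N - (N - j - 2 * (u : ℤ)) - 2 * u = j by ring]
  rw [← h2, ← h1]
  refine finsum_mem_inter_support_eq _ _ _ ?_
  ext x
  simp only [Set.image_univ, Set.mem_inter_iff, Set.mem_range, Function.mem_support, Set.mem_univ,
    true_and, iff_and_self]
  intro hx
  have : N - x.1 - 2 * x.2 = j := by
    by_contra h
    exact hx (by simp [mulTerm, coeff_monomial, h])
  exact ⟨x.2, Prod.ext (by simp only; omega) rfl⟩

theorem coeff_monomial_mul_monomial (i j : ℤ) (f g : R) (n : ℕ) :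
    (monomial δ i f * monomial δ j g).coeff (i + j + 2 * n) =
      quadCoeff i n • (f * ((δ : R →ₗ[ℂ] R) ^ n) g) := by
  rw [coeff_monomial_mul, finsum_eq_single _ n]
  · simp [coeff_monomial, show i + j + 2 * (n : ℤ) - i - 2 * n = j by ring]
  · intro u hu
    rw [coeff_monomial, if_neg (by omega)]
    simp

theorem coeff_monomial_mul_monomial_of_ne (i j : ℤ) (f g : R) (N : ℤ)
    (h : ∀ n : ℕ, N ≠ i + j + 2 * n) : (monomial δ i f * monomial δ j g).coeff N = 0 := by
  rw [coeff_monomial_mul, finsum_eq_zero_of_forall_eq_zero]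
  intro u
  rw [coeff_monomial, if_neg (by have := h u; omega)]
  simp

theorem finsum_nat_eq_antidiagonal {S : Type*} [AddCommMonoid S] (n : ℕ) (F : ℕ → S)
    (G : ℕ × ℕ → S)
    (h0 : ∀ v, n < v → F v = 0) (h : ∀ x ∈ antidiagonal n, F x.2 = G x) :
    ∑ᶠ v, F v = ∑ x ∈ antidiagonal n, G x := by
  rw [← Finset.sum_congr rfl h]
  have e : ∑ x ∈ antidiagonal n, F x.2 = ∑ v ∈ range (n + 1), F v := by
    rw [← Finset.Nat.sum_antidiagonal_swap, Finset.Nat.sum_antidiagonal_eq_sum_range_succ_mk]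
    rfl
  rw [e]
  apply finsum_eq_finsetSum_of_support_subset
  intro v hv
  simp only [coe_range, Set.mem_Iio]
  by_contra! hlt
  exact hv (h0 v (by omega))

theorem monomial_mul_assoc (i j l : ℤ) (f g h : R) :
    monomial δ i f * monomial δ j g * monomial δ l h =
      monomial δ i f * (monomial δ j g * monomial δ l h) := by
  ext N
  rw [coeff_mul_monomial, coeff_monomial_mul]
  by_cases hN : ∃ n : ℕ, N = i + j + l + 2 * n
  · obtain ⟨n, rfl⟩ := hN
    rw [finsum_nat_eq_antidiagonal n _ (fun x => (quadCoeff (i + j + 2 * x.1) x.2 * quadCoeff i x.1) •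
          (f * ((δ : R →ₗ[ℂ] R) ^ x.1) g * ((δ : R →ₗ[ℂ] R) ^ x.2) h)),
      finsum_nat_eq_antidiagonal n _ (fun x => (quadCoeff i x.2 * quadCoeff j x.1) •
          (f * ((δ : R →ₗ[ℂ] R) ^ x.2) (g * ((δ : R →ₗ[ℂ] R) ^ x.1) h)))]
    · have hL : ∀ x ∈ antidiagonal n, (quadCoeff (i + j + 2 * x.1) x.2 * quadCoeff i x.1) •
            (f * ((δ : R →ₗ[ℂ] R) ^ x.1) g * ((δ : R →ₗ[ℂ] R) ^ x.2) h) =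
          ∑ y ∈ antidiagonal x.2, (quadCoeff (i + 2 * x.1) y.1 * quadCoeff j y.2 * quadCoeff i x.1) •
            (f * ((δ : R →ₗ[ℂ] R) ^ x.1) g * ((δ : R →ₗ[ℂ] R) ^ (y.1 + y.2)) h) := by
        intro x _
        rw [show i + j + 2 * (x.1 : ℤ) = (i + 2 * x.1) + j by ring, quadCoeff_vandermonde,
          Finset.sum_mul, Finset.sum_smul]
        refine Finset.sum_congr rfl fun y hy => ?_
        rw [Finset.HasAntidiagonal.mem_antidiagonal.mp hy]
      have hR : ∀ x ∈ antidiagonal n, (quadCoeff i x.2 * quadCoeff j x.1) •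
            (f * ((δ : R →ₗ[ℂ] R) ^ x.2) (g * ((δ : R →ₗ[ℂ] R) ^ x.1) h)) =
          ∑ y ∈ antidiagonal x.2, (quadCoeff (i + 2 * y.1) y.2 * quadCoeff j x.1 * quadCoeff i y.1) •
            (f * ((δ : R →ₗ[ℂ] R) ^ y.1) g * ((δ : R →ₗ[ℂ] R) ^ (y.2 + x.1)) h) := by
        intro x _
        rw [derivation_pow_mul, Finset.mul_sum, Finset.smul_sum]
        refine Finset.sum_congr rfl fun y hy => ?_
        have e := quadCoeff_add_right i y.1 y.2
        rw [Finset.HasAntidiagonal.mem_antidiagonal.mp hy] at e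
        rw [mul_smul_comm, smul_smul, pow_add, Module.End.mul_apply, mul_assoc f]
        congr 1
        linear_combination quadCoeff j x.1 * e
      rw [Finset.sum_congr rfl hL, Finset.sum_congr rfl hR]
      rw [Finset.sum_sigma', Finset.sum_sigma']
      refine Finset.sum_nbij' (fun z => ⟨(z.2.2, z.1.1 + z.2.1), (z.1.1, z.2.1)⟩)
        (fun z => ⟨(z.2.1, z.2.2 + z.1.1), (z.2.2, z.1.1)⟩) ?_ ?_ ?_ ?_ ?_
      · rintro ⟨⟨a, b⟩, ⟨c, d⟩⟩ hz
        simp only [Finset.mem_sigma, Finset.HasAntidiagonal.mem_antidiagonal] at hz ⊢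
        obtain ⟨h1, h2⟩ := hz
        refine ⟨?_, trivial⟩
        omega
      · rintro ⟨⟨a, b⟩, ⟨c, d⟩⟩ hz
        simp only [Finset.mem_sigma, Finset.HasAntidiagonal.mem_antidiagonal] at hz ⊢
        obtain ⟨h1, h2⟩ := hz
        refine ⟨?_, trivial⟩
        omega
      · rintro ⟨⟨a, b⟩, ⟨c, d⟩⟩ hz
        simp only [Finset.mem_sigma, Finset.HasAntidiagonal.mem_antidiagonal] at hz ⊢
        obtain ⟨h1, h2⟩ := hz
        subst h2
        rfl
      · rintro ⟨⟨a, b⟩, ⟨c, d⟩⟩ hz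
        simp only [Finset.mem_sigma, Finset.HasAntidiagonal.mem_antidiagonal] at hz ⊢
        obtain ⟨h1, h2⟩ := hz
        subst h2
        rfl
      · rintro ⟨⟨a, b⟩, ⟨c, d⟩⟩ hz
        rfl
    · intro v hv
      rw [show i + j + l + 2 * (n : ℤ) - i - 2 * v = j + l + 2 * (n - v : ℤ) by ring,
        coeff_monomial_mul_monomial_of_ne _ _ _ _ _ (by omega)]
      simp
    · intro x hx
      have hx' := Finset.HasAntidiagonal.mem_antidiagonal.mp hx
      rw [show i + j + l + 2 * (n : ℤ) - i - 2 * x.2 = j + l + 2 * (x.1 : ℕ) by omega,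
        coeff_monomial_mul_monomial, map_smul, mul_smul_comm, smul_smul]
    · intro v hv
      rw [coeff_monomial_mul_monomial_of_ne _ _ _ _ _ (by omega)]
      simp
    · intro x hx
      have hx' := Finset.HasAntidiagonal.mem_antidiagonal.mp hx
      rw [show i + j + l + 2 * (n : ℤ) - l - 2 * x.2 = i + j + 2 * (x.1 : ℕ) by omega,
        coeff_monomial_mul_monomial, smul_mul_assoc, smul_smul]
  · rw [finsum_eq_zero_of_forall_eq_zero, finsum_eq_zero_of_forall_eq_zero]
    · intro u
      rw [coeff_monomial_mul_monomial_of_ne]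
      · simp
      · intro n hn
        exact hN ⟨n + u, by push_cast; omega⟩
    · intro u
      rw [coeff_monomial_mul_monomial_of_ne]
      · simp
      · intro n hn
        exact hN ⟨n + u, by push_cast; omega⟩

/-- Every series is a finite sum of monomials plus a remainder of large valuation. -/
theorem exists_truncation (p : QPDO δ) (A : ℤ) : ∃ (s : Finset ℤ) (p' : QPDO δ),
    p = ∑ i ∈ s, monomial δ i (p.coeff i) + p' ∧ ∀ i < A, p'.coeff i = 0 := by
  obtain ⟨a, ha⟩ := p.exists_lower
  refine ⟨Finset.Ico a A, p - ∑ i ∈ Finset.Ico a A, monomial δ i (p.coeff i), by abel, ?_⟩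
  intro i hi
  have hsum : ∀ s : Finset ℤ, (∑ j ∈ s, monomial δ j (p.coeff j)).coeff i
      = ∑ j ∈ s, (monomial δ j (p.coeff j)).coeff i := by
    intro s
    induction s using Finset.induction_on with
    | empty => simp
    | insert b s hb ih => rw [Finset.sum_insert hb, Finset.sum_insert hb, coeff_add, ih]
  rw [coeff_sub, hsum]
  simp only [coeff_monomial]
  rw [Finset.sum_ite_eq]
  by_cases h : a ≤ i
  · simp [h, hi]
  · simp [h, ha i (not_le.mp h)]

protected theorem mul_assoc (p q r : QPDO δ) : p * q * r = p * (q * r) := by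
  have step3 : ∀ (i j : ℤ) (f g : R) (r : QPDO δ), monomial δ i f * monomial δ j g * r =
      monomial δ i f * (monomial δ j g * r) := by
    intro i j f g r
    ext N
    obtain ⟨s, r', hr, hr'⟩ := r.exists_truncation (N - i - j + 1)
    have hi : ∀ k < i, (monomial δ i f).coeff k = 0 := fun k hk => by
      rw [coeff_monomial, if_neg hk.ne]
    have hj : ∀ k < j, (monomial δ j g).coeff k = 0 := fun k hk => by
      rw [coeff_monomial, if_neg hk.ne]
    rw [hr]
    simp only [mul_add, Finset.mul_sum, monomial_mul_assoc, coeff_add]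
    rw [coeff_mul_eq_zero (coeff_mul_eq_zero hi hj) hr' N (by omega),
      coeff_mul_eq_zero hi (coeff_mul_eq_zero hj hr') N (by omega)]
  have step2 : ∀ (i : ℤ) (f : R) (q r : QPDO δ), monomial δ i f * q * r =
      monomial δ i f * (q * r) := by
    intro i f q r
    ext N
    obtain ⟨c, hc⟩ := r.exists_lower
    obtain ⟨s, q', hq, hq'⟩ := q.exists_truncation (N - i - c + 1)
    have hi : ∀ k < i, (monomial δ i f).coeff k = 0 := fun k hk => by
      rw [coeff_monomial, if_neg hk.ne]
    rw [hq]
    simp only [mul_add, add_mul, Finset.mul_sum, Finset.sum_mul, step3, coeff_add]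
    rw [coeff_mul_eq_zero (coeff_mul_eq_zero hi hq') hc N (by omega),
      coeff_mul_eq_zero hi (coeff_mul_eq_zero hq' hc) N (by omega)]
  ext N
  obtain ⟨b, hb⟩ := q.exists_lower
  obtain ⟨c, hc⟩ := r.exists_lower
  obtain ⟨s, p', hp, hp'⟩ := p.exists_truncation (N - b - c + 1)
  rw [hp]
  simp only [add_mul, Finset.sum_mul, step2, coeff_add]
  rw [coeff_mul_eq_zero (coeff_mul_eq_zero hp' hb) hc N (by omega),
    coeff_mul_eq_zero hp' (coeff_mul_eq_zero hb hc) N (by omega)]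

theorem coeff_monomial_zero_mul (f : R) (q : QPDO δ) (N : ℤ) :
    (monomial δ 0 f * q).coeff N = f * q.coeff N := by
  rw [coeff_monomial_mul, finsum_eq_single _ 0]
  · simp [quadCoeff_zero_right]
  · intro u hu
    obtain ⟨v, rfl⟩ := Nat.exists_eq_succ_of_ne_zero hu
    simp [quadCoeff_zero_left]

noncomputable instance : Ring (QPDO δ) where
  __ := (inferInstance : NonUnitalNonAssocRing (QPDO δ))
  mul_assoc := QPDO.mul_assoc
  one := monomial δ 0 1
  one_mul q := by
    ext N
    exact (coeff_monomial_zero_mul 1 q N).trans (one_mul _)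
  mul_one q := by
    ext N
    refine (coeff_mul_monomial 0 1 q N).trans ?_
    rw [finsum_eq_single _ 0]
    · simp [quadCoeff_zero_right]
    · intro u hu
      obtain ⟨v, rfl⟩ := Nat.exists_eq_succ_of_ne_zero hu
      rw [pow_succ, Module.End.mul_apply]
      simp

/-- The inclusion `R ⊂ C`. -/
noncomputable def const (δ : Derivation ℂ R R) (f : R) : QPDO δ := monomial δ 0 f

/-- The generator `y` of `C = R((y; δ))₂`. -/
noncomputable def y (δ : Derivation ℂ R R) : QPDO δ := monomial δ 1 1

theorem smul_eq_const_mul (c : ℂ) (q : QPDO δ) : c • q = const δ (algebraMap ℂ R c) * q := by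
  ext N
  rw [const, coeff_monomial_zero_mul, coeff_smul, Algebra.smul_def]

end QPDO
end Ring

section Homographic

/-- The filter whose members contain all but countably many points of `U`. -/
noncomputable def offCountable (U : Set ℂ) : Filter ℂ := Filter.cocountable ⊓ Filter.principal U

theorem eventually_offCountable {U : Set ℂ} {p : ℂ → Prop} :
    (∀ᶠ z in offCountable U, p z) ↔ {z | z ∈ U ∧ ¬ p z}.Countable := by
  rw [offCountable, Filter.eventually_inf_principal, Filter.Eventually, Filter.mem_cocountable]
  have : {z | z ∈ U → p z}ᶜ = {z | z ∈ U ∧ ¬ p z} := by ext z; simp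
  rw [this]

/-- The denominator `cz + d`. -/
def denomAt (γ : Matrix.SpecialLinearGroup (Fin 2) ℂ) (z : ℂ) : ℂ := γ 1 0 * z + γ 1 1

/-- The homography `z ↦ (az + b) / (cz + d)`. -/
noncomputable def moebius (γ : Matrix.SpecialLinearGroup (Fin 2) ℂ) (z : ℂ) : ℂ :=
  (γ 0 0 * z + γ 0 1) / denomAt γ z

/-- A commutative `ℂ`-algebra `R` of functions of one complex variable `z`, in the setting of the
homographic action of a subgroup `Γ` of `SL(2, ℂ)`. The elements of `R` are functions on a nonempty
open set `U`; as they may have poles, values are only relevant up to countable subsets of `U`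
(this covers holomorphic and meromorphic functions on the upper half-plane, and `ℂ(z)` on
`U = ℂ`). The last three fields say that `R` is stable under `f ↦ f((az+b)/(cz+d))`, that
`cz + d` is an invertible element of `R`, and that `R` is stable under `d/dz`. -/
structure HomographicAlgebra (Γ : Subgroup (Matrix.SpecialLinearGroup (Fin 2) ℂ))
    (R : Type*) [CommRing R] [Algebra ℂ R] where
  U : Set ℂ
  isOpen_U : IsOpen U
  nonempty_U : U.Nonempty
  stable_U : ∀ γ ∈ Γ, ∀ z ∈ U, denomAt γ z ≠ 0 → moebius γ z ∈ U
  toFun : R → ℂ → ℂ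
  toFun_add : ∀ f g, ∀ᶠ z in offCountable U, toFun (f + g) z = toFun f z + toFun g z
  toFun_mul : ∀ f g, ∀ᶠ z in offCountable U, toFun (f * g) z = toFun f z * toFun g z
  toFun_const : ∀ c : ℂ, ∀ᶠ z in offCountable U, toFun (algebraMap ℂ R c) z = c
  toFun_injective : ∀ f g, (∀ᶠ z in offCountable U, toFun f z = toFun g z) → f = g
  exists_comp : ∀ γ ∈ Γ, ∀ f, ∃ g, ∀ᶠ z in offCountable U, toFun g z = toFun f (moebius γ z)
  exists_denom : ∀ γ ∈ Γ, ∃ u : Rˣ, ∀ᶠ z in offCountable U, toFun u z = denomAt γ z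
  exists_deriv : ∀ f, ∃ g, ∀ᶠ z in offCountable U, HasDerivAt (toFun f) (toFun g z) z

theorem hasDerivAt_unique_offCountable {U : Set ℂ} (hU : IsOpen U) {F G : ℂ → ℂ}
    (h : ∀ᶠ z in offCountable U, F z = G z) :
    ∀ᶠ z in offCountable U, ∀ a b, HasDerivAt F a z → HasDerivAt G b z → a = b := by
  have hE := eventually_offCountable.mp h
  filter_upwards [h, Filter.mem_inf_of_right (Filter.mem_principal_self U)] with z hz hzU a b ha hb
  set S : Set ℂ := {w | F w = G w} with hS
  have hacc : AccPt z (Filter.principal S) := by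
    rw [accPt_iff_nhds]
    intro V hV
    have hd := (hE.union (Set.countable_singleton z)).dense_compl ℝ
    obtain ⟨W, hWV, hWo, hzW⟩ := mem_nhds_iff.mp hV
    obtain ⟨w, hw1, hw2⟩ := hd.inter_open_nonempty (W ∩ U) (hWo.inter hU) ⟨z, hzW, hzU⟩
    refine ⟨w, ⟨hWV hw1.1, ?_⟩, fun hwz => hw2 (Or.inr hwz)⟩
    by_contra hne
    exact hw2 (Or.inl ⟨hw1.2, hne⟩)
  have hu := hacc.uniqueDiffWithinAt
  have h1 : HasDerivWithinAt F a S z := ha.hasDerivWithinAt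
  have h2 : HasDerivWithinAt F b S z :=
    hb.hasDerivWithinAt.congr (fun x hx => hx) hz
  exact hu.eq_deriv _ h1 h2

theorem det_eq_one_entries (γ : Matrix.SpecialLinearGroup (Fin 2) ℂ) :
    γ 0 0 * γ 1 1 - γ 0 1 * γ 1 0 = 1 := by
  have := γ.det_coe
  rwa [Matrix.det_fin_two] at this

theorem moebius_injOn (γ : Matrix.SpecialLinearGroup (Fin 2) ℂ) :
    Set.InjOn (moebius γ) {z | denomAt γ z ≠ 0} := by
  intro z hz w hw h
  simp only [Set.mem_ofPred_eq] at hz hw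
  rw [moebius, moebius, div_eq_div_iff hz hw] at h
  have hdet := det_eq_one_entries γ
  simp only [denomAt] at h
  linear_combination h - (z - w) * hdet

theorem denomAt_zero_countable (γ : Matrix.SpecialLinearGroup (Fin 2) ℂ) :
    {z | denomAt γ z = 0}.Countable := by
  apply Set.Subsingleton.countable
  intro z hz w hw
  simp only [Set.mem_ofPred_eq, denomAt] at hz hw
  have hdet := det_eq_one_entries γ
  by_cases hc : γ 1 0 = 0
  · simp [hc] at hz hdet
    simp [hz] at hdet
  · apply mul_left_cancel₀ hc
    linear_combination hz - hw

namespace HomographicAlgebra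

variable {Γ : Subgroup (Matrix.SpecialLinearGroup (Fin 2) ℂ)} {R : Type*} [CommRing R]
  [Algebra ℂ R] (H : HomographicAlgebra Γ R)

theorem tendsto_moebius (γ : Γ) :
    Filter.Tendsto (moebius γ) (offCountable H.U) (offCountable H.U) := by
  intro s hs
  have hs' : ∀ᶠ z in offCountable H.U, z ∈ s := hs
  rw [eventually_offCountable] at hs'
  change ∀ᶠ z in offCountable H.U, moebius γ z ∈ s
  rw [eventually_offCountable]
  have h2 : ({z | denomAt γ z ≠ 0} ∩ moebius γ ⁻¹' {z | z ∈ H.U ∧ ¬ z ∈ s}).Countable := by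
    refine Set.MapsTo.countable_of_injOn (f := moebius γ) (fun z hz => hz.2)
      ((moebius_injOn γ).mono Set.inter_subset_left) hs'
  refine ((denomAt_zero_countable γ).union h2).mono ?_
  rintro z ⟨hzU, hz⟩
  by_cases h : denomAt γ z = 0
  · exact Or.inl h
  · exact Or.inr ⟨h, H.stable_U γ γ.2 z hzU h, hz⟩

/-- The action `f ↦ f · γ`, `(f · γ)(z) = f((az+b)/(cz+d))`, of `γ ∈ Γ` on `R`. -/
noncomputable def comp (γ : Γ) : R →ₐ[ℂ] R :=
  have spec : ∀ f : R, ∀ᶠ z in offCountable H.U,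
      H.toFun (Classical.choose (H.exists_comp γ γ.2 f)) z = H.toFun f (moebius γ z) :=
    fun f => Classical.choose_spec (H.exists_comp γ γ.2 f)
  have hadd : ∀ f g : R, Classical.choose (H.exists_comp γ γ.2 (f + g)) =
      Classical.choose (H.exists_comp γ γ.2 f) + Classical.choose (H.exists_comp γ γ.2 g) := by
    intro f g
    apply H.toFun_injective
    filter_upwards [spec (f + g), spec f, spec g, H.toFun_add _ _,
      (H.tendsto_moebius γ).eventually (H.toFun_add f g)] with z h1 h2 h3 h4 h5
    rw [h1, h4, h5, h2, h3]
  have hmul : ∀ f g : R, Classical.choose (H.exists_comp γ γ.2 (f * g)) =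
      Classical.choose (H.exists_comp γ γ.2 f) * Classical.choose (H.exists_comp γ γ.2 g) := by
    intro f g
    apply H.toFun_injective
    filter_upwards [spec (f * g), spec f, spec g, H.toFun_mul _ _,
      (H.tendsto_moebius γ).eventually (H.toFun_mul f g)] with z h1 h2 h3 h4 h5
    rw [h1, h4, h5, h2, h3]
  have hconst : ∀ c : ℂ, Classical.choose (H.exists_comp γ γ.2 (algebraMap ℂ R c)) =
      algebraMap ℂ R c := by
    intro c
    apply H.toFun_injective
    filter_upwards [spec (algebraMap ℂ R c), H.toFun_const c,
      (H.tendsto_moebius γ).eventually (H.toFun_const c)] with z h1 h2 h3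
    rw [h1, h2, h3]
  { toFun := fun f => Classical.choose (H.exists_comp γ γ.2 f)
    map_one' := by simpa using hconst 1
    map_mul' := hmul
    map_zero' := by simpa using hconst 0
    map_add' := hadd
    commutes' := hconst }

theorem comp_spec (γ : Γ) (f : R) :
    ∀ᶠ z in offCountable H.U, H.toFun (H.comp γ f) z = H.toFun f (moebius γ z) :=
  Classical.choose_spec (H.exists_comp γ γ.2 f)

/-- The unit `s_γ : z ↦ cz + d` of `R`. -/
noncomputable def s (γ : Γ) : Rˣ := Classical.choose (H.exists_denom γ γ.2)

theorem s_spec (γ : Γ) : ∀ᶠ z in offCountable H.U, H.toFun (H.s γ) z = denomAt γ z :=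
  Classical.choose_spec (H.exists_denom γ γ.2)

/-- The standard derivation `∂_z` of `R`. -/
noncomputable def D : Derivation ℂ R R :=
  have spec : ∀ f : R, ∀ᶠ z in offCountable H.U,
      HasDerivAt (H.toFun f) (H.toFun (Classical.choose (H.exists_deriv f)) z) z :=
    fun f => Classical.choose_spec (H.exists_deriv f)
  have hadd : ∀ f g : R, Classical.choose (H.exists_deriv (f + g)) =
      Classical.choose (H.exists_deriv f) + Classical.choose (H.exists_deriv g) := by
    intro f g
    apply H.toFun_injective
    filter_upwards [spec (f + g), spec f, spec g, H.toFun_add _ _,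
      hasDerivAt_unique_offCountable (G := H.toFun f + H.toFun g) H.isOpen_U
        (H.toFun_add f g)] with z h1 h2 h3 h4 h5
    rw [h4]
    exact h5 _ _ h1 (h2.add h3)
  have hmul : ∀ f g : R, Classical.choose (H.exists_deriv (f * g)) =
      f * Classical.choose (H.exists_deriv g) + g * Classical.choose (H.exists_deriv f) := by
    intro f g
    apply H.toFun_injective
    filter_upwards [spec (f * g), spec f, spec g,
      H.toFun_add (f * Classical.choose (H.exists_deriv g))
        (g * Classical.choose (H.exists_deriv f)),
      H.toFun_mul f (Classical.choose (H.exists_deriv g)),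
      H.toFun_mul g (Classical.choose (H.exists_deriv f)),
      hasDerivAt_unique_offCountable (G := H.toFun f * H.toFun g) H.isOpen_U
        (H.toFun_mul f g)] with z h1 h2 h3 h4 h5 h6 h7
    rw [h4, h5, h6, h7 _ _ h1 (h2.mul h3)]
    ring
  have hconst : ∀ c : ℂ, Classical.choose (H.exists_deriv (algebraMap ℂ R c)) = 0 := by
    intro c
    apply H.toFun_injective
    have h0 := H.toFun_const 0
    rw [map_zero] at h0
    filter_upwards [spec (algebraMap ℂ R c), h0,
      hasDerivAt_unique_offCountable (G := fun _ => c) H.isOpen_U (H.toFun_const c)] with z h1 h2 h3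
    rw [h2]
    exact h3 _ _ h1 (hasDerivAt_const z c)
  Derivation.mk'
    { toFun := fun f => Classical.choose (H.exists_deriv f)
      map_add' := hadd
      map_smul' := fun c f => by
        simp only [RingHom.id_apply, Algebra.smul_def]
        rw [hmul, hconst, mul_zero, add_zero] }
    (fun f g => by simpa using hmul f g)

theorem D_spec (f : R) :
    ∀ᶠ z in offCountable H.U, HasDerivAt (H.toFun f) (H.toFun (H.D f) z) z :=
  Classical.choose_spec (H.exists_deriv f)

/-- The entry `c` of `γ`, as a complex number. -/
def lowerLeft (γ : Γ) : ℂ := (γ : Matrix.SpecialLinearGroup (Fin 2) ℂ) 1 0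

/-- The derivation `δ = -½ ∂_z` of `R`. -/
noncomputable def delta : Derivation ℂ R R := (-(1 / 2 : ℂ)) • H.D

/-- `σ` is the automorphism `q ↦ q · γ` of `C = R((y; -½∂_z))₂`: it extends the homographic action
of `γ` on `R`, and it sends `y` to the square root of `x (cz+d)^{-2}`, where `x = y²`, whose term
of minimal valuation is `(cz+d)^{-1} y`. -/
structure IsAction (γ : Γ) (σ : QPDO H.delta ≃+* QPDO H.delta) : Prop where
  map_const : ∀ f : R, σ (QPDO.const H.delta f) = QPDO.const H.delta (H.comp γ f)
  map_y_sq : σ (QPDO.y H.delta) * σ (QPDO.y H.delta) =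
    QPDO.y H.delta * QPDO.y H.delta * QPDO.const H.delta (((H.s γ)⁻¹ ^ 2 : Rˣ) : R)
  coeff_map_y_lt : ∀ i < (1 : ℤ), (σ (QPDO.y H.delta)).coeff i = 0
  coeff_map_y_one : (σ (QPDO.y H.delta)).coeff 1 = (((H.s γ)⁻¹ : Rˣ) : R)

/-- The space `C_k^Γ` of the `Γ`-invariant elements of `C = R((y; -½∂_z))₂` of `y`-valuation at
least `k`. -/
def invariants (k : ℤ) : Submodule ℂ (QPDO H.delta) where
  carrier := {q | (∀ i < k, q.coeff i = 0) ∧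
    ∀ (γ : Γ) (σ : QPDO H.delta ≃+* QPDO H.delta), H.IsAction γ σ → σ q = q}
  zero_mem' := ⟨fun _ _ => rfl, fun _ σ _ => map_zero σ⟩
  add_mem' := by
    rintro p q ⟨hp, hp'⟩ ⟨hq, hq'⟩
    refine ⟨fun i hi => by simp [hp i hi, hq i hi], fun γ σ hσ => ?_⟩
    rw [map_add, hp' γ σ hσ, hq' γ σ hσ]
  smul_mem' := by
    rintro c q ⟨hq, hq'⟩
    refine ⟨fun i hi => by simp [hq i hi], fun γ σ hσ => ?_⟩
    rw [QPDO.smul_eq_const_mul, map_mul, hσ.map_const, hq' γ σ hσ, AlgHom.commutes]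

/-- The space `M_k` of algebraic modular forms of weight `k` on `R`:
`f((az+b)/(cz+d)) = (cz+d)^k f(z)` for all elements of `Γ`. -/
def modularForms (k : ℕ) : Submodule ℂ R where
  carrier := {f | ∀ γ : Γ, H.comp γ f = (H.s γ : R) ^ k * f}
  zero_mem' := fun γ => by simp
  add_mem' := fun {f g} hf hg γ => by rw [map_add, hf γ, hg γ, mul_add]
  smul_mem' := fun c f hf γ => by rw [map_smul, hf γ, mul_smul_comm]

end HomographicAlgebra

/-- The formal power series `exp(a Z²) = ∑ a^n Z^{2n} / n!`. -/
noncomputable def expSq {R : Type*} [CommRing R] [Algebra ℂ R] (a : R) : PowerSeries R :=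
  PowerSeries.mk fun n => if Even n then ((1 : ℂ) / ((n / 2).factorial : ℂ)) • a ^ (n / 2) else 0

namespace HomographicAlgebra

variable {Γ : Subgroup (Matrix.SpecialLinearGroup (Fin 2) ℂ)} {R : Type*} [CommRing R]
  [Algebra ℂ R] (H : HomographicAlgebra Γ R)

/-- The space `J_{k,m}` of algebraic Jacobi forms on `R` of weight `k` and index `m`: expansions
`Φ(z, Z) = ∑ X_ν(z) Z^ν` with `X_ν ∈ R` satisfying, for all elements of `Γ`,
`Φ((az+b)/(cz+d), Z/(cz+d)) = (cz+d)^k exp(2πi m c Z²/(cz+d)) Φ(z, Z)`. -/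
noncomputable def jacobiForms (k m : ℕ) : Submodule ℂ (PowerSeries R) where
  carrier := {Φ | ∀ γ : Γ,
    PowerSeries.rescale (((H.s γ)⁻¹ : Rˣ) : R) (PowerSeries.map (H.comp γ : R →+* R) Φ) =
      PowerSeries.C ((H.s γ : R) ^ k) *
        expSq ((2 * Real.pi * Complex.I * m * lowerLeft γ : ℂ) • (((H.s γ)⁻¹ : Rˣ) : R)) * Φ}
  zero_mem' := fun γ => by simp
  add_mem' := fun {Φ Φ'} h h' γ => by rw [map_add, map_add, h γ, h' γ, mul_add]
  smul_mem' := fun c Φ h γ => by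
    have h1 : PowerSeries.map (H.comp γ : R →+* R) (c • Φ) =
        c • PowerSeries.map (H.comp γ : R →+* R) Φ := by
      ext n; simp
    have h2 : ∀ (r : R) (F : PowerSeries R),
        PowerSeries.rescale r (c • F) = c • PowerSeries.rescale r F := by
      intro r F; ext n; simp [PowerSeries.coeff_rescale]
    rw [h1, h2, h γ, mul_smul_comm]

/-- The coefficient `(-1)^n / (4^n n!) ∏_{i=0}^{n-1} (j+2i)(j+2i+2)/(j+i)` of `f^{(n)} y^{j+2n}` in
`ψ_j(f)`. For `n ≥ 1` the factor `j` common to numerator and denominator of the product has been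
cancelled, so that the formula also makes sense for `j = 0`. -/
noncomputable def psiCoeff (j n : ℕ) : ℂ :=
  (-1) ^ n / (4 ^ n * (n.factorial : ℂ)) *
    ((∏ i ∈ Finset.range n, ((j : ℂ) + 2 * i + 2)) *
      ∏ i ∈ Finset.Ico 1 n, (((j : ℂ) + 2 * i) / ((j : ℂ) + i)))

/-- The lift `ψ_j(f) = ∑_n psiCoeff j n • f^{(n)} y^{j+2n}`. -/
noncomputable def psi (j : ℕ) (f : R) : QPDO H.delta :=
  ⟨fun N => if (j : ℤ) ≤ N ∧ Even (N - j) then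
      psiCoeff j ((N - j) / 2).toNat • ((H.D : R →ₗ[ℂ] R) ^ ((N - j) / 2).toNat) f else 0,
    j, fun N hN => by simp [not_le.mpr hN]⟩

/-- The expansion `∑_n (2πi m)^n (j-1)! / (n! (j+n-1)!) f^{(n)} Z^{2n}`, for `j ≥ 1`. -/
noncomputable def jacobiLift (m j : ℕ) (f : R) : PowerSeries R :=
  PowerSeries.mk fun N => if Even N then
    ((2 * Real.pi * Complex.I * m : ℂ) ^ (N / 2) * ((j - 1).factorial : ℂ) /
      (((N / 2).factorial : ℂ) * ((j + N / 2 - 1).factorial : ℂ))) •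
        ((H.D : R →ₗ[ℂ] R) ^ (N / 2)) f else 0

end HomographicAlgebra
end Homographic

/-! ### Series with exponents in a class `i + 2ℕ`, and leading coefficients -/

namespace QPDO
open Finset
variable {R : Type*} [CommRing R] [Algebra ℂ R] {δ : Derivation ℂ R R}

/-! Write s = cz+d. Since δ = -½∂_z, one has y⁻² f = f y⁻² + f', so y⁻² behaves like ∂_z. A
homography replaces ∂_z by s²∂_z, hence must send y⁻² to s² y⁻²; the images of the other powers of y
are the series `eta i`.

Both spaces are instances of one construction. For a table of constants ε, the operator `tw ε` sends
f y^i to (f·γ) ∑_v ε(i,v) c^v s^{-i-v} y^{i+2v}. With ε = `twistCoeff` it is the automorphism of C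
attached to γ. With ε(i,v) = (-2πim)^v/v!, and Z^ν placed in degree k+ν, being fixed by it is the
functional equation of Jacobi forms (`tw_eq_self_iff`). So C_k^Γ and J_{k,m} both consist of the
series of valuation at least k fixed by all the operators of a family (`fixedSpace`). As ε(i,0) = 1,
the leading coefficient of a fixed series in degree j is a modular form of weight j. Once each
modular form is lifted linearly to a fixed series that it leads, successive subtraction of lifts
identifies the fixed space with ∏ M_j (`exists_linearEquiv_of_lifts`).

The lifts are ∑ λ_n f^{(n)} y^{j+2n}. Invariance reduces to one numerical relation between λ and ε
(`tw_serLift`), because an alternating sum of binomial type vanishes. The argument divides by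
j(j+1)⋯, so weight 0 is separate: ψ_0(f) = f - ½ψ_2(f') in C, and f·exp(2πim φ Z²) for Jacobi forms.

Multiplicativity of the twist rests on eta i · eta j = eta (i+j): the homogeneous series commuting
with s² y⁻² in a given degree form a line. Uniqueness of the action rests on automatic continuity:
series 1 + (positive valuation) have 2^n-th roots for all n, which forbids poles in their images.
The product is then transported, and the first Rankin-Cohen bracket is a coefficient of a
commutator. -/

/-- The series `∑_n a_n y^{i+2n}`. -/
noncomputable def ser (δ : Derivation ℂ R R) (i : ℤ) (a : ℕ → R) : QPDO δ :=
  ⟨fun N => if i ≤ N ∧ Even (N - i) then a ((N - i) / 2).toNat else 0,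
    i, fun N hN => by simp [not_le.mpr hN]⟩

theorem coeff_ser (i : ℤ) (a : ℕ → R) (n : ℕ) : (ser δ i a).coeff (i + 2 * n) = a n := by
  have h : i ≤ i + 2 * (n : ℤ) ∧ Even (i + 2 * (n : ℤ) - i) := ⟨by omega, n, by ring⟩
  simp only [coeff, ser]
  rw [if_pos h]
  congr 1
  omega

theorem coeff_ser_of_ne (i : ℤ) (a : ℕ → R) {N : ℤ} (h : ∀ n : ℕ, N ≠ i + 2 * n) :
    (ser δ i a).coeff N = 0 := by
  simp only [coeff, ser]
  rw [if_neg]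
  rintro ⟨h1, r, hr⟩
  exact h r.toNat (by omega)

theorem coeff_ser_of_lt (i : ℤ) (a : ℕ → R) {N : ℤ} (h : N < i) : (ser δ i a).coeff N = 0 :=
  coeff_ser_of_ne i a fun n => by omega

theorem coeff_ser_self (i : ℤ) (a : ℕ → R) : (ser δ i a).coeff i = a 0 := by
  simpa using coeff_ser (δ := δ) i a 0

theorem eq_ser {q : QPDO δ} {i : ℤ} {a : ℕ → R} (h : ∀ n : ℕ, q.coeff (i + 2 * n) = a n)
    (h0 : ∀ N, (∀ n : ℕ, N ≠ i + 2 * n) → q.coeff N = 0) : q = ser δ i a := by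
  ext N
  by_cases hN : ∃ n : ℕ, N = i + 2 * n
  · obtain ⟨n, rfl⟩ := hN
    rw [h, coeff_ser]
  · push Not at hN
    rw [h0 N hN, coeff_ser_of_ne i a hN]

theorem monomial_eq_ser (i : ℤ) (f : R) : monomial δ i f = ser δ i (Pi.single 0 f) := by
  apply eq_ser
  · intro n
    rw [coeff_monomial, Pi.single_apply]
    congr 1
    simp
  · intro N hN
    rw [coeff_monomial, if_neg (by simpa using hN 0)]

theorem ser_mul_ser (i j : ℤ) (a b : ℕ → R) :
    ser δ i a * ser δ j b = ser δ (i + j) (fun n => ∑ x ∈ antidiagonal n, ∑ z ∈ antidiagonal x.2,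
      quadCoeff (i + 2 * x.1) z.1 • (a x.1 * ((δ : R →ₗ[ℂ] R) ^ z.1) (b z.2))) := by
  apply eq_ser
  · intro n
    rw [coeff_mul]
    let s : Finset (Σ _ : ℕ × ℕ, ℕ × ℕ) := (antidiagonal n).sigma fun x => antidiagonal x.2
    -- A triple p + u + v = n stands for the product of a_p y^{i+2p} and b_v y^{j+2v} in which δ has
    -- been applied u times; `g` forgets v, which n determines.
    let g : (Σ _ : ℕ × ℕ, ℕ × ℕ) → ℤ × ℕ := fun z => (i + 2 * z.1.1, z.2.1)
    have hg : Set.InjOn g s := by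
      rintro ⟨⟨p, q⟩, ⟨u, v⟩⟩ hz ⟨⟨p', q'⟩, ⟨u', v'⟩⟩ hz' h
      simp only [s, coe_sigma, Set.mem_sigma_iff, mem_coe, HasAntidiagonal.mem_antidiagonal]
        at hz hz'
      simp only [g, Prod.mk.injEq] at h
      obtain ⟨h1, h2⟩ := hz
      obtain ⟨h3, h4⟩ := hz'
      obtain ⟨h5, h6⟩ := h
      have e1 : p = p' := by omega
      subst e1
      have e2 : q = q' := by omega
      subst e2
      have e3 : u = u' := by omega
      subst e3
      have e4 : v = v' := by omega
      subst e4
      rfl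
    rw [finsum_eq_finsetSum_of_support_subset (s := s.image g), sum_image hg, sum_sigma]
    · refine sum_congr rfl fun x hx => sum_congr rfl fun z hz => ?_
      have hx' := HasAntidiagonal.mem_antidiagonal.mp hx
      have hz' := HasAntidiagonal.mem_antidiagonal.mp hz
      simp only [g, mulTerm]
      rw [coeff_ser, show i + j + 2 * (n : ℤ) - (i + 2 * x.1) - 2 * z.1 = j + 2 * (z.2 : ℕ) by omega,
        coeff_ser]
    · intro x hx
      have h1 : ∃ p : ℕ, x.1 = i + 2 * p := by
        by_contra! h
        exact hx (by simp [mulTerm, coeff_ser_of_ne i a h])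
      have h2 : ∃ v : ℕ, i + j + 2 * (n : ℤ) - x.1 - 2 * x.2 = j + 2 * v := by
        by_contra! h
        exact hx (by simp [mulTerm, coeff_ser_of_ne j b h])
      obtain ⟨p, hp⟩ := h1
      obtain ⟨v, hv⟩ := h2
      simp only [coe_image, Set.mem_image, mem_coe]
      refine ⟨⟨(p, x.2 + v), (x.2, v)⟩, ?_, Prod.ext hp.symm rfl⟩
      simp only [s, mem_sigma, HasAntidiagonal.mem_antidiagonal]
      exact ⟨by omega, trivial⟩
  · intro N hN
    rw [coeff_mul, finsum_eq_zero_of_forall_eq_zero]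
    intro x
    by_contra hx
    have h1 : ∃ p : ℕ, x.1 = i + 2 * p := by
      by_contra! h
      exact hx (by simp [mulTerm, coeff_ser_of_ne i a h])
    have h2 : ∃ v : ℕ, N - x.1 - 2 * x.2 = j + 2 * v := by
      by_contra! h
      exact hx (by simp [mulTerm, coeff_ser_of_ne j b h])
    obtain ⟨p, hp⟩ := h1
    obtain ⟨v, hv⟩ := h2
    exact hN (p + x.2 + v) (by push_cast; omega)

theorem ser_mul_monomial (i j : ℤ) (a : ℕ → R) (g : R) :
    ser δ i a * monomial δ j g = ser δ (i + j) (fun n => ∑ x ∈ antidiagonal n,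
      quadCoeff (i + 2 * x.1) x.2 • (a x.1 * ((δ : R →ₗ[ℂ] R) ^ x.2) g)) := by
  rw [monomial_eq_ser, ser_mul_ser]
  congr 1
  funext n
  refine sum_congr rfl fun x _ => ?_
  rw [sum_eq_single (x.2, 0)]
  · simp
  · intro z hz hz'
    have h := HasAntidiagonal.mem_antidiagonal.mp hz
    have : z.2 ≠ 0 := fun h0 => hz' (Prod.ext (by simp only; omega) h0)
    simp [this]
  · intro h
    simp at h

theorem monomial_mul_ser (i j : ℤ) (f : R) (b : ℕ → R) :
    monomial δ i f * ser δ j b = ser δ (i + j) (fun n => ∑ x ∈ antidiagonal n,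
      quadCoeff i x.1 • (f * ((δ : R →ₗ[ℂ] R) ^ x.1) (b x.2))) := by
  rw [monomial_eq_ser, ser_mul_ser]
  congr 1
  funext n
  rw [sum_eq_single (0, n)]
  · simp
  · intro z hz hz'
    have h := HasAntidiagonal.mem_antidiagonal.mp hz
    have : z.1 ≠ 0 := fun h0 => hz' (Prod.ext h0 (by simp only; omega))
    simp [this]
  · intro h
    simp at h

theorem pow_apply_one (n : ℕ) : ((δ : R →ₗ[ℂ] R) ^ (n + 1)) 1 = 0 := by
  rw [pow_succ, Module.End.mul_apply]
  simp

theorem monomial_mul_monomial_one (i j : ℤ) (f : R) :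
    monomial δ i f * monomial δ j 1 = monomial δ (i + j) f := by
  rw [monomial_eq_ser i, ser_mul_monomial, monomial_eq_ser]
  congr 1
  funext n
  rw [sum_eq_single (n, 0)]
  · simp [quadCoeff_zero_right]
  · rintro ⟨p, q⟩ hz hz'
    have h := HasAntidiagonal.mem_antidiagonal.mp hz
    obtain ⟨v, hv⟩ : ∃ v, q = v + 1 :=
      Nat.exists_eq_succ_of_ne_zero fun h0 => hz' (Prod.ext (by simp only at h ⊢; omega) h0)
    simp only [hv, pow_apply_one, mul_zero, smul_zero]
  · intro h
    simp at h

theorem const_mul_monomial (i : ℤ) (f g : R) :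
    const δ f * monomial δ i g = monomial δ i (f * g) := by
  ext N
  rw [const, coeff_monomial_zero_mul, coeff_monomial, coeff_monomial]
  split_ifs <;> simp

theorem const_one : const δ (1 : R) = 1 := rfl

theorem const_mul_const (f g : R) : const δ f * const δ g = const δ (f * g) :=
  const_mul_monomial 0 f g

/-- Commuting y past a coefficient only produces terms of higher degree, so leading coefficients
multiply as in a commutative ring. -/
theorem coeff_mul_lead {p q : QPDO δ} {a b : ℤ} (ha : ∀ i < a, p.coeff i = 0)
    (hb : ∀ i < b, q.coeff i = 0) : (p * q).coeff (a + b) = p.coeff a * q.coeff b := by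
  rw [coeff_mul, finsum_eq_single _ (a, 0)]
  · simp [mulTerm, quadCoeff_zero_right]
  · intro x hx
    by_contra h
    obtain ⟨h1, h2⟩ := mulTerm_ne_zero ha hb h
    exact hx (Prod.ext (by simp only; omega) (by simp only; omega))

theorem exists_lead {p : QPDO δ} (hp : p ≠ 0) : ∃ a : ℤ, p.coeff a ≠ 0 ∧ ∀ i < a, p.coeff i = 0 := by
  obtain ⟨b, hb⟩ := p.exists_lower
  have h : ∃ n : ℕ, p.coeff (b + n) ≠ 0 := by
    by_contra! h
    refine hp (QPDO.ext fun i => ?_)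
    by_cases hi : i < b
    · exact hb i hi
    · have := h (i - b).toNat
      rwa [show b + ((i - b).toNat : ℤ) = i by omega] at this
  classical
  refine ⟨b + Nat.find h, Nat.find_spec h, fun i hi => ?_⟩
  by_cases hi' : i < b
  · exact hb i hi'
  · have := Nat.find_min h (m := (i - b).toNat) (by omega)
    rw [not_not] at this
    rwa [show b + ((i - b).toNat : ℤ) = i by omega] at this

theorem smul_mul (c : ℂ) (p q : QPDO δ) : c • p * q = c • (p * q) := by
  rw [smul_eq_const_mul, smul_eq_const_mul, mul_assoc]

theorem mul_smul' (c : ℂ) (p q : QPDO δ) : p * c • q = c • (p * q) := by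
  ext N
  rw [coeff_smul, coeff_mul, coeff_mul, smul_finsum' _ (mulTerm_support_finite p q N)]
  refine finsum_congr fun x => ?_
  simp only [mulTerm, coeff_smul, map_smul, mul_smul_comm]
  rw [smul_comm]

/-! ### Contractions for the valuation, and square roots -/

/-- A map that increases the order of contact has a fixed point. -/
theorem exists_fixedPoint (F : QPDO δ → QPDO δ) (a : ℤ) (hF : ∀ q, ∀ i < a, (F q).coeff i = 0)
    (hc : ∀ p q N, (∀ i < a, p.coeff i = 0) → (∀ i < a, q.coeff i = 0) →
      (∀ i < N, p.coeff i = q.coeff i) → ∀ i < N + 1, (F p).coeff i = (F q).coeff i) :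
    ∃ q, (∀ i < a, q.coeff i = 0) ∧ F q = q := by
  have hlow : ∀ n, ∀ i < a, (F^[n] 0).coeff i = 0 := by
    intro n i hi
    cases n with
    | zero => rfl
    | succ n => rw [Function.iterate_succ_apply']; exact hF _ i hi
  have hstep : ∀ n : ℕ, ∀ i < a + n, (F^[n + 1] 0).coeff i = (F^[n] 0).coeff i := by
    intro n
    induction n with
    | zero =>
      intro i hi
      have hi : i < a := by simpa using hi
      rw [hlow _ i hi, hlow _ i hi]
    | succ n ih =>
      intro i hi
      have h := hc _ _ _ (hlow _) (hlow _) ih i (by push_cast at hi; omega)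
      rwa [← Function.iterate_succ_apply' F, ← Function.iterate_succ_apply' F] at h
  have hstab : ∀ n k : ℕ, ∀ i < a + n, (F^[n + k] 0).coeff i = (F^[n] 0).coeff i := by
    intro n k i hi
    induction k with
    | zero => rfl
    | succ k ih => rw [← add_assoc, hstep (n + k) i (by push_cast; omega), ih]
  -- The coefficient of degree `i` is stationary from the iterate `i - a + 1` on, so this is the
  -- limit of the iterates of `0`.
  let q : QPDO δ := ⟨fun i => (F^[(i - a + 1).toNat] 0).coeff i, a, fun i hi => hlow _ i hi⟩
  have hq : ∀ n : ℕ, ∀ i < a + n, q.coeff i = (F^[n] 0).coeff i := by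
    intro n i hi
    change (F^[(i - a + 1).toNat] 0).coeff i = _
    obtain ⟨k, hk⟩ : ∃ k, n = (i - a + 1).toNat + k := ⟨n - (i - a + 1).toNat, by omega⟩
    rw [hk, hstab _ k i (by omega)]
  refine ⟨q, fun i hi => hlow _ i hi, QPDO.ext fun i => ?_⟩
  have h1 := hc q (F^[(i - a + 1).toNat] 0) _ (fun i hi => hlow _ i hi) (hlow _) (hq _) i (by omega)
  rw [h1, ← Function.iterate_succ_apply' F, hq ((i - a + 1).toNat + 1) i (by push_cast; omega)]

theorem coeff_mul_congr {p p' q q' : QPDO δ} {a b N : ℤ} (hp : ∀ i < a, p.coeff i = 0)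
    (hq' : ∀ i < b, q'.coeff i = 0)
    (h1 : ∀ i < N - b, p.coeff i = p'.coeff i) (h2 : ∀ i < N - a, q.coeff i = q'.coeff i) :
    ∀ i < N, (p * q).coeff i = (p' * q').coeff i := by
  intro i hi
  have e : p * q - p' * q' = p * (q - q') + (p - p') * q' := by noncomm_ring
  rw [← sub_eq_zero, ← coeff_sub, e, coeff_add,
    coeff_mul_eq_zero (a := a) (b := N - a) hp (fun j hj => by rw [coeff_sub, h2 j hj, sub_self]) i
      (by omega),
    coeff_mul_eq_zero (a := N - b) (b := b) (fun j hj => by rw [coeff_sub, h1 j hj, sub_self]) hq' i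
      (by omega), add_zero]

/-- The equation (1+p)² = 1+q says p = ½(q - p²), and the right side is a contraction on series of
positive valuation. -/
theorem exists_sqrt_one_add {q : QPDO δ} (hq : ∀ i < 1, q.coeff i = 0) :
    ∃ p : QPDO δ, (∀ i < 1, p.coeff i = 0) ∧ (1 + p) ^ 2 = 1 + q := by
  have hsq : ∀ (p p' : QPDO δ) (N : ℤ), (∀ i < (1 : ℤ), p.coeff i = 0) → (∀ i < (1 : ℤ), p'.coeff i = 0) →
      (∀ i < N, p.coeff i = p'.coeff i) → ∀ i < N + 1,
      (p * p).coeff i = (p' * p').coeff i := by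
    intro p p' N hp hp' h
    exact coeff_mul_congr hp hp' (by simpa using h) (by simpa using h)
  -- `exists_fixedPoint` wants a map whose values all have positive valuation, whatever the
  -- argument. The truncation `T` ensures this and changes nothing at the fixed point.
  let T : QPDO δ → QPDO δ := fun p => ⟨fun i => if i < 1 then 0 else p.coeff i, 1, fun i hi => if_pos hi⟩
  have hT : ∀ p i, (T p).coeff i = if i < 1 then 0 else p.coeff i := fun _ _ => rfl
  obtain ⟨p, hp, hfix⟩ := exists_fixedPoint
    (fun p => T ((1 / 2 : ℂ) • (q - p * p))) 1 (fun p i hi => if_pos hi) (by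
      intro p p' N hp hp' h i hi
      simp only [hT, coeff_smul, coeff_sub, hsq p p' N hp hp' h i hi])
  refine ⟨p, hp, ?_⟩
  have h2 : T ((1 / 2 : ℂ) • (q - p * p)) = (1 / 2 : ℂ) • (q - p * p) := by
    ext i
    rw [hT]
    split_ifs with hi
    · rw [coeff_smul, coeff_sub, hq i hi, coeff_mul_eq_zero hp hp i (by omega)]
      simp
    · rfl
  simp only [h2] at hfix
  have h3 : q - p * p = (2 : ℂ) • p := by
    nth_rewrite 3 [← hfix]
    rw [smul_smul]
    norm_num
  have h4 : q = p + p + p * p := by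
    rw [sub_eq_iff_eq_add.mp h3, two_smul]
  rw [h4]
  noncomm_ring

/-- The square root of `1 + q` is again 1 plus a series of positive valuation, so the extraction can
be iterated. -/
theorem exists_pow_two_pow_eq {q : QPDO δ} (hq : ∀ i < 1, q.coeff i = 0) (n : ℕ) :
    ∃ p : QPDO δ, p ^ 2 ^ n = 1 + q := by
  induction n generalizing q with
  | zero => exact ⟨1 + q, by simp⟩
  | succ n ih =>
    obtain ⟨p, hp, hpq⟩ := exists_sqrt_one_add hq
    obtain ⟨r, hr⟩ := ih hp
    exact ⟨r, by rw [pow_succ, pow_mul, hr, hpq]⟩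

theorem monomial_eq_pow (n : ℕ) : monomial δ n (1 : R) = y δ ^ n := by
  induction n with
  | zero => rfl
  | succ n ih => rw [pow_succ, ← ih, y, monomial_mul_monomial_one]; norm_cast

theorem monomial_neg_mul (n : ℕ) : monomial δ (-n : ℤ) (1 : R) * monomial δ n 1 = 1 := by
  rw [monomial_mul_monomial_one, neg_add_cancel]
  rfl

theorem monomial_mul_neg (n : ℕ) : monomial δ n (1 : R) * monomial δ (-n : ℤ) 1 = 1 := by
  rw [monomial_mul_monomial_one, add_neg_cancel]
  rfl

/-! ### Automatic continuity and uniqueness of square roots over a domain -/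

section Domain
variable [IsDomain R]

theorem coeff_pow_lead {p : QPDO δ} {a : ℤ} (hp : p.coeff a ≠ 0) (ha : ∀ i < a, p.coeff i = 0)
    (n : ℕ) : (p ^ n).coeff (n * a) ≠ 0 ∧ ∀ i < n * a, (p ^ n).coeff i = 0 := by
  induction n with
  | zero =>
    have h1 : ∀ i, (1 : QPDO δ).coeff i = if i = 0 then 1 else 0 := fun i => coeff_monomial 0 i 1
    refine ⟨by simp [h1], fun i hi => ?_⟩
    rw [pow_zero, h1, if_neg]
    rintro rfl
    simp at hi
  | succ n ih =>
    have e : ((n + 1 : ℕ) : ℤ) * a = n * a + a := by push_cast; ring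
    rw [pow_succ, e]
    exact ⟨by rw [coeff_mul_lead ih.2 ha]; exact mul_ne_zero ih.1 hp, coeff_mul_eq_zero ih.2 ha⟩

/-- An element with `2^n`-th roots for all `n` has no polar part. -/
theorem coeff_eq_zero_of_roots {q : QPDO δ} (h : ∀ n : ℕ, ∃ p : QPDO δ, p ^ 2 ^ n = q) :
    ∀ i < 0, q.coeff i = 0 := by
  by_cases hq : q = 0
  · simp [hq]
  obtain ⟨a, ha, ha'⟩ := exists_lead hq
  suffices 0 ≤ a from fun i hi => ha' i (by omega)
  by_contra! hneg
  -- The valuation `b` of a root of order 2^|a| satisfies 2^|a| b = a, impossible for a ≠ 0 because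
  -- 2^|a| > |a|.
  obtain ⟨p, hp⟩ := h a.natAbs
  have hp0 : p ≠ 0 := by
    rintro rfl
    rw [zero_pow (by positivity)] at hp
    exact hq hp.symm
  obtain ⟨b, hb, hb'⟩ := exists_lead hp0
  obtain ⟨h1, h2⟩ := coeff_pow_lead hb hb' (2 ^ a.natAbs)
  rw [hp] at h1 h2
  have e : ((2 ^ a.natAbs : ℕ) : ℤ) * b = a := by
    apply le_antisymm
    · by_contra! hlt
      exact ha (h2 a hlt)
    · by_contra! hlt
      exact h1 (ha' _ hlt)
  have hlt : a.natAbs < 2 ^ a.natAbs := Nat.lt_two_pow_self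
  have hdvd : 2 ^ a.natAbs ∣ a.natAbs := by
    rw [← Int.natCast_dvd]
    exact ⟨b, e.symm⟩
  exact absurd (Nat.le_of_dvd (by omega) hdvd) (by omega)

/-- A ring endomorphism that fixes `R` and `y` is the identity: it is automatically continuous. -/
theorem eq_id_of_fixes (τ : QPDO δ →+* QPDO δ) (h1 : ∀ f, τ (const δ f) = const δ f)
    (h2 : τ (y δ) = y δ) (q : QPDO δ) : τ q = q := by
  have hpow : ∀ n : ℕ, τ (monomial δ n 1) = monomial δ n 1 := fun n => by
    rw [monomial_eq_pow, map_pow, h2]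
  have hneg : ∀ n : ℕ, τ (monomial δ (-n : ℤ) 1) = monomial δ (-n : ℤ) 1 := fun n => by
    have e := congrArg τ (monomial_neg_mul (δ := δ) n)
    rw [map_mul, hpow, map_one] at e
    calc τ (monomial δ (-n : ℤ) 1)
        = τ (monomial δ (-n : ℤ) 1) * (monomial δ n (1 : R) * monomial δ (-n : ℤ) 1) := by
          rw [monomial_mul_neg, mul_one]
      _ = _ := by rw [← mul_assoc, e, one_mul]
  have hmon : ∀ (i : ℤ) (f : R), τ (monomial δ i f) = monomial δ i f := by
    intro i f
    rw [← mul_one f, ← const_mul_monomial, map_mul, h1]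
    congr 1
    obtain ⟨n, rfl | rfl⟩ := i.eq_nat_or_neg
    · exact hpow n
    · exact hneg n
  -- Having roots of every order 2^n is an algebraic property, which `τ` transfers from `1 + q` to
  -- its image.
  have hpos : ∀ q : QPDO δ, (∀ i < 1, q.coeff i = 0) → ∀ i < 0, (τ q).coeff i = 0 := by
    intro q hq i hi
    have h := coeff_eq_zero_of_roots (q := τ (1 + q)) (fun n => by
      obtain ⟨p, hp⟩ := exists_pow_two_pow_eq hq n
      exact ⟨τ p, by rw [← map_pow, hp]⟩) i hi
    rw [map_add, map_one, coeff_add] at h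
    have h1 : (1 : QPDO δ).coeff i = 0 := (coeff_monomial 0 i 1).trans (if_neg hi.ne)
    rwa [h1, zero_add] at h
  ext N
  obtain ⟨s, q', hq, hq'⟩ := q.exists_truncation (N.natAbs + 2)
  rw [hq, map_add, map_sum]
  simp only [hmon, coeff_add]
  congr 1
  -- With n = |N| + 1, the factor q' y^{-n} has positive valuation, so its image has no pole.
  -- Multiplying by y^n, which `τ` fixes, pushes the image of `q'` beyond degree `N`.
  have e : q' = q' * monomial δ (-((N.natAbs + 1 : ℕ) : ℤ)) 1 * monomial δ (N.natAbs + 1 : ℕ) 1 := by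
    rw [mul_assoc, monomial_neg_mul, mul_one]
  have hm : ∀ (i : ℤ), ∀ j < i, (monomial δ i (1 : R)).coeff j = 0 := fun i j hj => by
    rw [coeff_monomial, if_neg hj.ne]
  rw [hq' N (by omega), e, map_mul, hpow]
  refine coeff_mul_eq_zero (hpos _ ?_) (hm _) N (by omega)
  intro i hi
  exact coeff_mul_eq_zero hq' (hm _) i (by push_cast; omega)

/-- Two square roots of the same element with the same leading coefficient agree. -/
theorem eq_of_mul_self_eq {p q : QPDO δ} {a : ℤ} (hp : ∀ i < a, p.coeff i = 0)
    (hq : ∀ i < a, q.coeff i = 0) (hpq : p.coeff a = q.coeff a) (h0 : p.coeff a ≠ 0)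
    (h : p * p = q * q) : p = q := by
  by_contra hne
  obtain ⟨b, hb, hb'⟩ := exists_lead (sub_ne_zero.mpr hne)
  -- Noncommutative form of p² - q² = 0. Its lowest coefficient is twice the leading coefficient of
  -- `p` times that of `p - q`.
  have e : p * (p - q) + (p - q) * q = 0 := by
    rw [mul_sub, sub_mul, h]
    abel
  have e1 := coeff_mul_lead hp hb'
  have e2 := coeff_mul_lead hb' hq
  have e3 : (p * (p - q) + (p - q) * q).coeff (a + b) = 0 := by rw [e, coeff_zero]
  rw [coeff_add, e1, add_comm a b, e2, ← hpq] at e3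
  have e4 : (2 : R) * (p.coeff a * (p - q).coeff b) = 0 := by linear_combination e3
  have : (2 : R) ≠ 0 := by
    rw [← map_ofNat (algebraMap ℂ R) 2]
    exact (map_ne_zero _).mpr two_ne_zero
  exact mul_ne_zero this (mul_ne_zero h0 hb) e4

end Domain

end QPDO

/-! ### Identities between the structure constants -/

section Combinatorics
open Finset

/-- The rising factorial `a (a+1) ⋯ (a+t-1)`. -/
noncomputable def rise (a : ℂ) (t : ℕ) : ℂ := ∏ l ∈ range t, (a + l)

theorem rise_zero (a : ℂ) : rise a 0 = 1 := by simp [rise]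

theorem rise_succ (a : ℂ) (t : ℕ) : rise a (t + 1) = rise a t * (a + t) := by
  rw [rise, prod_range_succ, rise]

theorem rise_succ' (a : ℂ) (t : ℕ) : rise a (t + 1) = a * rise (a + 1) t := by
  rw [rise, prod_range_succ', rise, mul_comm]
  congr 1
  · simp
  · refine prod_congr rfl fun l _ => ?_
    push_cast
    ring

theorem rise_add (a : ℂ) (m n : ℕ) : rise a (m + n) = rise a m * rise (a + m) n := by
  rw [rise, prod_range_add, rise, rise]
  congr 1
  refine prod_congr rfl fun l _ => ?_
  push_cast
  ring

theorem rise_nat_ne_zero {j : ℕ} (hj : 0 < j) (n : ℕ) : rise (j : ℂ) n ≠ 0 := by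
  rw [rise, prod_ne_zero_iff]
  intro l _
  exact_mod_cast (by omega : j + l ≠ 0)

theorem quadCoeff_two_mul (a : ℤ) (t : ℕ) :
    quadCoeff (2 * a) t * (t.factorial : ℂ) = 2 ^ t * rise a t := by
  induction t with
  | zero => simp [quadCoeff_zero_right, rise_zero]
  | succ t ih =>
    have h := quadCoeff_succ (2 * a) t
    rw [rise_succ, Nat.factorial_succ]
    push_cast at h ⊢
    linear_combination (t.factorial : ℂ) * h + (2 * t + 2 * (a : ℂ)) * ih

/-- Reversing the order of the factors i + 2l negates those attached to 2 - i - 2u. This is the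
upper negation that prepares Vandermonde sums with alternating signs. -/
theorem quadCoeff_reflect (i : ℤ) (u : ℕ) :
    quadCoeff i u = (-1) ^ u * quadCoeff (2 - i - 2 * u) u := by
  rw [quadCoeff, quadCoeff, prod_div_distrib, prod_div_distrib, mul_div_assoc']
  congr 1
  rw [← prod_range_reflect, ← card_range u, ← prod_const, card_range, ← prod_mul_distrib]
  refine prod_congr rfl fun l hl => ?_
  have := mem_range.mp hl
  rw [Nat.cast_sub (by omega), Nat.cast_sub (by omega)]
  push_cast
  ring

/-- The coefficient `∏_{l < u} (i + 2l)(i + 2l + 2) / (4^u u!)`. -/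
noncomputable def twistCoeff (i : ℤ) (u : ℕ) : ℂ :=
  quadCoeff i u * quadCoeff (i + 2) u * (u.factorial : ℂ) / 4 ^ u

theorem twistCoeff_zero_right (i : ℤ) : twistCoeff i 0 = 1 := by
  simp [twistCoeff, quadCoeff_zero_right]

theorem twistCoeff_zero_left (u : ℕ) : twistCoeff 0 (u + 1) = 0 := by
  simp [twistCoeff, quadCoeff_zero_left]

/-- This vanishing is what makes the image of y⁻² a single monomial. -/
theorem twistCoeff_neg_two (u : ℕ) : twistCoeff (-2) (u + 1) = 0 := by
  simp [twistCoeff, quadCoeff_zero_left]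

/-- The same recurrence expresses commutation with s² y⁻² in `commute_iff`; together with the value
1 at `0` it characterises the series `eta i`. -/
theorem twistCoeff_succ (i : ℤ) (u : ℕ) : ((u : ℂ) + 1) * twistCoeff i (u + 1) =
    (i + 2 * u) * (i + 2 * u + 2) / 4 * twistCoeff i u := by
  have h1 := quadCoeff_succ i u
  have h2 := quadCoeff_succ (i + 2) u
  have h : ((u : ℂ) + 1) ≠ 0 := by exact_mod_cast Nat.succ_ne_zero u
  rw [twistCoeff, twistCoeff, Nat.factorial_succ]
  push_cast at h2 ⊢
  rw [← sub_eq_zero]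
  have e : ((u : ℂ) + 1) * (quadCoeff i (u + 1) * quadCoeff (i + 2) (u + 1) *
      (((u : ℂ) + 1) * u.factorial) / 4 ^ (u + 1)) =
      (((u : ℂ) + 1) * quadCoeff i (u + 1)) * (((u : ℂ) + 1) * quadCoeff (i + 2) (u + 1)) *
        u.factorial / 4 ^ (u + 1) := by ring
  rw [e, h1, h2]
  ring

theorem sum_antidiagonal_assoc {S : Type*} [AddCommMonoid S] (n : ℕ) (F : ℕ → ℕ → ℕ → S) :
    ∑ x ∈ antidiagonal n, ∑ z ∈ antidiagonal x.1, F z.1 z.2 x.2 =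
      ∑ x ∈ antidiagonal n, ∑ z ∈ antidiagonal x.2, F x.1 z.1 z.2 := by
  rw [sum_sigma', sum_sigma']
  refine sum_nbij' (fun z => ⟨(z.2.1, z.2.2 + z.1.2), (z.2.2, z.1.2)⟩)
    (fun z => ⟨(z.1.1 + z.2.1, z.2.2), (z.1.1, z.2.1)⟩) ?_ ?_ ?_ ?_ ?_
  · rintro ⟨⟨a, b⟩, ⟨c, d⟩⟩ hz
    simp only [mem_sigma, HasAntidiagonal.mem_antidiagonal] at hz ⊢
    obtain ⟨h1, h2⟩ := hz
    refine ⟨?_, trivial⟩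
    omega
  · rintro ⟨⟨a, b⟩, ⟨c, d⟩⟩ hz
    simp only [mem_sigma, HasAntidiagonal.mem_antidiagonal] at hz ⊢
    obtain ⟨h1, h2⟩ := hz
    refine ⟨?_, trivial⟩
    omega
  · rintro ⟨⟨a, b⟩, ⟨c, d⟩⟩ hz
    simp only [mem_sigma, HasAntidiagonal.mem_antidiagonal] at hz
    obtain ⟨-, rfl⟩ := hz
    rfl
  · rintro ⟨⟨a, b⟩, ⟨c, d⟩⟩ hz
    simp only [mem_sigma, HasAntidiagonal.mem_antidiagonal] at hz
    obtain ⟨-, rfl⟩ := hz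
    rfl
  · rintro ⟨⟨a, b⟩, ⟨c, d⟩⟩ hz
    rfl

/-- The coefficient of `c^t s^{j+n+r} g^{(r)}`, `n = r + t`, in `(s² ∂)^n (s^j g)`. -/
noncomputable def liftCoeff (j : ℤ) (r t : ℕ) : ℂ := ((r + t).choose r : ℂ) * rise (j + r) t

/-- Pascal rule for iterating s²∂: the new derivative falls either on the power of s, bringing down
its exponent, or on the derivative of g. -/
theorem liftCoeff_succ_succ (j : ℤ) (r t : ℕ) : liftCoeff j (r + 1) (t + 1) =
    (j + (r + 1 + t : ℕ) + (r + 1 : ℕ)) * liftCoeff j (r + 1) t + liftCoeff j r (t + 1) := by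
  simp only [liftCoeff]
  have h1 : ((r + 1 + (t + 1)).choose (r + 1) : ℂ) =
      (r + 1 + t).choose r + (r + 1 + t).choose (r + 1) := by
    rw [← add_assoc, Nat.choose_succ_succ]
    push_cast
    rfl
  have h2 : ((r + 1 + t).choose (r + 1) : ℂ) * (r + 1) = (r + 1 + t).choose r * (t + 1) := by
    have := Nat.choose_succ_right_eq (r + 1 + t) r
    rw [show r + 1 + t - r = t + 1 by omega] at this
    exact_mod_cast this
  rw [h1, show r + (t + 1) = r + 1 + t by ring, rise_succ, rise_succ' _ t]
  push_cast at h2 ⊢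
  rw [show (j : ℂ) + r + 1 = j + (r + 1) by ring]
  linear_combination (-rise ((j : ℂ) + (r + 1)) t) * h2

theorem liftCoeff_zero_right (j : ℤ) (r : ℕ) : liftCoeff j r 0 = 1 := by
  simp [liftCoeff, rise_zero]

theorem liftCoeff_zero_succ (j : ℤ) (t : ℕ) :
    liftCoeff j 0 (t + 1) = (j + t) * liftCoeff j 0 t := by
  simp [liftCoeff, rise_succ, mul_comm]

theorem sum_liftCoeff_smul {S : Type*} [AddCommGroup S] [Module ℂ S] (j : ℤ) (n : ℕ)
    (G : ℕ → ℕ → S) :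
    ∑ x ∈ antidiagonal (n + 1), liftCoeff j x.1 x.2 • G x.1 x.2 =
      ∑ x ∈ antidiagonal n, (((j + n + x.1) * liftCoeff j x.1 x.2) • G x.1 (x.2 + 1) +
        liftCoeff j x.1 x.2 • G (x.1 + 1) x.2) := by
  -- `A` collects the terms in which the last derivative hits the power of s, `B` those in which it
  -- hits g.
  let A : ℕ → ℕ → ℂ := fun r t => match t with
    | 0 => 0
    | t + 1 => (j + n + r) * liftCoeff j r t
  let B : ℕ → ℕ → ℂ := fun r t => match r with
    | 0 => 0
    | r + 1 => liftCoeff j r t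
  have hAB : ∀ x ∈ antidiagonal (n + 1), liftCoeff j x.1 x.2 • G x.1 x.2 =
      A x.1 x.2 • G x.1 x.2 + B x.1 x.2 • G x.1 x.2 := by
    rintro ⟨r, t⟩ hx
    have hn := HasAntidiagonal.mem_antidiagonal.mp hx
    rw [← add_smul]
    congr 1
    rcases r with _ | r <;> rcases t with _ | t
    · simp at hn
    · simp only at hn
      obtain rfl : n = t := by omega
      simp [A, B, liftCoeff_zero_succ]
    · simp [A, B, liftCoeff_zero_right]
    · simp only at hn
      obtain rfl : n = r + 1 + t := by omega
      exact liftCoeff_succ_succ j r t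
  rw [sum_congr rfl hAB, sum_add_distrib, Finset.Nat.sum_antidiagonal_succ',
    Finset.Nat.sum_antidiagonal_succ (f := fun x => B x.1 x.2 • G x.1 x.2), sum_add_distrib]
  simp [A, B]

/-- Numerical content of the compatibility of the twist with the rule for y^i g: both sides are the
coefficient of c^m s^{-i-m} ∂^r(g·γ) y^{i+2m+2r}, computed after and before commuting. Once common
factors are removed it is a Vandermonde sum. -/
theorem twistCoeff_mul_quadCoeff (i : ℤ) (r m : ℕ) :
    quadCoeff (i + 2 * m) r * twistCoeff i m * (-1 / 2) ^ r =
      ∑ x ∈ antidiagonal m, twistCoeff (i + 2 * (r + x.1 : ℕ)) x.2 * quadCoeff i (r + x.1) *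
        (-1 / 2) ^ (r + x.1) * liftCoeff 0 r x.1 := by
  -- Reflect, split the reflected argument as 2r + (-i-2r-2m), apply Vandermonde, and reflect the
  -- second factor back.
  have hq : quadCoeff (i + 2) m = ∑ x ∈ antidiagonal m, (-1) ^ x.1 *
      (quadCoeff (2 * r) x.1 * quadCoeff (i + 2 * r + 2 * x.1 + 2) x.2) := by
    rw [quadCoeff_reflect, show (2 - (i + 2) - 2 * m : ℤ) = 2 * r + (-i - 2 * r - 2 * m) by ring,
      quadCoeff_vandermonde, mul_sum]
    refine sum_congr rfl fun x hx => ?_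
    have h := HasAntidiagonal.mem_antidiagonal.mp hx
    rw [quadCoeff_reflect (i + 2 * r + 2 * x.1 + 2) x.2, ← h]
    rw [show (2 - (i + 2 * r + 2 * x.1 + 2) - 2 * x.2 : ℤ) =
      -i - 2 * r - 2 * (x.1 + x.2 : ℕ) by push_cast; ring, pow_add]
    ring
  have h1 := quadCoeff_add_right i m r
  have h2 := quadCoeff_add_right i r m
  rw [add_comm r m] at h2
  have h3 : ((m + r).choose m : ℂ) = (m + r).choose r := by rw [Nat.choose_symm_add]
  have h4 : quadCoeff (i + 2 * m) r * quadCoeff i m = quadCoeff i r * quadCoeff (i + 2 * r) m := by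
    rw [← h2, ← h3, h1, mul_comm]
  rw [twistCoeff, hq]
  simp only [mul_sum, sum_mul, sum_div]
  refine sum_congr rfl fun x hx => ?_
  have h := HasAntidiagonal.mem_antidiagonal.mp hx
  have h5 := quadCoeff_add_right i r x.1
  have h6 := quadCoeff_add_right (i + 2 * r) x.1 x.2
  have h7 := quadCoeff_two_mul r x.1
  have h8 : ((x.1 + x.2).choose x.1 : ℂ) * x.1.factorial * x.2.factorial = m.factorial := by
    rw [← h, Nat.choose_symm_add]
    exact_mod_cast Nat.add_choose_mul_factorial_mul_factorial x.1 x.2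
  rw [h] at h6 h8
  have hm : (m.factorial : ℂ) ≠ 0 := by exact_mod_cast m.factorial_ne_zero
  rw [twistCoeff, liftCoeff]
  have e1 : (i + 2 * (r + x.1 : ℕ) : ℤ) = i + 2 * r + 2 * x.1 := by push_cast; ring
  rw [e1]
  have e2 : rise ((0 : ℤ) + (r : ℂ)) x.1 = rise ((r : ℤ) : ℂ) x.1 := by simp
  rw [e2]
  have e3 : rise ((r : ℤ) : ℂ) x.1 = quadCoeff (2 * r) x.1 * x.1.factorial / 2 ^ x.1 := by
    rw [h7]
    field_simp
  rw [e3]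
  generalize hQ : quadCoeff (i + 2 * r + 2 * x.1 + 2) x.2 = Q
  have e4 : (4 : ℂ) ^ m = 2 ^ x.1 * 2 ^ x.1 * 4 ^ x.2 := by
    rw [← h, pow_add, ← mul_pow]
    norm_num
  have e5 : (-1 / 2 : ℂ) ^ (r + x.1) = (-1 / 2) ^ r * ((-1) ^ x.1 / 2 ^ x.1) := by
    rw [pow_add, div_pow (-1 : ℂ) 2 x.1]
  rw [e4, e5]
  calc _ = (quadCoeff (i + 2 * m) r * quadCoeff i m) * quadCoeff (2 * r) x.1 * Q * m.factorial *
        (-1) ^ x.1 * (-1 / 2) ^ r / (2 ^ x.1 * 2 ^ x.1 * 4 ^ x.2) := by ring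
    _ = quadCoeff i r * (quadCoeff (i + 2 * r) m * (m.choose x.1)) * quadCoeff (2 * r) x.1 * Q *
        x.1.factorial * x.2.factorial *
        (-1) ^ x.1 * (-1 / 2) ^ r / (2 ^ x.1 * 2 ^ x.1 * 4 ^ x.2) := by
          rw [h4, ← h8]; ring
    _ = (quadCoeff i r * quadCoeff (i + 2 * r) x.1) * quadCoeff (i + 2 * r + 2 * x.1) x.2 *
        quadCoeff (2 * r) x.1 * Q * x.1.factorial * x.2.factorial *
        (-1) ^ x.1 * (-1 / 2) ^ r / (2 ^ x.1 * 2 ^ x.1 * 4 ^ x.2) := by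
          rw [h6]; ring
    _ = _ := by rw [← h5]; field_simp

end Combinatorics

/-! ### Images of the powers of y under a homography -/

/-- An algebra endomorphism `φ` of `R` that behaves with respect to the derivation `δ = -½ D` like
the composition with a homography `z ↦ (az + b)/(cz + d)`, where `s` stands for `cz + d`. -/
structure HomographicTwist {R : Type*} [CommRing R] [Algebra ℂ R] (δ : Derivation ℂ R R) where
  D : Derivation ℂ R R
  φ : R →ₐ[ℂ] R
  s : Rˣ
  c : ℂ
  delta_eq : δ = (-(1 / 2 : ℂ)) • D
  D_s : D s = algebraMap ℂ R c
  D_φ : ∀ f, D (φ f) = ((s⁻¹ ^ 2 : Rˣ) : R) * φ (D f)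

namespace HomographicTwist
open Finset QPDO
variable {R : Type*} [CommRing R] [Algebra ℂ R] {δ : Derivation ℂ R R} (t : HomographicTwist δ)

/-- The element `c^n s^z`. -/
noncomputable def mon (n : ℕ) (z : ℤ) : R := t.c ^ n • ((t.s ^ z : Rˣ) : R)

theorem mon_mul_mon (n m : ℕ) (z w : ℤ) : t.mon n z * t.mon m w = t.mon (n + m) (z + w) := by
  rw [mon, mon, mon, smul_mul_smul_comm, pow_add, zpow_add, Units.val_mul]

theorem mon_mul_mon_mul (n m : ℕ) (z w : ℤ) (f : R) :
    t.mon n z * (t.mon m w * f) = t.mon (n + m) (z + w) * f := by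
  rw [← mul_assoc, mon_mul_mon]

theorem mon_zero_zero : t.mon 0 0 = 1 := by simp [mon]

theorem mon_zero (z : ℤ) : t.mon 0 z = ((t.s ^ z : Rˣ) : R) := by simp [mon]

theorem D_mon_zero (z : ℤ) : t.D (t.mon 0 z) = (z : ℂ) • t.mon 1 (z - 1) := by
  have hs : ∀ z, (t.s : R) * t.mon 1 (z - 1) = t.mon 1 z := fun z => by
    have := t.mon_mul_mon 0 1 1 (z - 1)
    rwa [mon_zero, zpow_one, zero_add, add_sub_cancel] at this
  have key : ∀ z : ℤ, t.D (t.mon 0 (z + 1)) = t.mon 1 z + (t.s : R) * t.D (t.mon 0 z) := by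
    intro z
    have e : t.mon 0 (z + 1) = t.mon 0 z * (t.s : R) := by
      rw [mon_zero, mon_zero, zpow_add_one, Units.val_mul]
    have e3 : t.mon 0 z * algebraMap ℂ R t.c = t.mon 1 z := by
      rw [mon_zero, mon, pow_one, Algebra.smul_def, mul_comm]
    rw [e, Derivation.leibniz, D_s, smul_eq_mul, smul_eq_mul, e3]
  induction z using Int.induction_on with
  | zero => simp [mon_zero_zero]
  | succ n ih =>
    rw [key, ih, mul_smul_comm, hs, add_sub_cancel_right]
    push_cast
    rw [add_smul, one_smul, add_comm]
  | pred n ih =>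
    have h := key (-n - 1)
    rw [sub_add_cancel, ih] at h
    apply t.s.isUnit.mul_left_cancel
    rw [mul_smul_comm, hs, ← sub_eq_iff_eq_add'.mpr h]
    push_cast
    rw [sub_smul, one_smul]

theorem D_mon (n : ℕ) (z : ℤ) : t.D (t.mon n z) = (z : ℂ) • t.mon (n + 1) (z - 1) := by
  have e : t.mon n z = t.c ^ n • t.mon 0 z := by simp [mon]
  rw [e, Derivation.map_smul, D_mon_zero, smul_comm, mon, mon, pow_one, pow_succ, mul_smul]

theorem delta_mon (n : ℕ) (z : ℤ) :
    δ (t.mon n z) = (-(z : ℂ) / 2) • t.mon (n + 1) (z - 1) := by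
  have h := congrArg (fun d => d (t.mon n z)) t.delta_eq
  simp only [Derivation.smul_apply, D_mon, smul_smul] at h
  rw [h]
  congr 1
  ring

/-- Only the shape matters: each derivative trades a power of s for a factor c. The value of the
constant is never needed. -/
theorem exists_delta_pow_mon (w n : ℕ) (z : ℤ) :
    ∃ κ : ℂ, ((δ : R →ₗ[ℂ] R) ^ w) (t.mon n z) = κ • t.mon (n + w) (z - w) := by
  induction w with
  | zero => exact ⟨1, by simp⟩
  | succ w ih =>
    obtain ⟨κ, hκ⟩ := ih
    rw [pow_succ', Module.End.mul_apply, hκ, map_smul, Derivation.coeFn_coe, delta_mon, smul_smul]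
    refine ⟨κ * (-((z - w : ℤ) : ℂ) / 2), ?_⟩
    rw [show z - ((w + 1 : ℕ) : ℤ) = z - w - 1 by push_cast; ring, ← add_assoc]

theorem delta_pow (n : ℕ) (f : R) :
    ((δ : R →ₗ[ℂ] R) ^ n) f = ((-1 / 2 : ℂ) ^ n) • ((t.D : R →ₗ[ℂ] R) ^ n) f := by
  induction n with
  | zero => simp
  | succ n ih =>
    have h : ∀ g, δ g = (-1 / 2 : ℂ) • t.D g := fun g => by
      have h := congrArg (fun d => d g) t.delta_eq
      simp only [Derivation.smul_apply] at h
      rw [h]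
      congr 1
      ring
    rw [pow_succ', Module.End.mul_apply, ih, map_smul, Derivation.coeFn_coe, h, smul_smul, pow_succ,
      pow_succ' (t.D : R →ₗ[ℂ] R), Module.End.mul_apply, Derivation.coeFn_coe]

theorem φ_D (f : R) : t.φ (t.D f) = t.mon 0 2 * t.D (t.φ f) := by
  rw [D_φ, mon_zero, ← mul_assoc, ← Units.val_mul]
  simp

/-- The images of the derivatives of an element `f` such that `φ f = s^j g`. -/
theorem φ_D_pow {f g : R} {j : ℤ} (h : t.φ f = t.mon 0 j * g) (n : ℕ) :
    t.φ (((t.D : R →ₗ[ℂ] R) ^ n) f) = ∑ x ∈ antidiagonal n,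
      liftCoeff j x.1 x.2 • (t.mon x.2 (j + n + x.1) * ((t.D : R →ₗ[ℂ] R) ^ x.1) g) := by
  induction n with
  | zero => simp [liftCoeff_zero_right, h]
  | succ n ih =>
    rw [sum_liftCoeff_smul j n
      (fun r v => t.mon v (j + (n + 1 : ℕ) + r) * ((t.D : R →ₗ[ℂ] R) ^ r) g),
      pow_succ', Module.End.mul_apply, Derivation.coeFn_coe, φ_D, ih, map_sum, mul_sum]
    refine sum_congr rfl fun x _ => ?_
    have e1 : 2 + (j + n + x.1 - 1) = j + (n + 1 : ℕ) + x.1 := by push_cast; ring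
    have e2 : 2 + (j + n + x.1) = j + (n + 1 : ℕ) + (x.1 + 1 : ℕ) := by push_cast; ring
    rw [Derivation.map_smul, Derivation.leibniz, D_mon, smul_eq_mul, smul_eq_mul, smul_add, mul_add,
      add_comm, mul_comm (((t.D : R →ₗ[ℂ] R) ^ x.1) g), smul_mul_assoc, smul_smul, mul_smul_comm,
      mul_smul_comm, mon_mul_mon_mul, mon_mul_mon_mul, pow_succ', Module.End.mul_apply,
      Derivation.coeFn_coe, zero_add, zero_add, e1, e2, mul_comm (liftCoeff j x.1 x.2)]
    push_cast
    rfl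

/-- The series `∑_u e(i,u) c^u s^{-i-u} y^{i+2u}`, the image of `y^i`. -/
noncomputable def eta (i : ℤ) : QPDO δ := ser δ i fun n => twistCoeff i n • t.mon n (-i - n)

theorem eta_zero : t.eta 0 = 1 := by
  rw [← const_one, const, monomial_eq_ser, eta]
  congr 1
  funext n
  rcases n with _ | n
  · simp [twistCoeff_zero_right, mon_zero_zero]
  · simp [twistCoeff_zero_left]

theorem eta_neg_two : t.eta (-2) = monomial δ (-2) (t.mon 0 2) := by
  rw [monomial_eq_ser, eta]
  congr 1
  funext n
  rcases n with _ | n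
  · simp [twistCoeff_zero_right]
  · simp [twistCoeff_neg_two]

/-- Hence y⁻² f = f y⁻² - 2δ(f), with no further terms: y⁻² acts as a first-order differential
operator. -/
theorem quadCoeff_neg_two (u : ℕ) : quadCoeff (-2) (u + 2) = 0 := by
  rw [quadCoeff, prod_eq_zero (i := 1)] <;> simp

theorem quadCoeff_one_right (i : ℤ) : quadCoeff i 1 = i := by simp [quadCoeff]

theorem quadCoeff_two_right (i : ℤ) : quadCoeff i 2 = i * (i + 2) / 2 := by
  simp [quadCoeff, prod_range_succ]
  ring

/-- Since ∂s is constant, s² is annihilated by three derivatives. -/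
theorem delta_pow_sq (w : ℕ) : ((δ : R →ₗ[ℂ] R) ^ (w + 3)) (t.mon 0 2) = 0 := by
  rw [pow_add, Module.End.mul_apply]
  have : ((δ : R →ₗ[ℂ] R) ^ 3) (t.mon 0 2) = 0 := by
    simp only [pow_succ, pow_zero, one_mul, Module.End.mul_apply, Derivation.coeFn_coe, delta_mon,
      map_smul]
    norm_num
  rw [this, map_zero]

/-- The condition for a homogeneous series to commute with `s² y⁻²`. -/
theorem commute_iff (i : ℤ) (β : ℕ → ℂ) :
    t.eta (-2) * ser δ i (fun n => β n • t.mon n (-i - n)) =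
      ser δ i (fun n => β n • t.mon n (-i - n)) * t.eta (-2) ↔
    ∀ n : ℕ, ((n + 1) * β (n + 1) - (i + 2 * n) * (i + 2 * n + 2) / 4 * β n) •
      t.mon (n + 2) (-i - n) = 0 := by
  rw [eta_neg_two, monomial_mul_ser, ser_mul_monomial, add_comm (-2) i]
  have hser : ∀ (k : ℤ) (a b : ℕ → R), ser δ k a = ser δ k b ↔ ∀ n, a n = b n := fun k a b =>
    ⟨fun h n => by rw [← coeff_ser (δ := δ) k a n, h, coeff_ser], fun h => by rw [funext h]⟩
  rw [hser]
  let c : ℕ → R := fun n => β n • t.mon n (-i - n)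
  -- On the left two terms survive, because y⁻² f has only two; on the right up to three, because s²
  -- has only two nonzero derivatives at most.
  have hl0 : ∀ m : ℕ, ∑ x ∈ antidiagonal (m + 1), quadCoeff (-2) x.1 •
      (t.mon 0 2 * ((δ : R →ₗ[ℂ] R) ^ x.1) (c x.2)) =
      (β (m + 1) - (i + m) * β m) • t.mon (m + 1) (1 - i - m) := by
    intro m
    rw [Finset.Nat.sum_antidiagonal_succ, sum_eq_single (0, m)]
    · simp only [quadCoeff_zero_right, quadCoeff_one_right, c, pow_zero, zero_add, pow_one,
        Module.End.one_apply, Derivation.coeFn_coe, Derivation.map_smul, delta_mon,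
        mul_smul_comm, mon_mul_mon, smul_smul]
      rw [show 2 + (-i - ((m + 1 : ℕ) : ℤ)) = 1 - i - m by push_cast; ring,
        show 2 + (-i - (m : ℤ) - 1) = 1 - i - m by ring, ← add_smul]
      congr 1
      push_cast
      ring
    · rintro ⟨p, q⟩ hx hx'
      have h := HasAntidiagonal.mem_antidiagonal.mp hx
      obtain ⟨v, rfl⟩ : ∃ v, p = v + 1 :=
        Nat.exists_eq_succ_of_ne_zero fun h0 => hx' (Prod.ext h0 (by simp only at h ⊢; omega))
      simp only [quadCoeff_neg_two, zero_smul]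
    · intro h
      simp at h
  have hr1 : ∑ x ∈ antidiagonal (0 + 1 : ℕ), quadCoeff (i + 2 * x.1) x.2 •
      (c x.1 * ((δ : R →ₗ[ℂ] R) ^ x.2) (t.mon 0 2)) = (β 1 - i * β 0) • t.mon 1 (1 - i) := by
    rw [Finset.Nat.sum_antidiagonal_succ']
    simp only [Finset.Nat.antidiagonal_zero, sum_singleton, quadCoeff_zero_right, quadCoeff_one_right, c,
      pow_zero, zero_add, pow_one, Module.End.one_apply, Derivation.coeFn_coe, delta_mon,
      mul_smul_comm, smul_mul_assoc, mon_mul_mon, smul_smul]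
    rw [show -i - ((1 : ℕ) : ℤ) + 2 = 1 - i by push_cast; ring,
      show -i - ((0 : ℕ) : ℤ) + (2 - 1) = 1 - i by push_cast; ring, ← add_smul]
    congr 1
    push_cast
    ring
  have hr2 : ∀ n : ℕ, ∑ x ∈ antidiagonal (n + 2), quadCoeff (i + 2 * x.1) x.2 •
      (c x.1 * ((δ : R →ₗ[ℂ] R) ^ x.2) (t.mon 0 2)) =
      (β (n + 2) - (i + 2 * (n + 1)) * β (n + 1) + (i + 2 * n) * (i + 2 * n + 2) / 4 * β n) •
        t.mon (n + 2) (-i - n) := by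
    intro n
    have hδ2 : ((δ : R →ₗ[ℂ] R) ^ 2) (t.mon 0 2) = (1 / 2 : ℂ) • t.mon 2 0 := by
      simp only [pow_succ, pow_zero, one_mul, Module.End.mul_apply, Derivation.coeFn_coe, delta_mon,
        Derivation.map_smul, smul_smul]
      norm_num
    rw [Finset.Nat.sum_antidiagonal_succ', Finset.Nat.sum_antidiagonal_succ', sum_eq_single (n, 0)]
    · simp only [quadCoeff_zero_right, quadCoeff_one_right, quadCoeff_two_right, c, pow_zero,
        zero_add, pow_one, Module.End.one_apply, Derivation.coeFn_coe, delta_mon, hδ2,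
        mul_smul_comm, smul_mul_assoc, mon_mul_mon, smul_smul, Nat.reduceAdd, add_zero]
      rw [show -i - ((n + 1 + 1 : ℕ) : ℤ) + 2 = -i - n by push_cast; ring,
        show -i - ((n + 1 : ℕ) : ℤ) + (2 - 1) = -i - n by push_cast; ring, ← add_smul, ← add_smul]
      congr 1
      push_cast
      ring
    · rintro ⟨p, q⟩ hx hx'
      have h := HasAntidiagonal.mem_antidiagonal.mp hx
      obtain ⟨v, rfl⟩ : ∃ v, q = v + 1 :=
        Nat.exists_eq_succ_of_ne_zero fun h0 => hx' (Prod.ext (by simp only at h ⊢; omega) h0)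
      simp only [delta_pow_sq, mul_zero, smul_zero]
    · intro h
      simp at h
  have hmain : ∀ n : ℕ, (∑ x ∈ antidiagonal (n + 2), quadCoeff (-2) x.1 •
      (t.mon 0 2 * ((δ : R →ₗ[ℂ] R) ^ x.1) (c x.2)) =
      ∑ x ∈ antidiagonal (n + 2), quadCoeff (i + 2 * x.1) x.2 •
      (c x.1 * ((δ : R →ₗ[ℂ] R) ^ x.2) (t.mon 0 2))) ↔
      ((n + 1) * β (n + 1) - (i + 2 * n) * (i + 2 * n + 2) / 4 * β n) •
      t.mon (n + 2) (-i - n) = 0 := by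
    intro n
    rw [hl0 (n + 1), hr2, show 1 - i - ((n + 1 : ℕ) : ℤ) = -i - n by push_cast; ring, ← sub_eq_zero,
      ← sub_smul]
    push_cast
    rw [show (β (n + 1 + 1) - (i + (n + 1)) * β (n + 1) - (β (n + 2) - (i + 2 * (n + 1)) * β (n + 1)
      + (i + 2 * n) * (i + 2 * n + 2) / 4 * β n) : ℂ) =
      (n + 1) * β (n + 1) - (i + 2 * n) * (i + 2 * n + 2) / 4 * β n by ring]
  constructor
  · intro h n
    exact (hmain n).mp (h (n + 2))
  · intro h n
    -- The coefficients of index 0 and 1 agree for every `β`, so the condition starts at index 2.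
    rcases n with _ | _ | n
    · simp [quadCoeff_zero_right, mul_comm]
    · refine (hl0 0).trans (Eq.trans ?_ hr1.symm)
      simp
    · exact (hmain n).mpr (h n)

theorem mon_ne_zero [Nontrivial R] (hc : t.c ≠ 0) (n : ℕ) (z : ℤ) : t.mon n z ≠ 0 := by
  intro h
  rw [mon, smul_eq_zero] at h
  exact h.elim (fun h => pow_ne_zero n hc h) (t.s ^ z).ne_zero

/-- A homogeneous series that commutes with `s² y⁻²` is a multiple of some `eta i`. -/
theorem ser_eq_smul_eta [Nontrivial R] (i : ℤ) (β : ℕ → ℂ)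
    (h : t.eta (-2) * ser δ i (fun n => β n • t.mon n (-i - n)) =
      ser δ i (fun n => β n • t.mon n (-i - n)) * t.eta (-2)) :
    ser δ i (fun n => β n • t.mon n (-i - n)) = β 0 • t.eta i := by
  rw [commute_iff] at h
  have key : ∀ n : ℕ, β n • t.mon n (-i - n) = β 0 • (twistCoeff i n • t.mon n (-i - n)) := by
    intro n
    -- For c = 0 the recurrence says nothing, but then every term of index n ≥ 1 is zero.
    by_cases hc : t.c = 0
    · rcases n with _ | n
      · simp [twistCoeff_zero_right]
      · simp [mon, hc]
    rw [smul_smul]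
    congr 1
    induction n with
    | zero => simp [twistCoeff_zero_right]
    | succ n ih =>
      have h1 := (smul_eq_zero.mp (h n)).resolve_right (t.mon_ne_zero hc _ _)
      have h2 := twistCoeff_succ i n
      have h3 : ((n : ℂ) + 1) ≠ 0 := by exact_mod_cast Nat.succ_ne_zero n
      apply mul_left_cancel₀ h3
      linear_combination h1 - β 0 * h2 + (i + 2 * n) * (i + 2 * n + 2) / 4 * ih
  rw [funext key]
  ext N
  rw [coeff_smul]
  by_cases hN : ∃ n : ℕ, N = i + 2 * n
  · obtain ⟨n, rfl⟩ := hN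
    rw [eta, coeff_ser, coeff_ser]
  · push Not at hN
    rw [eta, coeff_ser_of_ne _ _ hN, coeff_ser_of_ne _ _ hN, smul_zero]

theorem commute_eta (i : ℤ) : t.eta (-2) * t.eta i = t.eta i * t.eta (-2) := by
  refine (t.commute_iff i (twistCoeff i)).mpr fun n => ?_
  rw [twistCoeff_succ, sub_self, zero_smul]

/-- The product is homogeneous of degree `i + j` and commutes with s² y⁻² because both factors do.
It is therefore a multiple of `eta (i + j)`, and the leading coefficient shows that the factor is 1.
No convolution identity for `twistCoeff` has to be computed. -/
theorem eta_mul_eta [Nontrivial R] (i j : ℤ) : t.eta i * t.eta j = t.eta (i + j) := by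
  choose κ hκ using t.exists_delta_pow_mon
  -- These constants only record that the product is homogeneous; apart from `β 0` they are never
  -- evaluated.
  let β : ℕ → ℂ := fun n => ∑ x ∈ antidiagonal n, ∑ z ∈ antidiagonal x.2,
    quadCoeff (i + 2 * x.1) z.1 * (twistCoeff i x.1 * (twistCoeff j z.2 * κ z.1 z.2 (-j - z.2)))
  have h : t.eta i * t.eta j = ser δ (i + j) (fun n => β n • t.mon n (-(i + j) - n)) := by
    rw [eta, eta, ser_mul_ser]
    congr 1
    funext n
    rw [sum_smul]
    refine sum_congr rfl fun x hx => ?_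
    rw [sum_smul]
    refine sum_congr rfl fun z hz => ?_
    have hx' := HasAntidiagonal.mem_antidiagonal.mp hx
    have hz' := HasAntidiagonal.mem_antidiagonal.mp hz
    rw [map_smul, hκ, smul_mul_smul_comm, mul_smul_comm, mon_mul_mon, smul_smul, smul_smul]
    congr 1
    · ring
    · congr 1
      · omega
      · omega
  have h0 : β 0 = 1 := by
    have e : (t.eta i * t.eta j).coeff (i + j) = t.mon 0 (-(i + j)) := by
      rw [eta, eta, coeff_mul_lead (fun N hN => coeff_ser_of_lt _ _ hN)
        (fun N hN => coeff_ser_of_lt _ _ hN), coeff_ser_self, coeff_ser_self]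
      simp only [twistCoeff_zero_right, one_smul, mon_mul_mon]
      congr 1
      simp
      ring
    rw [h, coeff_ser_self] at e
    have e2 : (β 0 - 1) • t.mon 0 (-(i + j)) = 0 := by
      rw [sub_smul, one_smul, sub_eq_zero]
      simpa using e
    rw [mon_zero, smul_eq_zero] at e2
    exact sub_eq_zero.mp (e2.resolve_right (Units.ne_zero _))
  rw [h, ser_eq_smul_eta, h0, one_smul]
  rw [← h, ← mul_assoc, commute_eta, mul_assoc, commute_eta, mul_assoc]

/-- It is the inverse of s² y⁻². Thus `eta 1` is the square root of y² s⁻² that the action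
prescribes for the image of y. -/
theorem eta_two [Nontrivial R] : t.eta 2 = monomial δ 2 1 * const δ (t.mon 0 (-2)) := by
  have h1 : t.eta 2 * t.eta (-2) = 1 := by rw [eta_mul_eta, add_neg_cancel, eta_zero]
  have h2 : t.eta (-2) * (monomial δ 2 1 * const δ (t.mon 0 (-2))) = 1 := by
    rw [eta_neg_two, ← mul_assoc, monomial_mul_monomial_one, neg_add_cancel]
    change const δ _ * const δ _ = _
    rw [const_mul_const, mon_mul_mon, add_zero, add_neg_cancel, mon_zero_zero, const_one]
  calc t.eta 2 = t.eta 2 * (t.eta (-2) * (monomial δ 2 1 * const δ (t.mon 0 (-2)))) := by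
        rw [h2, mul_one]
    _ = _ := by rw [← mul_assoc, h1, one_mul]

end HomographicTwist

/-! ### The twist on all series: multiplicativity and bijectivity -/

namespace QPDO
open Finset
variable {R : Type*} [CommRing R] [Algebra ℂ R] {δ : Derivation ℂ R R}

theorem coeff_monomial_of_lt {i j : ℤ} (f : R) (h : j < i) : (monomial δ i f).coeff j = 0 := by
  rw [coeff_monomial, if_neg h.ne]

theorem monomial_mul_monomial (i j : ℤ) (f g : R) : monomial δ i f * monomial δ j g =
    ser δ (i + j) (fun n => quadCoeff i n • (f * ((δ : R →ₗ[ℂ] R) ^ n) g)) := by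
  apply eq_ser
  · exact coeff_monomial_mul_monomial i j f g
  · exact fun N hN => coeff_monomial_mul_monomial_of_ne i j f g N hN

/-- Additive maps that respect the filtration by the valuation are determined by their values at
the monomials. -/
theorem addMonoidHom_ext {F G : QPDO δ →+ QPDO δ} (k : ℤ)
    (hF : ∀ A p, (∀ i < A, p.coeff i = 0) → ∀ i < A + k, (F p).coeff i = 0)
    (hG : ∀ A p, (∀ i < A, p.coeff i = 0) → ∀ i < A + k, (G p).coeff i = 0)
    (h : ∀ i f, F (monomial δ i f) = G (monomial δ i f)) : F = G := by
  ext p N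
  obtain ⟨s, p', hp, hp'⟩ := p.exists_truncation (N - k + 1)
  rw [hp, map_add, map_add, map_sum, map_sum, coeff_add, coeff_add, hF _ p' hp' N (by omega),
    hG _ p' hp' N (by omega)]
  simp only [h]

end QPDO

namespace HomographicTwist
open Finset QPDO
variable {R : Type*} [CommRing R] [Algebra ℂ R] {δ : Derivation ℂ R R} (t : HomographicTwist δ)

/-- The `v`-th contribution to the coefficient of `y^N` in `t.tw ε q`. -/
noncomputable def twTerm (ε : ℤ → ℕ → ℂ) (q : QPDO δ) (N : ℤ) (v : ℕ) : R :=
  ε (N - 2 * v) v • (t.mon v (v - N) * t.φ (q.coeff (N - 2 * v)))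

theorem twTerm_eq_zero {ε : ℤ → ℕ → ℂ} {q : QPDO δ} {a N : ℤ} (ha : ∀ i < a, q.coeff i = 0) {v : ℕ}
    (hv : N - a < 2 * v) : t.twTerm ε q N v = 0 := by
  rw [twTerm, ha _ (by omega), map_zero, mul_zero, smul_zero]

theorem twTerm_support_finite (ε : ℤ → ℕ → ℂ) (q : QPDO δ) (N : ℤ) :
    (Function.support (t.twTerm ε q N)).Finite := by
  obtain ⟨a, ha⟩ := q.exists_lower
  refine (Set.finite_Iic (N - a).toNat).subset fun v hv => ?_
  by_contra h
  simp only [Set.mem_Iic] at h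
  exact hv (t.twTerm_eq_zero ha (by omega))

/-- The operator `f y^i ↦ φ(f) ∑_v ε(i,v) c^v s^{-i-v} y^{i+2v}`. -/
noncomputable def tw (ε : ℤ → ℕ → ℂ) : QPDO δ →ₗ[ℂ] QPDO δ where
  toFun q := ⟨fun N => ∑ᶠ v, t.twTerm ε q N v, by
    obtain ⟨a, ha⟩ := q.exists_lower
    exact ⟨a, fun N hN => finsum_eq_zero_of_forall_eq_zero fun v =>
      t.twTerm_eq_zero ha (by omega)⟩⟩
  map_add' p q := by
    ext N
    refine Eq.trans (finsum_congr fun v => ?_) (finsum_add_distrib (t.twTerm_support_finite ε p N)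
      (t.twTerm_support_finite ε q N))
    simp only [twTerm, coeff_add, map_add, mul_add, smul_add]
  map_smul' c q := by
    ext N
    refine Eq.trans (finsum_congr fun v => ?_)
      (smul_finsum' c (t.twTerm_support_finite ε q N)).symm
    simp only [twTerm, coeff_smul, map_smul, mul_smul_comm]
    rw [smul_comm]

variable (ε : ℤ → ℕ → ℂ)

theorem coeff_tw (q : QPDO δ) (N : ℤ) : (t.tw ε q).coeff N = ∑ᶠ v, t.twTerm ε q N v := rfl

theorem coeff_tw_eq_zero {q : QPDO δ} {a : ℤ} (ha : ∀ i < a, q.coeff i = 0) :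
    ∀ N < a, (t.tw ε q).coeff N = 0 := fun N hN =>
  finsum_eq_zero_of_forall_eq_zero fun v => t.twTerm_eq_zero ha (by omega)

theorem coeff_tw_lead {q : QPDO δ} {a : ℤ} (ha : ∀ i < a, q.coeff i = 0) :
    (t.tw ε q).coeff a = ε a 0 • (t.mon 0 (-a) * t.φ (q.coeff a)) := by
  rw [coeff_tw, finsum_eq_single _ 0 fun v hv => t.twTerm_eq_zero ha (by omega)]
  simp [twTerm]

/-- The twist never lowers degrees, hence is continuous; this makes fixed spaces stable under
limits. -/
theorem coeff_tw_congr {p q : QPDO δ} {N : ℤ} (h : ∀ i ≤ N, p.coeff i = q.coeff i) :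
    (t.tw ε p).coeff N = (t.tw ε q).coeff N :=
  finsum_congr fun v => by rw [twTerm, twTerm, h _ (by omega)]

theorem tw_ser (i : ℤ) (a : ℕ → R) : t.tw ε (ser δ i a) = ser δ i (fun n =>
    ∑ x ∈ antidiagonal n, ε (i + 2 * x.1) x.2 • (t.mon x.2 (-(i + 2 * x.1 + x.2)) * t.φ (a x.1))) := by
  apply eq_ser
  · intro n
    rw [coeff_tw, finsum_nat_eq_antidiagonal n]
    · intro v hv
      exact t.twTerm_eq_zero (fun j hj => coeff_ser_of_lt i a hj) (by omega)
    · intro x hx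
      have h := HasAntidiagonal.mem_antidiagonal.mp hx
      rw [twTerm, show i + 2 * (n : ℤ) - 2 * x.2 = i + 2 * x.1 by omega, coeff_ser,
        show (x.2 : ℤ) - (i + 2 * n) = -(i + 2 * x.1 + x.2) by omega]
  · intro N hN
    rw [coeff_tw, finsum_eq_zero_of_forall_eq_zero]
    intro v
    rw [twTerm, coeff_ser_of_ne, map_zero, mul_zero, smul_zero]
    intro n hn
    exact hN (n + v) (by push_cast; omega)

theorem tw_const_mul (f : R) (q : QPDO δ) : t.tw ε (const δ f * q) = const δ (t.φ f) * t.tw ε q := by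
  ext N
  rw [const, const, coeff_monomial_zero_mul, coeff_tw, coeff_tw,
    mul_finsum' _ _ (t.twTerm_support_finite ε q N)]
  refine finsum_congr fun v => ?_
  rw [twTerm, twTerm, coeff_monomial_zero_mul, map_mul, mul_smul_comm, mul_left_comm]

theorem tw_monomial_one (i : ℤ) : t.tw twistCoeff (monomial δ i 1) = t.eta i := by
  rw [monomial_eq_ser, tw_ser, eta]
  congr 1
  funext n
  rw [sum_eq_single (0, n)]
  · simp
    congr 2
    ring
  · intro z hz hz'
    have h := HasAntidiagonal.mem_antidiagonal.mp hz
    have : z.1 ≠ 0 := fun h0 => hz' (Prod.ext h0 (by simp only; omega))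
    simp [this]
  · intro h
    simp at h

theorem tw_monomial (i : ℤ) (f : R) :
    t.tw twistCoeff (monomial δ i f) = const δ (t.φ f) * t.eta i := by
  rw [← mul_one f, ← const_mul_monomial, tw_const_mul, tw_monomial_one, mul_one]

/-- The only relation of C mixing y with R is respected by the twist. Expanding the derivatives of
`t.φ g` on both sides leaves `twistCoeff_mul_quadCoeff`. -/
theorem tw_monomial_mul_const (i : ℤ) (g : R) :
    t.tw twistCoeff (monomial δ i 1 * const δ g) = t.eta i * const δ (t.φ g) := by
  rw [const, const, monomial_mul_monomial, tw_ser, eta, ser_mul_monomial]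
  congr 1
  funext n
  have hφ : t.φ g = t.mon 0 0 * t.φ g := by rw [mon_zero_zero, one_mul]
  have hl : ∀ x ∈ antidiagonal n, twistCoeff (i + 0 + 2 * x.1) x.2 •
      (t.mon x.2 (-(i + 0 + 2 * x.1 + x.2)) * t.φ (quadCoeff i x.1 •
        (1 * ((δ : R →ₗ[ℂ] R) ^ x.1) g))) = ∑ z ∈ antidiagonal x.1,
      (twistCoeff (i + 2 * (z.1 + z.2 : ℕ)) x.2 * quadCoeff i (z.1 + z.2) * (-1 / 2) ^ (z.1 + z.2) *
        liftCoeff 0 z.1 z.2) • (t.mon (z.2 + x.2) (-i - (z.2 + x.2)) *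
          ((t.D : R →ₗ[ℂ] R) ^ z.1) (t.φ g)) := by
    intro x _
    rw [one_mul, t.delta_pow, map_smul, map_smul, t.φ_D_pow hφ, smul_sum, smul_sum, mul_sum, smul_sum]
    refine sum_congr rfl fun z hz => ?_
    have h := HasAntidiagonal.mem_antidiagonal.mp hz
    rw [← h, mul_smul_comm, mul_smul_comm, mul_smul_comm, smul_smul, smul_smul, smul_smul,
      mon_mul_mon_mul, add_comm x.2 z.2, add_zero]
    congr 3
    push_cast
    ring
  rw [sum_congr rfl hl, sum_antidiagonal_assoc n (fun r v u =>
      (twistCoeff (i + 2 * (r + v : ℕ)) u * quadCoeff i (r + v) * (-1 / 2) ^ (r + v) *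
        liftCoeff 0 r v) • (t.mon (v + u) (-i - (v + u)) * ((t.D : R →ₗ[ℂ] R) ^ r) (t.φ g)))]
  -- After the swap, `x.1` is the exponent of c and `x.2` the order of the derivative, as in the
  -- expansion of the right side.
  rw [← Finset.Nat.sum_antidiagonal_swap]
  refine sum_congr rfl fun x _ => ?_
  simp only [Prod.fst_swap, Prod.snd_swap]
  rw [t.delta_pow, mul_smul_comm, smul_mul_assoc, smul_smul, smul_smul]
  rw [sum_congr rfl (g := fun z : ℕ × ℕ => (twistCoeff (i + 2 * (x.2 + z.1 : ℕ)) z.2 *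
    quadCoeff i (x.2 + z.1) * (-1 / 2) ^ (x.2 + z.1) * liftCoeff 0 x.2 z.1) •
      (t.mon x.1 (-i - x.1) * ((t.D : R →ₗ[ℂ] R) ^ x.2) (t.φ g)))]
  · rw [← sum_smul, ← twistCoeff_mul_quadCoeff]
    congr 1
    ring
  · intro z hz
    rw [← HasAntidiagonal.mem_antidiagonal.mp hz]
    push_cast
    rfl

theorem coeff_eta_of_lt {i N : ℤ} (h : N < i) : (t.eta i).coeff N = 0 := coeff_ser_of_lt _ _ h

/-- First of three stages towards `tw_mul`: the right factor is a power of y, then the left factor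
is a monomial, then both are arbitrary. Each stage checks monomials and concludes by continuity. -/
theorem tw_mul_monomial_one [Nontrivial R] (p : QPDO δ) (j : ℤ) :
    t.tw twistCoeff (p * monomial δ j 1) = t.tw twistCoeff p * t.eta j := by
  have h : (t.tw twistCoeff).toAddMonoidHom.comp (AddMonoidHom.mulRight (monomial δ j 1)) =
      (AddMonoidHom.mulRight (t.eta j)).comp (t.tw twistCoeff).toAddMonoidHom := by
    refine addMonoidHom_ext j ?_ ?_ ?_
    · intro A p hp
      exact t.coeff_tw_eq_zero _ (coeff_mul_eq_zero hp fun i hi => coeff_monomial_of_lt 1 hi)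
    · intro A p hp
      exact coeff_mul_eq_zero (t.coeff_tw_eq_zero _ hp) fun i hi => t.coeff_eta_of_lt hi
    · intro i f
      change t.tw twistCoeff (monomial δ i f * monomial δ j 1) =
        t.tw twistCoeff (monomial δ i f) * t.eta j
      rw [monomial_mul_monomial_one, tw_monomial, tw_monomial, mul_assoc, eta_mul_eta]
  exact DFunLike.congr_fun h p

theorem tw_monomial_mul [Nontrivial R] (i : ℤ) (f : R) (q : QPDO δ) :
    t.tw twistCoeff (monomial δ i f * q) = t.tw twistCoeff (monomial δ i f) * t.tw twistCoeff q := by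
  have hm : ∀ j < i, (monomial δ i f).coeff j = 0 := fun j hj => coeff_monomial_of_lt f hj
  have h : (t.tw twistCoeff).toAddMonoidHom.comp (AddMonoidHom.mulLeft (monomial δ i f)) =
      (AddMonoidHom.mulLeft (t.tw twistCoeff (monomial δ i f))).comp
        (t.tw twistCoeff).toAddMonoidHom := by
    refine addMonoidHom_ext i ?_ ?_ ?_
    · intro A p hp
      rw [add_comm]
      exact t.coeff_tw_eq_zero _ (coeff_mul_eq_zero hm hp)
    · intro A p hp
      rw [add_comm]
      exact coeff_mul_eq_zero (t.coeff_tw_eq_zero _ hm) (t.coeff_tw_eq_zero _ hp)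
    · intro j g
      change t.tw twistCoeff (monomial δ i f * monomial δ j g) =
        t.tw twistCoeff (monomial δ i f) * t.tw twistCoeff (monomial δ j g)
      have e1 : monomial δ i f = const δ f * monomial δ i 1 := by rw [const_mul_monomial, mul_one]
      have e2 : monomial δ j g = const δ g * monomial δ j 1 := by rw [const_mul_monomial, mul_one]
      rw [tw_monomial, tw_monomial, e1, e2]
      rw [show const δ f * monomial δ i 1 * (const δ g * monomial δ j 1) =
        const δ f * (monomial δ i 1 * const δ g) * monomial δ j 1 by simp only [mul_assoc],
        tw_mul_monomial_one, tw_const_mul, tw_monomial_mul_const]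
      simp only [mul_assoc]
  exact DFunLike.congr_fun h q

theorem tw_mul [Nontrivial R] (p q : QPDO δ) :
    t.tw twistCoeff (p * q) = t.tw twistCoeff p * t.tw twistCoeff q := by
  obtain ⟨b, hb⟩ := q.exists_lower
  have h : (t.tw twistCoeff).toAddMonoidHom.comp (AddMonoidHom.mulRight q) =
      (AddMonoidHom.mulRight (t.tw twistCoeff q)).comp (t.tw twistCoeff).toAddMonoidHom := by
    refine addMonoidHom_ext b ?_ ?_ ?_
    · intro A p hp
      exact t.coeff_tw_eq_zero _ (coeff_mul_eq_zero hp hb)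
    · intro A p hp
      exact coeff_mul_eq_zero (t.coeff_tw_eq_zero _ hp) (t.coeff_tw_eq_zero _ hb)
    · intro i f
      exact t.tw_monomial_mul i f q
  exact DFunLike.congr_fun h p

theorem tw_const (f : R) : t.tw twistCoeff (const δ f) = const δ (t.φ f) := by
  rw [const, tw_monomial, eta_zero, mul_one]

/-- The twist is triangular for the valuation, with diagonal f ↦ s^{-a} φ(f), which is bijective. -/
theorem tw_bijective (hφ : Function.Bijective t.φ) : Function.Bijective (t.tw twistCoeff) := by
  constructor
  · rw [injective_iff_map_eq_zero]
    intro q hq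
    by_contra h
    obtain ⟨a, ha, ha'⟩ := exists_lead h
    have e := t.coeff_tw_lead twistCoeff ha'
    rw [hq, coeff_zero, twistCoeff_zero_right, one_smul, mon_zero] at e
    have e2 := ((t.s ^ (-a)).isUnit.mul_right_eq_zero).mp e.symm
    exact ha (hφ.1 (e2.trans (map_zero _).symm))
  · intro p
    obtain ⟨a, ha⟩ := p.exists_lower
    obtain ⟨g, hg⟩ := hφ.2.hasRightInverse
    have hgl : ∀ x, g (t.φ x) = x := fun x => hφ.1 (hg _)
    -- In degree i, `tw q` contains q_i only through s^{-i} φ(q_i), and the last summand cancels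
    -- this. The new coefficient depends only on the q_j with j < i, so `F` is a contraction whose
    -- fixed points are preimages of `p`.
    let F : QPDO δ → QPDO δ := fun q =>
      ⟨fun i => if i < a then 0 else
        g (t.mon 0 i * (p.coeff i - (t.tw twistCoeff q).coeff i) + t.φ (q.coeff i)),
        a, fun i hi => if_pos hi⟩
    have hFc : ∀ q i, (F q).coeff i = if i < a then 0 else
        g (t.mon 0 i * (p.coeff i - (t.tw twistCoeff q).coeff i) + t.φ (q.coeff i)) :=
      fun _ _ => rfl
    obtain ⟨q, hq, hfix⟩ := exists_fixedPoint F a (fun q i hi => if_pos hi) (by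
      intro q q' N _ _ h i hi
      rw [hFc, hFc]
      congr 2
      have hd := t.coeff_tw_lead twistCoeff (q := q - q') (a := i)
        (fun j hj => by rw [coeff_sub, h j (by omega), sub_self])
      rw [map_sub, coeff_sub, coeff_sub, twistCoeff_zero_right, one_smul, map_sub] at hd
      have hm : t.mon 0 i * t.mon 0 (-i) = 1 := by
        rw [mon_mul_mon, add_neg_cancel, add_zero, mon_zero_zero]
      linear_combination (-t.mon 0 i) * hd + (t.φ (q'.coeff i) - t.φ (q.coeff i)) * hm)
    refine ⟨q, QPDO.ext fun i => ?_⟩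
    by_cases hi : i < a
    · rw [ha i hi, t.coeff_tw_eq_zero _ hq i hi]
    · have h := hFc q i
      rw [hfix, if_neg hi] at h
      have h2 := congrArg t.φ h
      rw [hg] at h2
      have h3 : t.mon 0 i * (p.coeff i - (t.tw twistCoeff q).coeff i) = 0 := by
        linear_combination -h2
      rw [mon_zero] at h3
      exact (sub_eq_zero.mp ((t.s ^ i).isUnit.mul_right_eq_zero.mp h3)).symm

/-- The automorphism of `C` that extends `φ` and sends `y^i` to `eta i`. -/
noncomputable def twEquiv [Nontrivial R] (hφ : Function.Bijective t.φ) : QPDO δ ≃+* QPDO δ :=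
  RingEquiv.ofBijective
    { toFun := t.tw twistCoeff
      map_one' := by rw [← const_one, tw_const, map_one]
      map_mul' := t.tw_mul
      map_zero' := map_zero _
      map_add' := map_add _ : QPDO δ →+* QPDO δ } (t.tw_bijective hφ)

theorem twEquiv_apply [Nontrivial R] (hφ : Function.Bijective t.φ) (q : QPDO δ) :
    t.twEquiv hφ q = t.tw twistCoeff q := rfl

/-- The automorphism is determined by its values on `R` and by the square and the leading
coefficient of the image of `y`. -/
theorem eq_twEquiv [IsDomain R] (hφ : Function.Bijective t.φ) {σ : QPDO δ ≃+* QPDO δ}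
    (h1 : ∀ f, σ (const δ f) = const δ (t.φ f)) (h2 : σ (y δ) * σ (y δ) = t.eta 2)
    (h3 : ∀ i < (1 : ℤ), (σ (y δ)).coeff i = 0) (h4 : (σ (y δ)).coeff 1 = t.mon 0 (-1)) :
    σ = t.twEquiv hφ := by
  have hy : t.twEquiv hφ (y δ) = t.eta 1 := t.tw_monomial_one 1
  have hσ : σ (y δ) = t.eta 1 := by
    have h5 : (t.eta 1).coeff 1 = t.mon 0 (-1) := by
      rw [eta, coeff_ser_self, twistCoeff_zero_right, one_smul]
      simp
    refine eq_of_mul_self_eq h3 (fun i hi => t.coeff_eta_of_lt hi) (h4.trans h5.symm) ?_ ?_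
    · rw [h4, mon_zero]
      exact Units.ne_zero _
    · rw [h2, eta_mul_eta]
      rfl
  -- `σ` and the twist agree on R and at y, so their quotient fixes both and is the identity by
  -- automatic continuity.
  have hid := eq_id_of_fixes (σ.trans (t.twEquiv hφ).symm : QPDO δ ≃+* QPDO δ).toRingHom
    (fun f => by
      change (t.twEquiv hφ).symm (σ (const δ f)) = _
      rw [RingEquiv.symm_apply_eq, h1, twEquiv_apply, tw_const])
    (by
      change (t.twEquiv hφ).symm (σ (y δ)) = _
      rw [RingEquiv.symm_apply_eq, hσ, hy])
  ext1 q
  exact (RingEquiv.symm_apply_eq _).mp (hid q)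

end HomographicTwist

/-! ### Triangular elimination from lifts of leading coefficients -/

namespace QPDO
open Finset
variable {R : Type*} [CommRing R] [Algebra ℂ R] {δ : Derivation ℂ R R}

section Triangular
variable {k : ℤ} {M : ℕ → Submodule ℂ R} (L : (i : ℕ) → M i →ₗ[ℂ] QPDO δ)

theorem support_coeff_lift_subset (hlow : ∀ (i : ℕ) f, ∀ N < k + i, (L i f).coeff N = 0)
    (f : (i : ℕ) → M i) {N : ℤ} {n : ℕ} (hn : N < k + n) :
    (Function.support fun i => (L i (f i)).coeff N) ⊆ range n := by
  intro i hi
  simp only [coe_range, Set.mem_Iio]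
  by_contra! h
  exact hi (hlow i (f i) N (by omega))

/-- The sum `∑_i L_i(f_i)` of a locally finite family. -/
noncomputable def liftSum (hlow : ∀ (i : ℕ) f, ∀ N < k + i, (L i f).coeff N = 0) :
    ((i : ℕ) → M i) →ₗ[ℂ] QPDO δ where
  toFun f := ⟨fun N => ∑ᶠ i, (L i (f i)).coeff N, k, fun N hN =>
    finsum_eq_zero_of_forall_eq_zero fun i => hlow i (f i) N (by omega)⟩
  map_add' f g := by
    ext N
    refine Eq.trans (finsum_congr fun i => ?_) (finsum_add_distrib
      ((finite_toSet _).subset (support_coeff_lift_subset L hlow f (n := (N - k + 1).toNat) (by omega)))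
      ((finite_toSet _).subset (support_coeff_lift_subset L hlow g (n := (N - k + 1).toNat) (by omega))))
    rw [Pi.add_apply, map_add, coeff_add]
  map_smul' c f := by
    ext N
    refine Eq.trans (finsum_congr fun i => ?_) (smul_finsum' c
      ((finite_toSet _).subset
        (support_coeff_lift_subset L hlow f (n := (N - k + 1).toNat) (by omega)))).symm
    rw [Pi.smul_apply, map_smul, coeff_smul]

theorem coeff_sum (s : Finset ℕ) (q : ℕ → QPDO δ) (N : ℤ) :
    (∑ i ∈ s, q i).coeff N = ∑ i ∈ s, (q i).coeff N := by
  induction s using Finset.cons_induction with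
  | empty => simp
  | cons a s h ih => rw [sum_cons, sum_cons, coeff_add, ih]

variable {L} in
theorem coeff_liftSum (hlow : ∀ (i : ℕ) f, ∀ N < k + i, (L i f).coeff N = 0) (f : (i : ℕ) → M i) {N : ℤ}
    {n : ℕ} (hn : N < k + n) :
    (liftSum L hlow f).coeff N = (∑ i ∈ range n, L i (f i)).coeff N := by
  rw [coeff_sum]
  exact finsum_eq_finsetSum_of_support_subset _ (support_coeff_lift_subset L hlow f hn)

variable {L} in
theorem coeff_liftSum_lead (hlow : ∀ (i : ℕ) f, ∀ N < k + i, (L i f).coeff N = 0)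
    (hlead : ∀ i f, (L i f).coeff (k + i) = f) {f : (i : ℕ) → M i} {n : ℕ} (h : ∀ i < n, f i = 0) :
    (liftSum L hlow f).coeff (k + n) = f n := by
  rw [coeff_liftSum hlow f (n := n + 1) (by push_cast; omega), sum_range_succ, coeff_add, hlead,
    sum_eq_zero fun i hi => by rw [h i (mem_range.mp hi), map_zero], coeff_zero, zero_add]

variable {L} in
/-- A space of series whose leading coefficients in degree `k + i` belong to `M i` is isomorphic to
`∏ M i` as soon as every element of every `M i` lifts. -/
theorem exists_linearEquiv_of_lifts {V : Submodule ℂ (QPDO δ)}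
    (hlow : ∀ (i : ℕ) f, ∀ N < k + i, (L i f).coeff N = 0) (hlead : ∀ i f, (L i f).coeff (k + i) = f)
    (hL : ∀ i f, L i f ∈ V) (hVlow : ∀ q ∈ V, ∀ N < k, q.coeff N = 0)
    (hVlead : ∀ q ∈ V, ∀ i : ℕ, (∀ N < k + i, q.coeff N = 0) → q.coeff (k + i) ∈ M i)
    (hVlim : ∀ q, (∀ N, ∃ p ∈ V, ∀ i ≤ N, q.coeff i = p.coeff i) → q ∈ V) :
    ∃ Ψ : ((i : ℕ) → M i) ≃ₗ[ℂ] V, ∀ f, (Ψ f : QPDO δ) = liftSum L hlow f := by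
  have hmem : ∀ f, liftSum L hlow f ∈ V := fun f => hVlim _ fun N =>
    ⟨_, V.sum_mem fun i _ => hL i (f i), fun i hi =>
      coeff_liftSum hlow f (n := (N - k + 1).toNat) (by omega)⟩
  let Ψ : ((i : ℕ) → M i) →ₗ[ℂ] V := (liftSum L hlow).codRestrict V hmem
  have hinj : Function.Injective Ψ := by
    rw [injective_iff_map_eq_zero]
    intro f hf
    have hf' : liftSum L hlow f = 0 := congrArg Subtype.val hf
    funext n
    induction n using Nat.strong_induction_on with
    | _ n ih =>
      have h := coeff_liftSum_lead hlow hlead ih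
      rw [hf', coeff_zero] at h
      exact Subtype.ext h.symm
  have hsurj : Function.Surjective Ψ := by
    rintro ⟨q, hq⟩
    let W : ℕ → Type _ := fun n => {p : QPDO δ // p ∈ V ∧ ∀ N < k + n, p.coeff N = 0}
    -- Subtracting the lift of its leading coefficient keeps a remainder in `V` and raises its
    -- valuation; hence the coefficient to lift next again lies in the right `M n`.
    let lead : (n : ℕ) → W n → M n := fun n p => ⟨p.1.coeff (k + n), hVlead p.1 p.2.1 n p.2.2⟩
    let step : (n : ℕ) → W n → W (n + 1) := fun n p => ⟨p.1 - L n (lead n p),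
      V.sub_mem p.2.1 (hL _ _), fun N hN => by
        rw [coeff_sub]
        rcases (show N < k + n ∨ N = k + n by push_cast at hN; omega) with h | rfl
        · rw [p.2.2 N h, hlow _ _ N h, sub_zero]
        · rw [hlead, sub_self]⟩
    let r : (n : ℕ) → W n := fun n => Nat.rec ⟨q, hq, by simpa using hVlow q hq⟩ step n
    have hr : ∀ n, (r (n + 1)).1 = (r n).1 - L n (lead n (r n)) := fun n => rfl
    let f : (i : ℕ) → M i := fun i => lead i (r i)
    have hsum : ∀ n, q = ∑ i ∈ range n, L i (f i) + (r n).1 := by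
      intro n
      induction n with
      | zero =>
        rw [sum_range_zero, zero_add]
        rfl
      | succ n ih =>
        rw [sum_range_succ, hr]
        refine ih.trans ?_
        simp only [f]
        abel
    refine ⟨f, Subtype.ext (QPDO.ext fun N => ?_)⟩
    change (liftSum L hlow f).coeff N = q.coeff N
    rw [coeff_liftSum hlow f (n := (N - k + 1).toNat) (by omega)]
    conv_rhs => rw [hsum (N - k + 1).toNat]
    rw [coeff_add, (r _).2.2 N (by omega), add_zero]
  exact ⟨LinearEquiv.ofBijective Ψ ⟨hinj, hsurj⟩, fun f => rfl⟩

end Triangular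

/-- `f ↦ ∑_n λ_n f^{(n)} y^{j+2n}`. -/
noncomputable def serLift (δ D : Derivation ℂ R R) (j : ℤ) (lam : ℕ → ℂ) : R →ₗ[ℂ] QPDO δ where
  toFun f := ser δ j fun n => lam n • ((D : R →ₗ[ℂ] R) ^ n) f
  map_add' f g := by
    ext N
    by_cases hN : ∃ n : ℕ, N = j + 2 * n
    · obtain ⟨n, rfl⟩ := hN
      rw [coeff_add, coeff_ser, coeff_ser, coeff_ser, map_add, smul_add]
    · push Not at hN
      rw [coeff_add, coeff_ser_of_ne _ _ hN, coeff_ser_of_ne _ _ hN, coeff_ser_of_ne _ _ hN, add_zero]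
  map_smul' c f := by
    ext N
    by_cases hN : ∃ n : ℕ, N = j + 2 * n
    · obtain ⟨n, rfl⟩ := hN
      rw [coeff_smul, coeff_ser, coeff_ser, map_smul, smul_comm]
      rfl
    · push Not at hN
      rw [coeff_smul, coeff_ser_of_ne _ _ hN, coeff_ser_of_ne _ _ hN, smul_zero]

theorem serLift_apply (D : Derivation ℂ R R) (j : ℤ) (lam : ℕ → ℂ) (f : R) :
    serLift δ D j lam f = ser δ j fun n => lam n • ((D : R →ₗ[ℂ] R) ^ n) f := rfl

theorem coeff_serLift_of_lt (D : Derivation ℂ R R) {j N : ℤ} (lam : ℕ → ℂ) (f : R) (h : N < j) :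
    (serLift δ D j lam f).coeff N = 0 := by
  rw [serLift_apply, coeff_ser_of_lt _ _ h]

end QPDO

/-! ### A numerical criterion for the invariance of a lift -/

namespace HomographicTwist
open Finset QPDO
variable {R : Type*} [CommRing R] [Algebra ℂ R] {δ : Derivation ℂ R R} (t : HomographicTwist δ)

/-- Binomial expansion of (1-1)^m / m!. -/
theorem sum_antidiagonal_alternating (m : ℕ) : ∑ x ∈ antidiagonal m,
    (-1 : ℂ) ^ x.2 / ((x.1.factorial : ℂ) * x.2.factorial) = if m = 0 then 1 else 0 := by
  have h := (Commute.all (1 : ℂ) (-1)).add_pow' m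
  have hm : (m.factorial : ℂ) ≠ 0 := by exact_mod_cast m.factorial_ne_zero
  have e : ∑ x ∈ antidiagonal m, (-1 : ℂ) ^ x.2 / ((x.1.factorial : ℂ) * x.2.factorial) =
      (1 + -1) ^ m / m.factorial := by
    rw [h, sum_div]
    refine sum_congr rfl fun x hx => ?_
    have hx' := HasAntidiagonal.mem_antidiagonal.mp hx
    have h1 := Nat.add_choose_mul_factorial_mul_factorial x.1 x.2
    rw [← Nat.choose_symm_add, hx'] at h1
    have h2 : (m.choose x.1 : ℂ) * x.1.factorial * x.2.factorial = m.factorial := by exact_mod_cast h1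
    have h3 : (x.1.factorial : ℂ) ≠ 0 := by exact_mod_cast x.1.factorial_ne_zero
    have h4 : (x.2.factorial : ℂ) ≠ 0 := by exact_mod_cast x.2.factorial_ne_zero
    rw [nsmul_eq_mul, one_pow, one_mul, div_eq_div_iff (mul_ne_zero h3 h4) hm, ← h2]
    ring
  rw [e, add_neg_cancel]
  split_ifs with h0
  · simp [h0]
  · simp [h0]

/-- Expand the images of the derivatives of f by `φ_D_pow`, and collect c^p s^{-p} f^{(r)} with r +
p = n. By `h`, the coefficient is a constant times the sum of (-1)^u/(v! u!) over v + u = p, which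
vanishes unless p = 0. Positivity of `j` allows division by `rise j r`. -/
theorem tw_serLift {j : ℕ} (hj : 0 < j) {f : R} (hf : t.φ f = t.mon 0 j * f) {ε : ℤ → ℕ → ℂ}
    {lam : ℕ → ℂ} (h : ∀ n u : ℕ, lam n * ε (j + 2 * n) u * n.factorial * rise j n * u.factorial =
      (-1) ^ u * lam (n + u) * (n + u).factorial * rise j (n + u)) :
    t.tw ε (serLift δ t.D j lam f) = serLift δ t.D j lam f := by
  rw [serLift_apply, tw_ser]
  congr 1
  funext n
  have hl : ∀ x ∈ antidiagonal n, ε (j + 2 * x.1) x.2 • (t.mon x.2 (-(j + 2 * x.1 + x.2)) *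
      t.φ (lam x.1 • ((t.D : R →ₗ[ℂ] R) ^ x.1) f)) = ∑ z ∈ antidiagonal x.1,
      (ε (j + 2 * (z.1 + z.2 : ℕ)) x.2 * lam (z.1 + z.2) * liftCoeff j z.1 z.2) •
        (t.mon (z.2 + x.2) (-(z.2 + x.2)) * ((t.D : R →ₗ[ℂ] R) ^ z.1) f) := by
    intro x _
    rw [map_smul, t.φ_D_pow hf, smul_sum, mul_sum, smul_sum]
    refine sum_congr rfl fun z hz => ?_
    have h := HasAntidiagonal.mem_antidiagonal.mp hz
    rw [← h, mul_smul_comm, mul_smul_comm, smul_smul, smul_smul, mon_mul_mon_mul, add_comm x.2 z.2]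
    congr 3
    push_cast
    ring
  rw [sum_congr rfl hl, sum_antidiagonal_assoc n (fun r v u =>
      (ε (j + 2 * (r + v : ℕ)) u * lam (r + v) * liftCoeff j r v) •
        (t.mon (v + u) (-(v + u)) * ((t.D : R →ₗ[ℂ] R) ^ r) f))]
  have hx : ∀ x ∈ antidiagonal n, ∑ z ∈ antidiagonal x.2,
      (ε (j + 2 * (x.1 + z.1 : ℕ)) z.2 * lam (x.1 + z.1) * liftCoeff j x.1 z.1) •
        (t.mon (z.1 + z.2) (-(z.1 + z.2)) * ((t.D : R →ₗ[ℂ] R) ^ x.1) f) =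
      if x.2 = 0 then lam n • ((t.D : R →ₗ[ℂ] R) ^ n) f else 0 := by
    intro x hx
    have hx' := HasAntidiagonal.mem_antidiagonal.mp hx
    have hr : (x.1.factorial : ℂ) ≠ 0 := by exact_mod_cast x.1.factorial_ne_zero
    have hjr := rise_nat_ne_zero hj x.1
    have hc : ∀ z ∈ antidiagonal x.2,
        (ε (j + 2 * (x.1 + z.1 : ℕ)) z.2 * lam (x.1 + z.1) * liftCoeff j x.1 z.1) •
        (t.mon (z.1 + z.2) (-(z.1 + z.2)) * ((t.D : R →ₗ[ℂ] R) ^ x.1) f) =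
        ((lam n * n.factorial * rise j n / (x.1.factorial * rise j x.1)) *
          ((-1 : ℂ) ^ z.2 / ((z.1.factorial : ℂ) * z.2.factorial))) •
        (t.mon x.2 (-x.2) * ((t.D : R →ₗ[ℂ] R) ^ x.1) f) := by
      intro z hz
      have hz' := HasAntidiagonal.mem_antidiagonal.mp hz
      have h1 := h (x.1 + z.1) z.2
      rw [show x.1 + z.1 + z.2 = n by omega] at h1
      have h2 : ((x.1 + z.1).choose x.1 : ℂ) * x.1.factorial * z.1.factorial =
          (x.1 + z.1).factorial := by
        rw [Nat.choose_symm_add]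
        exact_mod_cast Nat.add_choose_mul_factorial_mul_factorial x.1 z.1
      have h3 := rise_add j x.1 z.1
      have hz1 : (z.1.factorial : ℂ) ≠ 0 := by exact_mod_cast z.1.factorial_ne_zero
      have hz2 : (z.2.factorial : ℂ) ≠ 0 := by exact_mod_cast z.2.factorial_ne_zero
      rw [h3, ← h2] at h1
      rw [← hz']
      push_cast at h1 ⊢
      congr 1
      rw [div_mul_div_comm, eq_div_iff (by simp [hr, hjr, hz1, hz2]), liftCoeff]
      push_cast
      linear_combination h1
    rw [sum_congr rfl hc, ← sum_smul, ← mul_sum, sum_antidiagonal_alternating]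
    split_ifs with h0
    · obtain rfl : x.1 = n := by omega
      have hn : lam x.1 * (x.1.factorial : ℂ) * rise j x.1 / (x.1.factorial * rise j x.1) = lam x.1 := by
        field_simp
      rw [hn, mul_one, h0]
      simp [mon_zero_zero]
    · simp
  rw [sum_congr rfl hx, sum_eq_single (n, 0)]
  · simp
  · intro z hz hz'
    have h := HasAntidiagonal.mem_antidiagonal.mp hz
    rw [if_neg fun h0 => hz' (Prod.ext (by simp only; omega) h0)]
  · intro h
    simp at h

end HomographicTwist

/-! ### Fixed series, their leading coefficients and limits -/

section FixedSpace
open QPDO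
variable {R : Type*} [CommRing R] [Algebra ℂ R] {δ : Derivation ℂ R R} {ι : Type*}

/-- The series of valuation at least `k` that are fixed by the operators `(t γ).tw ε`. -/
def fixedSpace (t : ι → HomographicTwist δ) (ε : ℤ → ℕ → ℂ) (k : ℤ) : Submodule ℂ (QPDO δ) where
  carrier := {q | (∀ i < k, q.coeff i = 0) ∧ ∀ γ, (t γ).tw ε q = q}
  zero_mem' := ⟨fun _ _ => rfl, fun γ => map_zero _⟩
  add_mem' := by
    rintro p q ⟨hp, hp'⟩ ⟨hq, hq'⟩
    exact ⟨fun i hi => by simp [hp i hi, hq i hi], fun γ => by rw [map_add, hp', hq']⟩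
  smul_mem' := by
    rintro c q ⟨hq, hq'⟩
    exact ⟨fun i hi => by simp [hq i hi], fun γ => by rw [map_smul, hq']⟩

/-- In lowest degree only ε(a,0) = 1 contributes, and the fixed-point equation becomes modularity of
weight a. -/
theorem fixedSpace_lead {t : ι → HomographicTwist δ} {ε : ℤ → ℕ → ℂ} {k : ℤ} (hε : ∀ i, ε i 0 = 1)
    {q : QPDO δ} (hq : q ∈ fixedSpace t ε k) {a : ℤ} (ha : ∀ i < a, q.coeff i = 0) (γ : ι) :
    (t γ).φ (q.coeff a) = (t γ).mon 0 a * q.coeff a := by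
  have h := (t γ).coeff_tw_lead ε ha
  rw [hq.2 γ, hε, one_smul] at h
  nth_rewrite 2 [h]
  rw [HomographicTwist.mon_mul_mon_mul, add_neg_cancel, zero_add, HomographicTwist.mon_zero_zero,
    one_mul]

theorem fixedSpace_lim {t : ι → HomographicTwist δ} {ε : ℤ → ℕ → ℂ} {k : ℤ} {q : QPDO δ}
    (h : ∀ N, ∃ p ∈ fixedSpace t ε k, ∀ i ≤ N, q.coeff i = p.coeff i) : q ∈ fixedSpace t ε k := by
  refine ⟨fun i hi => ?_, fun γ => QPDO.ext fun N => ?_⟩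
  · obtain ⟨p, hp, hpq⟩ := h i
    rw [hpq i le_rfl, hp.1 i hi]
  · obtain ⟨p, hp, hpq⟩ := h N
    rw [(t γ).coeff_tw_congr ε hpq, hp.2 γ, hpq N le_rfl]

end FixedSpace

/-! ### Homographies acting on R, and the action on C -/

open QPDO

theorem moebius_inv_moebius (γ : Matrix.SpecialLinearGroup (Fin 2) ℂ) {z : ℂ}
    (hz : denomAt γ z ≠ 0) : moebius γ⁻¹ (moebius γ z) = z := by
  have hdet := det_eq_one_entries γ
  have hw : γ 1 0 * z + γ 1 1 = denomAt γ z := rfl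
  have e : moebius γ z * denomAt γ z = γ 0 0 * z + γ 0 1 := div_mul_cancel₀ _ hz
  have h1 : denomAt γ⁻¹ (moebius γ z) * denomAt γ z = 1 := by
    rw [denomAt, Matrix.SpecialLinearGroup.SL2_inv_expl]
    simp
    linear_combination (-γ 1 0) * e - γ 0 0 * hw + hdet
  have h2 : (γ⁻¹ 0 0 * moebius γ z + γ⁻¹ 0 1) * denomAt γ z = z := by
    rw [Matrix.SpecialLinearGroup.SL2_inv_expl]
    simp
    linear_combination γ 1 1 * e + γ 0 1 * hw + z * hdet
  rw [moebius, div_eq_iff (left_ne_zero_of_mul_eq_one h1)]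
  apply mul_right_cancel₀ hz
  linear_combination h2 - z * h1

theorem hasDerivAt_denomAt (γ : Matrix.SpecialLinearGroup (Fin 2) ℂ) (z : ℂ) :
    HasDerivAt (denomAt γ) (γ 1 0) z := by
  have h := ((hasDerivAt_id z).const_mul (γ 1 0)).add_const (γ 1 1)
  rw [mul_one] at h
  exact h

theorem hasDerivAt_moebius (γ : Matrix.SpecialLinearGroup (Fin 2) ℂ) {z : ℂ}
    (hz : denomAt γ z ≠ 0) : HasDerivAt (moebius γ) ((denomAt γ z)⁻¹ ^ 2) z := by
  have h1 : HasDerivAt (fun z => γ 0 0 * z + γ 0 1) (γ 0 0) z := by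
    simpa using ((hasDerivAt_id z).const_mul (γ 0 0)).add_const (γ 0 1)
  have h2 := h1.div (hasDerivAt_denomAt γ z) hz
  have hdet := det_eq_one_entries γ
  have e : γ 0 0 * denomAt γ z - (γ 0 0 * z + γ 0 1) * γ 1 0 = 1 := by
    simp only [denomAt]
    linear_combination hdet
  rw [e, one_div, ← inv_pow] at h2
  exact h2

namespace HomographicAlgebra

variable {Γ : Subgroup (Matrix.SpecialLinearGroup (Fin 2) ℂ)} {R : Type*} [CommRing R]
  [Algebra ℂ R] (H : HomographicAlgebra Γ R)

theorem eventually_denomAt_ne_zero (γ : Γ) : ∀ᶠ z in offCountable H.U, denomAt γ z ≠ 0 := by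
  rw [eventually_offCountable]
  refine (denomAt_zero_countable γ).mono fun z hz => ?_
  simpa using hz.2

theorem D_s (γ : Γ) : H.D (H.s γ) = algebraMap ℂ R (lowerLeft γ) := by
  apply H.toFun_injective
  filter_upwards [H.D_spec (H.s γ), H.toFun_const (lowerLeft γ),
    hasDerivAt_unique_offCountable H.isOpen_U (H.s_spec γ)] with z h1 h2 h3
  rw [h2]
  exact h3 _ _ h1 (hasDerivAt_denomAt γ z)

/-- Chain rule: the derivative of the homography is (cz+d)⁻² because the determinant is 1. -/
theorem D_comp (γ : Γ) (f : R) :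
    H.D (H.comp γ f) = (((H.s γ)⁻¹ ^ 2 : Rˣ) : R) * H.comp γ (H.D f) := by
  have h : (H.s γ : R) * (H.s γ : R) * H.D (H.comp γ f) = H.comp γ (H.D f) := by
    apply H.toFun_injective
    filter_upwards [H.eventually_denomAt_ne_zero γ, H.D_spec (H.comp γ f),
      hasDerivAt_unique_offCountable H.isOpen_U (H.comp_spec γ f),
      (H.tendsto_moebius γ).eventually (H.D_spec f), H.comp_spec γ (H.D f),
      H.toFun_mul ((H.s γ : R) * (H.s γ : R)) (H.D (H.comp γ f)),
      H.toFun_mul (H.s γ : R) (H.s γ : R), H.s_spec γ] with z h0 h1 h2 h3 h4 h5 h6 h7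
    rw [h5, h6, h7, h4, h2 _ _ h1 (h3.comp z (hasDerivAt_moebius γ h0))]
    field_simp
  rw [← h, Units.val_pow_eq_pow_val]
  have e : ((H.s γ)⁻¹ : Rˣ) * (H.s γ : R) = 1 := (H.s γ).inv_mul
  linear_combination (-H.D (H.comp γ f) * (((H.s γ)⁻¹ : Rˣ) * (H.s γ : R) + 1)) * e

theorem comp_comp_inv (γ : Γ) (f : R) : H.comp γ (H.comp γ⁻¹ f) = f := by
  apply H.toFun_injective
  filter_upwards [H.comp_spec γ (H.comp γ⁻¹ f),
    (H.tendsto_moebius γ).eventually (H.comp_spec γ⁻¹ f), H.eventually_denomAt_ne_zero γ]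
    with z h1 h2 h3
  rw [h1, h2, InvMemClass.coe_inv, moebius_inv_moebius _ h3]

theorem comp_bijective (γ : Γ) : Function.Bijective (H.comp γ) := by
  constructor
  · intro f g h
    have h1 := H.comp_comp_inv γ⁻¹ f
    have h2 := H.comp_comp_inv γ⁻¹ g
    rw [inv_inv] at h1 h2
    rw [← h1, h, h2]
  · exact fun f => ⟨_, H.comp_comp_inv γ f⟩

/-- The action of `γ` on `R`, as a twist of the derivation `-½ ∂_z`. -/
noncomputable def twist (γ : Γ) : HomographicTwist H.delta where
  D := H.D
  φ := H.comp γ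
  s := H.s γ
  c := lowerLeft γ
  delta_eq := rfl
  D_s := H.D_s γ
  D_φ := H.D_comp γ

theorem twist_mon_zero_natCast (γ : Γ) (n : ℕ) : (H.twist γ).mon 0 n = (H.s γ : R) ^ n := by
  rw [HomographicTwist.mon_zero, zpow_natCast, Units.val_pow_eq_pow_val]
  rfl

theorem y_mul_y_mul_const [Nontrivial R] (γ : Γ) : QPDO.y H.delta * QPDO.y H.delta *
    QPDO.const H.delta (((H.s γ)⁻¹ ^ 2 : Rˣ) : R) = (H.twist γ).eta 2 := by
  rw [HomographicTwist.eta_two, y, monomial_mul_monomial_one, HomographicTwist.mon_zero, inv_pow,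
    ← zpow_natCast, ← zpow_neg]
  rfl

/-- Carries both existence and uniqueness of the action: y² s⁻² is `eta 2`, and among its square
roots with leading term s⁻¹ y there is only `eta 1`. -/
theorem isAction_iff [IsDomain R] (γ : Γ) (σ : QPDO H.delta ≃+* QPDO H.delta) :
    H.IsAction γ σ ↔ σ = (H.twist γ).twEquiv (H.comp_bijective γ) := by
  have hs : (H.twist γ).mon 0 (-1) = (((H.s γ)⁻¹ : Rˣ) : R) := by
    rw [HomographicTwist.mon_zero, zpow_neg_one]
    rfl
  constructor
  · intro h
    refine (H.twist γ).eq_twEquiv (H.comp_bijective γ) h.map_const ?_ h.coeff_map_y_lt ?_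
    · rw [h.map_y_sq, y_mul_y_mul_const]
    · rw [h.coeff_map_y_one, hs]
  · rintro rfl
    have hy : (H.twist γ).twEquiv (H.comp_bijective γ) (y H.delta) = (H.twist γ).eta 1 :=
      (H.twist γ).tw_monomial_one 1
    refine ⟨(H.twist γ).tw_const, ?_, ?_, ?_⟩
    · rw [y_mul_y_mul_const, hy, HomographicTwist.eta_mul_eta]
      rfl
    · intro i hi
      rw [hy, HomographicTwist.coeff_eta_of_lt _ hi]
    · rw [hy, HomographicTwist.eta, coeff_ser_self, twistCoeff_zero_right, one_smul, ← hs]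
      simp

theorem invariants_eq_fixedSpace [IsDomain R] (k : ℤ) :
    H.invariants k = fixedSpace H.twist twistCoeff k := by
  ext q
  refine and_congr_right fun _ => forall_congr' fun γ => ?_
  simp only [isAction_iff, forall_eq]
  rfl

/-! ### Invariance of the lifts ψ_j -/

theorem mem_modularForms_iff (j : ℕ) (f : R) :
    f ∈ H.modularForms j ↔ ∀ γ, (H.twist γ).φ f = (H.twist γ).mon 0 j * f :=
  forall_congr' fun γ => by rw [twist_mon_zero_natCast]; rfl

theorem psi_eq_serLift (j : ℕ) (f : R) : H.psi j f = serLift H.delta H.D j (psiCoeff j) f := rfl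

theorem psiCoeff_zero (j : ℕ) : psiCoeff j 0 = 1 := by simp [psiCoeff]

theorem psiCoeff_one (j : ℕ) : psiCoeff j 1 = -((j : ℂ) + 2) / 4 := by
  simp [psiCoeff]
  ring

/-- Stated without division so as to include j = 0, where n = 0 only gives 0 = 0. That lost value is
why weight 0 needs its own argument. -/
theorem psiCoeff_succ (j n : ℕ) : psiCoeff j (n + 1) * (n + 1) * (j + n) =
    -((j + 2 * n) * (j + 2 * n + 2) / 4) * psiCoeff j n := by
  rcases n with _ | n
  · rw [psiCoeff_one, psiCoeff_zero]
    push_cast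
    ring
  · have h1 : ((j : ℂ) + (n + 1 : ℕ)) ≠ 0 := by exact_mod_cast (by omega : j + (n + 1) ≠ 0)
    have h2 : (((n + 1 : ℕ) : ℂ) + 1) ≠ 0 := by exact_mod_cast (by omega : n + 1 + 1 ≠ 0)
    rw [psiCoeff, psiCoeff, Finset.prod_range_succ _ (n + 1),
      Finset.prod_Ico_succ_top (by omega : 1 ≤ n + 1), Nat.factorial_succ (n + 1)]
    generalize ∏ i ∈ Finset.range (n + 1), ((j : ℂ) + 2 * i + 2) = A
    generalize ∏ i ∈ Finset.Ico 1 (n + 1), (((j : ℂ) + 2 * i) / ((j : ℂ) + i)) = B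
    have h3 : ((n + 1).factorial : ℂ) ≠ 0 := by exact_mod_cast (n + 1).factorial_ne_zero
    rw [Nat.cast_mul, Nat.cast_add (n + 1) 1, Nat.cast_one]
    field_simp
    ring

/-- The relation required by `tw_serLift`: the recurrence of `twistCoeff` in `u` matches that of
`psiCoeff` in `n + u`. -/
theorem psiCoeff_mul_twistCoeff (j n u : ℕ) :
    psiCoeff j n * twistCoeff (j + 2 * n) u * n.factorial * rise j n * u.factorial =
      (-1) ^ u * psiCoeff j (n + u) * (n + u).factorial * rise j (n + u) := by
  induction u with
  | zero => simp [twistCoeff_zero_right]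
  | succ u ih =>
    have h1 := twistCoeff_succ (j + 2 * n) u
    have h2 := psiCoeff_succ j (n + u)
    rw [← add_assoc, Nat.factorial_succ, Nat.factorial_succ, rise_succ]
    push_cast at h1 h2 ih ⊢
    linear_combination (psiCoeff j n * n.factorial * rise j n * u.factorial) * h1 +
      ((j + 2 * n + 2 * u) * (j + 2 * n + 2 * u + 2) / 4) * ih -
      ((-1) ^ (u + 1) * (n + u).factorial * rise j (n + u)) * h2

/-- Reduces weight 0 to weight 2, the weight of the derivative of a form of weight 0. -/
theorem psiCoeff_zero_succ (n : ℕ) : psiCoeff 0 (n + 1) = -(1 / 2) * psiCoeff 2 n := by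
  induction n with
  | zero => simp [psiCoeff_one, psiCoeff_zero]; norm_num
  | succ n ih =>
    have h1 := psiCoeff_succ 0 (n + 1)
    have h2 := psiCoeff_succ 2 n
    have h : ((n : ℂ) + 1) * (n + 2) ≠ 0 := by
      exact_mod_cast (by positivity : (n + 1) * (n + 2) ≠ 0)
    apply mul_left_cancel₀ h
    push_cast at h1 h2 ⊢
    linear_combination h1 + (1 / 2) * h2 - ((2 * n + 2) * (2 * n + 4) / 4) * ih

theorem psi_zero_eq (f : R) :
    H.psi 0 f = const H.delta f + (-(1 / 2) : ℂ) • H.psi 2 (H.D f) := by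
  rw [psi_eq_serLift, psi_eq_serLift, serLift_apply, serLift_apply, const]
  symm
  apply eq_ser
  · intro n
    rw [coeff_add, coeff_smul, coeff_monomial]
    rcases n with _ | n
    · rw [coeff_ser_of_lt _ _ (by simp)]
      simp [psiCoeff_zero]
    · rw [show ((0 : ℕ) : ℤ) + 2 * (n + 1 : ℕ) = (2 : ℕ) + 2 * (n : ℕ) by push_cast; ring, coeff_ser,
        if_neg (by omega), smul_smul, psiCoeff_zero_succ, zero_add, pow_succ, Module.End.mul_apply]
      rfl
  · intro N hN
    rw [coeff_add, coeff_smul, coeff_monomial, if_neg (by simpa using hN 0), coeff_ser_of_ne]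
    · simp
    · intro n hn
      exact hN (n + 1) (by push_cast at hn ⊢; omega)

theorem psi_mem_fixedSpace [IsDomain R] {j : ℕ} {f : R} (hf : f ∈ H.modularForms j) {k : ℤ}
    (hk : k ≤ j) : H.psi j f ∈ fixedSpace H.twist twistCoeff k := by
  refine ⟨fun i hi => by
    rw [psi_eq_serLift, serLift_apply, coeff_ser_of_lt _ _ (by omega)], fun γ => ?_⟩
  -- In weight 0 the term f is fixed and f' is modular of weight 2, so `psi_zero_eq` gives a sum of
  -- two fixed series.
  rcases Nat.eq_zero_or_pos j with rfl | hj
  · have h0 := (H.mem_modularForms_iff _ _).mp hf γ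
    rw [Nat.cast_zero, HomographicTwist.mon_zero_zero, one_mul] at h0
    rw [psi_zero_eq, map_add, map_smul, HomographicTwist.tw_const, h0]
    congr 2
    refine (H.twist γ).tw_serLift two_pos ?_ (psiCoeff_mul_twistCoeff 2)
    exact ((H.twist γ).φ_D f).trans (by rw [h0]; rfl)
  · exact (H.twist γ).tw_serLift hj ((H.mem_modularForms_iff _ _).mp hf γ)
      (psiCoeff_mul_twistCoeff j)

end HomographicAlgebra

/-! ### Jacobi forms as fixed series -/

theorem coeff_expSq {R : Type*} [CommRing R] [Algebra ℂ R] (a : R) (n : ℕ) :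
    PowerSeries.coeff (2 * n) (expSq a) = ((1 : ℂ) / (n.factorial : ℂ)) • a ^ n := by
  rw [expSq, PowerSeries.coeff_mk, if_pos (even_two_mul n), Nat.mul_div_cancel_left _ two_pos]

theorem coeff_expSq_of_odd {R : Type*} [CommRing R] [Algebra ℂ R] (a : R) {n : ℕ} (h : ¬ Even n) :
    PowerSeries.coeff n (expSq a) = 0 := by
  rw [expSq, PowerSeries.coeff_mk, if_neg h]

theorem coeff_expSq_mul {R : Type*} [CommRing R] [Algebra ℂ R] (a : R) (G : PowerSeries R) (n : ℕ) :
    PowerSeries.coeff n (expSq a * G) = ∑ v ∈ Finset.range (n / 2 + 1),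
      ((1 : ℂ) / (v.factorial : ℂ)) • (a ^ v * PowerSeries.coeff (n - 2 * v) G) := by
  rw [PowerSeries.coeff_mul]
  symm
  refine Finset.sum_of_injOn (fun v => (2 * v, n - 2 * v)) ?_ ?_ ?_ ?_
  · intro u _ v _ h
    simp only [Prod.mk.injEq] at h
    omega
  · intro v hv
    simp only [Finset.coe_range, Set.mem_Iio] at hv
    simp only [Finset.mem_coe, Finset.HasAntidiagonal.mem_antidiagonal]
    omega
  · rintro ⟨p, q⟩ hx hx'
    have h := Finset.HasAntidiagonal.mem_antidiagonal.mp hx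
    rw [coeff_expSq_of_odd, zero_mul]
    rintro ⟨v, hv⟩
    simp only at h hv
    refine hx' ⟨v, ?_, ?_⟩
    · simp only [Finset.coe_range, Set.mem_Iio]
      omega
    · simp only [Prod.mk.injEq]
      omega
  · intro v _
    simp only
    rw [coeff_expSq, smul_mul_assoc]

theorem expSq_mul_expSq_neg {R : Type*} [CommRing R] [Algebra ℂ R] (a : R) :
    expSq a * expSq (-a) = 1 := by
  -- `expSq a` is the exponential series of aT at T = Z². The rational structure serves only to
  -- apply the addition formula of `PowerSeries.exp`.
  let _ : Algebra ℚ R := ((algebraMap ℂ R).comp (algebraMap ℚ ℂ)).toAlgebra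
  have h : ∀ a : R, expSq a =
      PowerSeries.expand 2 two_ne_zero (PowerSeries.rescale a (PowerSeries.exp R)) := by
    intro a
    ext n
    by_cases hn : Even n
    · obtain ⟨v, rfl⟩ := even_iff_two_dvd.mp hn
      rw [coeff_expSq, PowerSeries.coeff_expand_mul, PowerSeries.coeff_rescale,
        PowerSeries.coeff_exp, Algebra.smul_def, mul_comm]
      congr 1
      change _ = algebraMap ℂ R (algebraMap ℚ ℂ _)
      simp
    · rw [coeff_expSq_of_odd a hn, PowerSeries.coeff_expand_of_not_dvd]
      rwa [← even_iff_two_dvd]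
  rw [h, h, ← map_mul, PowerSeries.exp_mul_exp_eq_exp_add, add_neg_cancel, PowerSeries.rescale_zero]
  simp

namespace QPDO
variable {R : Type*} [CommRing R] [Algebra ℂ R] {δ : Derivation ℂ R R}

/-- The power series `∑_ν q_{k+ν} Z^ν`. -/
noncomputable def toPowerSeries (k : ℤ) : QPDO δ →ₗ[ℂ] PowerSeries R where
  toFun q := PowerSeries.mk fun ν => q.coeff (k + ν)
  map_add' p q := by ext; simp
  map_smul' c q := by ext; simp

theorem coeff_toPowerSeries (k : ℤ) (q : QPDO δ) (ν : ℕ) :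
    PowerSeries.coeff ν (toPowerSeries k q) = q.coeff (k + ν) := 
  PowerSeries.coeff_mk ν fun ν => q.coeff (k + ν)

theorem toPowerSeries_injOn {k : ℤ} {p q : QPDO δ} (hp : ∀ i < k, p.coeff i = 0)
    (hq : ∀ i < k, q.coeff i = 0) (h : toPowerSeries k p = toPowerSeries k q) : p = q := by
  ext i
  by_cases hi : i < k
  · rw [hp i hi, hq i hi]
  · have := congrArg (PowerSeries.coeff (i - k).toNat) h
    rwa [coeff_toPowerSeries, coeff_toPowerSeries,
      show k + ((i - k).toNat : ℤ) = i by omega] at this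

theorem exists_toPowerSeries_eq (k : ℤ) (Φ : PowerSeries R) :
    ∃ q : QPDO δ, (∀ i < k, q.coeff i = 0) ∧ toPowerSeries k q = Φ := by
  let q : QPDO δ := ⟨fun i => if i < k then 0 else PowerSeries.coeff (i - k).toNat Φ, k,
    fun i hi => if_pos hi⟩
  have hq : ∀ i, q.coeff i = if i < k then 0 else PowerSeries.coeff (i - k).toNat Φ := fun _ => rfl
  refine ⟨q, fun i hi => by rw [hq, if_pos hi], ?_⟩
  ext ν
  rw [coeff_toPowerSeries, hq, if_neg (by omega), add_sub_cancel_left, Int.toNat_natCast]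

end QPDO

/-- The coefficient of `c^v s^{-i-v}` in the transformation of Jacobi forms. -/
noncomputable def jacobiCoeff (τ : ℂ) (_ : ℤ) (v : ℕ) : ℂ := (-τ) ^ v / (v.factorial : ℂ)

theorem jacobiCoeff_zero (τ : ℂ) (i : ℤ) : jacobiCoeff τ i 0 = 1 := by simp [jacobiCoeff]

namespace HomographicTwist
open QPDO Finset
variable {R : Type*} [CommRing R] [Algebra ℂ R] {δ : Derivation ℂ R R} (t : HomographicTwist δ)

theorem mon_pow (n : ℕ) (z : ℤ) (k : ℕ) : t.mon n z ^ k = t.mon (n * k) (z * k) := by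
  rw [mon, mon, smul_pow, ← pow_mul, zpow_mul, zpow_natCast, Units.val_pow_eq_pow_val]

/-- The dictionary: after the shift by k, the operator becomes Φ ↦ s^{-k} exp(-τ c Z²/s) Φ(γz, Z/s).
This dictates the choice of `jacobiCoeff`. -/
theorem toPowerSeries_tw (τ : ℂ) (k : ℤ) {q : QPDO δ} (hq : ∀ i < k, q.coeff i = 0) :
    toPowerSeries k (t.tw (jacobiCoeff τ) q) = PowerSeries.C (t.mon 0 (-k)) *
      (expSq (-(τ • t.mon 1 (-1))) * PowerSeries.rescale (t.mon 0 (-1))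
        (PowerSeries.map (t.φ : R →+* R) (toPowerSeries k q))) := by
  ext ν
  rw [PowerSeries.coeff_C_mul, coeff_toPowerSeries, coeff_tw, coeff_expSq_mul,
    finsum_eq_finsetSum_of_support_subset (s := range (ν / 2 + 1)), mul_sum]
  · refine sum_congr rfl fun v hv => ?_
    have hv' := mem_range.mp hv
    rw [PowerSeries.coeff_rescale, PowerSeries.coeff_map, coeff_toPowerSeries, twTerm, jacobiCoeff,
      show k + (ν : ℤ) - 2 * v = k + (ν - 2 * v : ℕ) by omega, ← neg_smul, smul_pow, mon_pow, mon_pow,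
      smul_mul_assoc, mul_smul_comm, mul_smul_comm, smul_smul, mon_mul_mon_mul, mon_mul_mon_mul]
    congr 1
    · ring
    · congr 2
      · ring
      · omega
  · intro v hv
    simp only [coe_range, Set.mem_Iio]
    by_contra! h
    exact hv (t.twTerm_eq_zero hq (by omega))

theorem tw_eq_self_iff (τ : ℂ) (k : ℤ) {q : QPDO δ} (hq : ∀ i < k, q.coeff i = 0) :
    t.tw (jacobiCoeff τ) q = q ↔ PowerSeries.rescale (t.mon 0 (-1))
        (PowerSeries.map (t.φ : R →+* R) (toPowerSeries k q)) =
      PowerSeries.C (t.mon 0 k) * expSq (τ • t.mon 1 (-1)) * toPowerSeries k q := by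
  have h1 := t.toPowerSeries_tw τ k hq
  have h2 := expSq_mul_expSq_neg (τ • t.mon 1 (-1))
  have h3 : PowerSeries.C (t.mon 0 k) * PowerSeries.C (t.mon 0 (-k)) = (1 : PowerSeries R) := by
    rw [← map_mul, mon_mul_mon, add_neg_cancel, add_zero, mon_zero_zero, map_one]
  have h4 : t.tw (jacobiCoeff τ) q = q ↔
      toPowerSeries k (t.tw (jacobiCoeff τ) q) = toPowerSeries k q :=
    ⟨fun h => by rw [h], fun h => toPowerSeries_injOn (t.coeff_tw_eq_zero _ hq) hq h⟩
  rw [h4, h1]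
  generalize PowerSeries.rescale (t.mon 0 (-1)) (PowerSeries.map (t.φ : R →+* R)
    (toPowerSeries k q)) = G
  generalize PowerSeries.C (t.mon 0 k) = A at *
  generalize PowerSeries.C (t.mon 0 (-k)) = B at *
  generalize expSq (-(τ • t.mon 1 (-1))) = E' at *
  generalize expSq (τ • t.mon 1 (-1)) = E at *
  constructor
  · intro h
    rw [← h]
    linear_combination (-G * E * E') * h3 - G * h2
  · intro h
    rw [h]
    linear_combination (toPowerSeries k q * E * E') * h3 + toPowerSeries k q * h2

/-- The lift of an invariant function of weight `0` given by a quasimodular form of weight `2`. -/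
noncomputable def expLift (δ : Derivation ℂ R R) (τ : ℂ) (p : R) : R →ₗ[ℂ] QPDO δ where
  toFun f := ser δ 0 fun n => (τ ^ n / (n.factorial : ℂ)) • (p ^ n * f)
  map_add' f g := by
    ext N
    by_cases hN : ∃ n : ℕ, N = 0 + 2 * n
    · obtain ⟨n, rfl⟩ := hN
      rw [coeff_add, coeff_ser, coeff_ser, coeff_ser, mul_add, smul_add]
    · push Not at hN
      rw [coeff_add, coeff_ser_of_ne _ _ hN, coeff_ser_of_ne _ _ hN, coeff_ser_of_ne _ _ hN, add_zero]
  map_smul' c f := by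
    ext N
    by_cases hN : ∃ n : ℕ, N = 0 + 2 * n
    · obtain ⟨n, rfl⟩ := hN
      rw [coeff_smul, coeff_ser, coeff_ser, mul_smul_comm, smul_comm]
      rfl
    · push Not at hN
      rw [coeff_smul, coeff_ser_of_ne _ _ hN, coeff_ser_of_ne _ _ hN, smul_zero]

theorem expLift_apply (τ : ℂ) (p f : R) :
    expLift δ τ p f = ser δ 0 fun n => (τ ^ n / (n.factorial : ℂ)) • (p ^ n * f) := rfl

theorem coeff_expLift_of_lt (τ : ℂ) (p f : R) {N : ℤ} (h : N < 0) :
    (expLift δ τ p f).coeff N = 0 := by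
  rw [expLift_apply, coeff_ser_of_lt _ _ h]

/-- From s⁻² φ(p) = p + c/s, the series exp(τ p Z²) acquires exactly the Jacobi factor exp(τ c
Z²/s). On coefficients this is the binomial expansion of p^n = ((p + c/s) - c/s)^n. -/
theorem tw_expLift (τ : ℂ) {p f : R} (hp : t.φ p = t.mon 0 2 * p + t.mon 1 1) (hf : t.φ f = f) :
    t.tw (jacobiCoeff τ) (expLift δ τ p f) = expLift δ τ p f := by
  rw [expLift_apply, tw_ser]
  congr 1
  funext n
  have hpw : t.mon 0 (-2) * t.φ p = p + t.mon 1 (-1) := by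
    rw [hp, mul_add, mon_mul_mon_mul, mon_mul_mon]
    norm_num [mon_zero_zero]
  have h := (Commute.all (p + t.mon 1 (-1)) (-t.mon 1 (-1))).add_pow' n
  rw [add_neg_cancel_right] at h
  rw [h, sum_mul, smul_sum]
  refine sum_congr rfl fun x hx => ?_
  have hx' := HasAntidiagonal.mem_antidiagonal.mp hx
  have hm : t.mon x.2 (-(0 + 2 * x.1 + x.2)) = t.mon 1 (-1) ^ x.2 * t.mon 0 (-2) ^ x.1 := by
    rw [mon_pow, mon_pow, mon_mul_mon]
    congr 1
    · ring
    · ring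
  have h1 := Nat.add_choose_mul_factorial_mul_factorial x.1 x.2
  rw [← Nat.choose_symm_add, hx'] at h1
  have h2 : (n.choose x.1 : ℂ) * x.1.factorial * x.2.factorial = n.factorial := by exact_mod_cast h1
  have h3 : (x.1.factorial : ℂ) ≠ 0 := by exact_mod_cast x.1.factorial_ne_zero
  have h4 : (x.2.factorial : ℂ) ≠ 0 := by exact_mod_cast x.2.factorial_ne_zero
  have h5 : (n.choose x.1 : ℂ) ≠ 0 := by
    intro h0
    rw [h0, zero_mul, zero_mul] at h2
    exact n.factorial_ne_zero (by exact_mod_cast h2.symm)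
  rw [hm, map_smul, map_mul, map_pow, hf, ← hpw, mul_pow, jacobiCoeff, ← Nat.cast_smul_eq_nsmul ℂ,
    mul_smul_comm, smul_smul, smul_mul_assoc, smul_smul, neg_pow (t.mon 1 (-1)), neg_pow τ]
  have e : (-1 : R) ^ x.2 = algebraMap ℂ R ((-1) ^ x.2) := by simp
  rw [e, ← Algebra.smul_def, mul_smul_comm, smul_mul_assoc, smul_smul]
  congr 1
  · rw [← h2, ← hx', pow_add]
    rw [hx']
    field_simp
  · ring

end HomographicTwist

namespace HomographicAlgebra
open QPDO

variable {Γ : Subgroup (Matrix.SpecialLinearGroup (Fin 2) ℂ)} {R : Type*} [CommRing R]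
  [Algebra ℂ R] (H : HomographicAlgebra Γ R)

theorem mem_fixedSpace_iff (k m : ℕ) {q : QPDO H.delta} (hq : ∀ i < (k : ℤ), q.coeff i = 0) :
    q ∈ fixedSpace H.twist (jacobiCoeff (2 * Real.pi * Complex.I * m)) k ↔
      toPowerSeries k q ∈ H.jacobiForms k m := by
  have e : q ∈ fixedSpace H.twist (jacobiCoeff (2 * Real.pi * Complex.I * m)) k ↔
      ∀ γ, (H.twist γ).tw (jacobiCoeff (2 * Real.pi * Complex.I * m)) q = q := and_iff_right hq
  rw [e]
  refine forall_congr' fun γ => ?_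
  rw [HomographicTwist.tw_eq_self_iff _ _ k hq, twist_mon_zero_natCast]
  have h1 : (H.twist γ).mon 0 (-1) = (((H.s γ)⁻¹ : Rˣ) : R) := by
    rw [HomographicTwist.mon_zero, zpow_neg_one]
    rfl
  have h2 : (2 * Real.pi * Complex.I * m : ℂ) • (H.twist γ).mon 1 (-1) =
      (2 * Real.pi * Complex.I * m * lowerLeft γ : ℂ) • (((H.s γ)⁻¹ : Rˣ) : R) := by
    rw [HomographicTwist.mon, zpow_neg_one, pow_one, smul_smul]
    rfl
  rw [h1, h2]
  rfl

/-- Jacobi forms of weight `k` as fixed series of valuation at least `k`. -/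
noncomputable def jacobiEquiv (k m : ℕ) :
    fixedSpace H.twist (jacobiCoeff (2 * Real.pi * Complex.I * m)) k ≃ₗ[ℂ] H.jacobiForms k m :=
  LinearEquiv.ofBijective
    ((toPowerSeries (δ := H.delta) (k : ℤ)).restrict fun q
      (hq : q ∈ fixedSpace H.twist (jacobiCoeff (2 * Real.pi * Complex.I * m)) k) =>
      (H.mem_fixedSpace_iff k m hq.1).mp hq) (by
    constructor
    · intro p q h
      exact Subtype.ext (toPowerSeries_injOn p.2.1 q.2.1 (congrArg Subtype.val h))
    · rintro ⟨Φ, hΦ⟩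
      obtain ⟨q, hq, rfl⟩ := exists_toPowerSeries_eq (δ := H.delta) k Φ
      exact ⟨⟨q, (H.mem_fixedSpace_iff k m hq).mpr hΦ⟩, rfl⟩)

theorem coeff_jacobiEquiv (k m : ℕ)
    (q : fixedSpace H.twist (jacobiCoeff (2 * Real.pi * Complex.I * m)) k) (ν : ℕ) :
    PowerSeries.coeff ν (H.jacobiEquiv k m q : PowerSeries R) = (q : QPDO H.delta).coeff (k + ν) :=
  coeff_toPowerSeries _ _ _

/-- The coefficient `τ^n (j-1)! / (n! (j+n-1)!)`. -/
noncomputable def jacobiLiftCoeff (τ : ℂ) (j n : ℕ) : ℂ :=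
  τ ^ n * ((j - 1).factorial : ℂ) / ((n.factorial : ℂ) * ((j + n - 1).factorial : ℂ))

theorem jacobiLiftCoeff_zero (τ : ℂ) (j : ℕ) : jacobiLiftCoeff τ j 0 = 1 := by
  have : ((j - 1).factorial : ℂ) ≠ 0 := by exact_mod_cast (j - 1).factorial_ne_zero
  simp [jacobiLiftCoeff, this]

/-- As (j-1)! times the rising factorial is (j+n-1)!, the lift coefficients are τ^n / (n!
j(j+1)⋯(j+n-1)); the relation of `tw_serLift` then amounts to τ^n τ^u = τ^{n+u}. -/
theorem jacobiLiftCoeff_mul (τ : ℂ) {j : ℕ} (hj : 0 < j) (n : ℕ) :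
    jacobiLiftCoeff τ j n * n.factorial * rise j n = τ ^ n := by
  have h : ∀ n, ((j - 1).factorial : ℂ) * rise j n = ((j + n - 1).factorial : ℂ) := by
    intro n
    induction n with
    | zero => simp [rise_zero]
    | succ n ih =>
      rw [rise_succ, ← mul_assoc, ih, show j + (n + 1) - 1 = (j + n - 1) + 1 by omega,
        Nat.factorial_succ, show j + n - 1 + 1 = j + n by omega]
      push_cast
      ring
  have h1 : (n.factorial : ℂ) ≠ 0 := by exact_mod_cast n.factorial_ne_zero
  have h2 : ((j + n - 1).factorial : ℂ) ≠ 0 := by exact_mod_cast (j + n - 1).factorial_ne_zero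
  rw [jacobiLiftCoeff, div_mul_eq_mul_div, div_mul_eq_mul_div, div_eq_iff (mul_ne_zero h1 h2), ← h n]
  ring

theorem jacobiLiftCoeff_mul_jacobiCoeff (τ : ℂ) {j : ℕ} (hj : 0 < j) (n u : ℕ) :
    jacobiLiftCoeff τ j n * jacobiCoeff τ (j + 2 * n) u * n.factorial * rise j n * u.factorial =
      (-1) ^ u * jacobiLiftCoeff τ j (n + u) * (n + u).factorial * rise j (n + u) := by
  have h1 := jacobiLiftCoeff_mul τ hj n
  have h2 := jacobiLiftCoeff_mul τ hj (n + u)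
  have h3 : (u.factorial : ℂ) ≠ 0 := by exact_mod_cast u.factorial_ne_zero
  have h4 : jacobiCoeff τ (j + 2 * n) u * u.factorial = (-1) ^ u * τ ^ u := by
    rw [jacobiCoeff, div_mul_cancel₀ _ h3, neg_pow]
  rw [pow_add] at h2
  linear_combination (jacobiCoeff τ (j + 2 * n) u * u.factorial) * h1 + τ ^ n * h4 - (-1) ^ u * h2

theorem coeff_serLift_jacobi (m k i N : ℕ) (hi : i ≤ N) (f : R) :
    (serLift H.delta H.D (k + i : ℕ)
      (jacobiLiftCoeff (2 * Real.pi * Complex.I * m) (k + i)) f).coeff (k + N) =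
    PowerSeries.coeff (N - i) (H.jacobiLift m (k + i) f) := by
  rw [jacobiLift, PowerSeries.coeff_mk, serLift_apply]
  split_ifs with h
  · obtain ⟨v, hv⟩ := h
    rw [show (k : ℤ) + N = (k + i : ℕ) + 2 * (v : ℕ) by push_cast; omega, coeff_ser,
      show (N - i) / 2 = v by omega]
    rfl
  · rw [coeff_ser_of_ne]
    intro n hn
    exact h ⟨n, by push_cast at hn; omega⟩

end HomographicAlgebra

/-! ### The isomorphisms, the transported product and its commutators -/

namespace HomographicAlgebra
open QPDO

variable {Γ : Subgroup (Matrix.SpecialLinearGroup (Fin 2) ℂ)} {R : Type*} [CommRing R]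
  [Algebra ℂ R] (H : HomographicAlgebra Γ R)

theorem fixedSpace_lead_mem {ε : ℤ → ℕ → ℂ} (hε : ∀ i, ε i 0 = 1) {k : ℕ} {q : QPDO H.delta}
    (hq : q ∈ fixedSpace H.twist ε k) (i : ℕ) (h : ∀ N < (k : ℤ) + i, q.coeff N = 0) :
    q.coeff ((k : ℤ) + i) ∈ H.modularForms (k + i) := by
  rw [mem_modularForms_iff]
  intro γ
  rw [Nat.cast_add]
  exact fixedSpace_lead hε hq h γ

/-- The isomorphism `(f_j)_j ↦ ∑_j ψ_j(f_j)` from families of modular forms to invariants. -/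
theorem exists_equiv_invariants [IsDomain R] (k : ℕ) :
    ∃ Ψ : ((i : ℕ) → H.modularForms (k + i)) ≃ₗ[ℂ] H.invariants k,
      ∀ (f : (i : ℕ) → H.modularForms (k + i)) (N : ℤ),
        (Ψ f : QPDO H.delta).coeff N = ∑ᶠ i : ℕ, (H.psi (k + i) (f i : R)).coeff N := by
  let L : (i : ℕ) → H.modularForms (k + i) →ₗ[ℂ] QPDO H.delta := fun i =>
    (serLift H.delta H.D (k + i : ℕ) (psiCoeff (k + i))).comp (H.modularForms (k + i)).subtype
  have hL : ∀ i f, L i f = H.psi (k + i) f := fun i f => rfl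
  have hlow : ∀ (i : ℕ) f, ∀ N < (k : ℤ) + i, (L i f).coeff N = 0 := fun i f N hN =>
    coeff_serLift_of_lt _ _ _ (by push_cast; exact hN)
  have hlead : ∀ (i : ℕ) f, (L i f).coeff ((k : ℤ) + i) = f := fun i f => by
    rw [hL, psi_eq_serLift, serLift_apply, ← Nat.cast_add, coeff_ser_self]
    simp [psiCoeff_zero]
  rw [invariants_eq_fixedSpace]
  obtain ⟨Ψ, hΨ⟩ := exists_linearEquiv_of_lifts (V := fixedSpace H.twist twistCoeff k) hlow hlead
    (fun i f => H.psi_mem_fixedSpace f.2 (by push_cast; omega)) (fun q hq => hq.1)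
    (fun q hq i h => H.fixedSpace_lead_mem twistCoeff_zero_right hq i h) (fun q => fixedSpace_lim)
  exact ⟨Ψ, fun f N => by rw [hΨ]; rfl⟩

/-- Only the weight k + i = 0 needs the quasimodular function; all positive weights use the
classical lift. The lifts are defined on all of R, and modularity enters only for invariance. -/
theorem exists_jacobi_lifts (k m : ℕ) (hk : 0 < k ∨
      ∃ φ : R, ∀ γ : Γ, H.comp γ φ = (H.s γ : R) ^ 2 * φ + lowerLeft γ • (H.s γ : R)) :
    ∃ L : (i : ℕ) → R →ₗ[ℂ] QPDO H.delta,
      (∀ (i : ℕ) f, ∀ N < (k : ℤ) + i, (L i f).coeff N = 0) ∧ (∀ i f, (L i f).coeff ((k : ℤ) + i) = f) ∧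
      (∀ i, ∀ f ∈ H.modularForms (k + i),
        L i f ∈ fixedSpace H.twist (jacobiCoeff (2 * Real.pi * Complex.I * m)) k) ∧
      (0 < k → ∀ i, L i = serLift H.delta H.D (k + i : ℕ)
        (jacobiLiftCoeff (2 * Real.pi * Complex.I * m) (k + i))) := by
  generalize (2 * Real.pi * Complex.I * m : ℂ) = τ
  let S : (i : ℕ) → R →ₗ[ℂ] QPDO H.delta := fun i =>
    serLift H.delta H.D (k + i : ℕ) (jacobiLiftCoeff τ (k + i))
  have hlow : ∀ (i : ℕ) f, ∀ N < (k : ℤ) + i, (S i f).coeff N = 0 := fun i f N hN =>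
    coeff_serLift_of_lt _ _ _ (by push_cast; exact hN)
  have hlead : ∀ (i : ℕ) f, (S i f).coeff ((k : ℤ) + i) = f := fun i f => by
    simp only [S]
    rw [serLift_apply, ← Nat.cast_add, coeff_ser_self]
    simp [jacobiLiftCoeff_zero]
  have hmem : ∀ i, 0 < k + i → ∀ f ∈ H.modularForms (k + i),
      S i f ∈ fixedSpace H.twist (jacobiCoeff τ) k := fun i hi f hf =>
    ⟨fun N hN => hlow i f N (by omega), fun γ => (H.twist γ).tw_serLift hi
      ((H.mem_modularForms_iff _ _).mp hf γ) (jacobiLiftCoeff_mul_jacobiCoeff τ hi)⟩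
  rcases Nat.eq_zero_or_pos k with rfl | hk0
  · obtain ⟨p, hp⟩ := hk.resolve_left (lt_irrefl 0)
    have hp' : ∀ γ, (H.twist γ).φ p = (H.twist γ).mon 0 2 * p + (H.twist γ).mon 1 1 := by
      intro γ
      have h2 := H.twist_mon_zero_natCast γ 2
      rw [Nat.cast_ofNat] at h2
      rw [h2, HomographicTwist.mon, pow_one, zpow_one]
      exact hp γ
    refine ⟨fun i => if i = 0 then HomographicTwist.expLift H.delta τ p else S i, ?_, ?_, ?_,
      fun h => absurd h (lt_irrefl 0)⟩
    · intro i f N hN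
      simp only
      split_ifs with hi
      · exact HomographicTwist.coeff_expLift_of_lt _ _ _ (by simpa [hi] using hN)
      · exact hlow i f N hN
    · intro i f
      simp only
      split_ifs with hi
      · rw [HomographicTwist.expLift_apply, hi, Nat.cast_zero, add_zero, coeff_ser_self]
        simp
      · exact hlead i f
    · intro i f hf
      simp only
      split_ifs with hi
      · subst hi
        refine ⟨fun N hN => HomographicTwist.coeff_expLift_of_lt _ _ _ hN,
          fun γ => (H.twist γ).tw_expLift τ (hp' γ) ?_⟩
        have h0 := (H.mem_modularForms_iff _ _).mp hf γ
        rwa [add_zero, Nat.cast_zero, HomographicTwist.mon_zero_zero, one_mul] at h0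
      · exact hmem i (by omega) f hf
  · exact ⟨S, hlow, hlead, fun i => hmem i (by omega), fun _ i => rfl⟩

/-- Families of modular forms are isomorphic to Jacobi forms. -/
theorem exists_equiv_jacobiForms (k m : ℕ) (hk : 0 < k ∨
      ∃ φ : R, ∀ γ : Γ, H.comp γ φ = (H.s γ : R) ^ 2 * φ + lowerLeft γ • (H.s γ : R)) :
    ∃ Θ : ((i : ℕ) → H.modularForms (k + i)) ≃ₗ[ℂ] H.jacobiForms k m,
      (∀ (f : (i : ℕ) → H.modularForms (k + i)) (n : ℕ), (∀ i < n, f i = 0) →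
        PowerSeries.coeff n (Θ f : PowerSeries R) = (f n : R)) ∧
      (0 < k → ∀ (f : (i : ℕ) → H.modularForms (k + i)) (N : ℕ),
        PowerSeries.coeff N (Θ f : PowerSeries R) =
          ∑ i ∈ Finset.range (N + 1),
            PowerSeries.coeff (N - i) (H.jacobiLift m (k + i) (f i : R))) := by
  obtain ⟨L, hlow, hlead, hmem, hL⟩ := H.exists_jacobi_lifts k m hk
  let L' : (i : ℕ) → H.modularForms (k + i) →ₗ[ℂ] QPDO H.delta := fun i =>
    (L i).comp (H.modularForms (k + i)).subtype
  have hlow' : ∀ (i : ℕ) f, ∀ N < (k : ℤ) + i, (L' i f).coeff N = 0 := fun i f => hlow i f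
  have hlead' : ∀ (i : ℕ) f, (L' i f).coeff ((k : ℤ) + i) = f := fun i f => hlead i f
  obtain ⟨Ψ, hΨ⟩ := exists_linearEquiv_of_lifts hlow' hlead'
    (fun i f => hmem i f f.2) (fun q hq => hq.1)
    (fun q hq i h => H.fixedSpace_lead_mem (jacobiCoeff_zero _) hq i h) (fun q => fixedSpace_lim)
  refine ⟨Ψ.trans (H.jacobiEquiv k m), fun f n hf => ?_, fun hk0 f N => ?_⟩
  · rw [LinearEquiv.trans_apply, coeff_jacobiEquiv, hΨ, coeff_liftSum_lead hlow' hlead' hf]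
  · rw [LinearEquiv.trans_apply, coeff_jacobiEquiv, hΨ,
      coeff_liftSum hlow' f (n := N + 1) (by push_cast; omega), coeff_sum]
    refine Finset.sum_congr rfl fun i hi => ?_
    rw [← coeff_serLift_jacobi H m k i N (by have := Finset.mem_range.mp hi; omega), ← hL hk0]
    rfl

theorem mul_mem_invariants {k : ℕ} {p q : QPDO H.delta} (hp : p ∈ H.invariants k)
    (hq : q ∈ H.invariants k) : p * q ∈ H.invariants k :=
  ⟨fun i hi => coeff_mul_eq_zero hp.1 hq.1 i (by omega),
    fun γ σ hσ => by rw [map_mul, hp.2 γ σ hσ, hq.2 γ σ hσ]⟩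

theorem one_mem_invariants : (1 : QPDO H.delta) ∈ H.invariants (0 : ℕ) :=
  ⟨fun _ hi => coeff_monomial_of_lt 1 hi, fun _ σ _ => map_one σ⟩

theorem coeff_psi_mul_psi (a b : ℕ) (f g : R) :
    (H.psi a f * H.psi b g).coeff (a + b + 2) =
      (-((b : ℂ) + 2) / 4 - a / 2) • (f * H.D g) + (-((a : ℂ) + 2) / 4) • (H.D f * g) := by
  rw [psi_eq_serLift, psi_eq_serLift, serLift_apply, serLift_apply, ser_mul_ser,
    show (a : ℤ) + b + 2 = a + b + 2 * (1 : ℕ) by norm_num, coeff_ser]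
  have hδ : ∀ x, H.delta x = (-(1 / 2) : ℂ) • H.D x := fun _ => rfl
  simp [Finset.Nat.antidiagonal_succ, psiCoeff_zero, psiCoeff_one, quadCoeff_zero_right,
    HomographicTwist.quadCoeff_one_right, hδ, smul_smul]
  module

/-- The leading terms f y^a and g y^b commute in degree a + b, so the first possible discrepancy is
in degree a + b + 2, where the first Rankin-Cohen bracket appears. -/
theorem coeff_commutator_psi (a b : ℕ) (f g : R) :
    (H.psi a f * H.psi b g - H.psi b g * H.psi a f).coeff (a + b + 2) =
      (-(1 / 2) : ℂ) • ((a : ℂ) • (f * H.D g) - (b : ℂ) • (H.D f * g)) := by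
  have h := H.coeff_psi_mul_psi b a g f
  rw [add_comm (b : ℤ) a] at h
  rw [coeff_sub, coeff_psi_mul_psi, h, mul_comm g, mul_comm (H.D g)]
  module

end HomographicAlgebra

theorem mainTheorem10 {R : Type*} [CommRing R] [IsDomain R] [Algebra ℂ R]
    (Γ : Subgroup (Matrix.SpecialLinearGroup (Fin 2) ℂ)) (H : HomographicAlgebra Γ R)
    (k m : ℕ) (hm : 0 < m)
    (hk : 0 < k ∨
      ∃ φ : R, ∀ γ : Γ, H.comp γ φ = (H.s γ : R) ^ 2 * φ + HomographicAlgebra.lowerLeft γ • (H.s γ : R)) :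
    -- the action of `Γ` on `C` defining `C_k^Γ` exists and is unique
    (∀ γ : Γ, ∃! σ : QPDO H.delta ≃+* QPDO H.delta, H.IsAction γ σ) ∧
    ∃ (Ψ : ((i : ℕ) → H.modularForms (k + i)) ≃ₗ[ℂ] H.invariants k)
      (Θ : ((i : ℕ) → H.modularForms (k + i)) ≃ₗ[ℂ] H.jacobiForms k m)
      (T : H.invariants k ≃ₗ[ℂ] H.jacobiForms k m),
      -- `Ψ(∑ f_j) = ∑ ψ_j(f_j)`
      (∀ (f : (i : ℕ) → H.modularForms (k + i)) (N : ℤ),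
        (Ψ f : QPDO H.delta).coeff N = ∑ᶠ i : ℕ, (H.psi (k + i) (f i : R)).coeff N) ∧
      -- `Θ` preserves leading coefficients, and it is the explicit classical map for `k ≥ 1`
      (∀ (f : (i : ℕ) → H.modularForms (k + i)) (n : ℕ), (∀ i < n, f i = 0) →
        PowerSeries.coeff n (Θ f : PowerSeries R) = (f n : R)) ∧
      (0 < k → ∀ (f : (i : ℕ) → H.modularForms (k + i)) (N : ℕ),
        PowerSeries.coeff N (Θ f : PowerSeries R) =
          ∑ i ∈ Finset.range (N + 1),
            PowerSeries.coeff (N - i) (H.jacobiLift m (k + i) (f i : R))) ∧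
      -- `T` is the resulting isomorphism from `C_k^Γ` to `J_{k,m}`
      (∀ f, T (Ψ f) = Θ f) ∧
      -- the product transported from `C_k^Γ` is an algebra structure on `J_{k,m}`
      ∃ star : H.jacobiForms k m →ₗ[ℂ] H.jacobiForms k m →ₗ[ℂ] H.jacobiForms k m,
        (∀ F G, (T.symm (star F G) : QPDO H.delta) =
          (T.symm F : QPDO H.delta) * (T.symm G : QPDO H.delta)) ∧
        (∀ F G K, star (star F G) K = star F (star G K)) ∧
        (k = 0 → ∃ e, ∀ F, star e F = F ∧ star F e = F) ∧
        -- it is not commutative if some first Rankin-Cohen bracket does not vanish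
        (∀ a b : ℕ, k ≤ a → k ≤ b → ∀ f ∈ H.modularForms a, ∀ g ∈ H.modularForms b,
          (a : ℂ) • (f * H.D g) - (b : ℂ) • (H.D f * g) ≠ 0 →
            ∃ F G, star F G ≠ star G F) := by
  refine ⟨fun γ => ⟨_, (H.isAction_iff γ _).mpr rfl, fun σ hσ => (H.isAction_iff γ σ).mp hσ⟩, ?_⟩
  obtain ⟨Ψ, hΨ⟩ := H.exists_equiv_invariants k
  obtain ⟨Θ, hΘ, hΘ'⟩ := H.exists_equiv_jacobiForms k m hk
  refine ⟨Ψ, Θ, Ψ.symm.trans Θ, hΨ, hΘ, hΘ', fun f => by simp, ?_⟩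
  -- From here on only the linear bijectivity of `T` is used.
  generalize Ψ.symm.trans Θ = T
  let star : H.jacobiForms k m →ₗ[ℂ] H.jacobiForms k m →ₗ[ℂ] H.jacobiForms k m :=
    LinearMap.mk₂ ℂ (fun F G => T ⟨(T.symm F : QPDO H.delta) * (T.symm G : QPDO H.delta),
        H.mul_mem_invariants (T.symm F).2 (T.symm G).2⟩)
      (fun F F' G => by
        rw [← map_add]
        congr 1
        ext1
        simp [add_mul])
      (fun c F G => by
        rw [← map_smul]
        congr 1
        ext1
        simp [QPDO.smul_mul])
      (fun F G G' => by
        rw [← map_add]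
        congr 1
        ext1
        simp [mul_add])
      (fun c F G => by
        rw [← map_smul]
        congr 1
        ext1
        simp [QPDO.mul_smul'])
  have hstar : ∀ F G, (T.symm (star F G) : QPDO H.delta) =
      (T.symm F : QPDO H.delta) * (T.symm G : QPDO H.delta) := fun F G => by
    simp [star]
  have hext : ∀ {F G : H.jacobiForms k m}, (T.symm F : QPDO H.delta) = T.symm G → F = G :=
    fun h => T.symm.injective (Subtype.ext h)
  refine ⟨star, hstar, fun F G K => hext ?_, ?_, ?_⟩
  · rw [hstar, hstar, hstar, hstar, mul_assoc]
  · rintro rfl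
    refine ⟨T ⟨1, H.one_mem_invariants⟩, fun F => ⟨hext ?_, hext ?_⟩⟩
    · rw [hstar, LinearEquiv.symm_apply_apply, one_mul]
    · rw [hstar, LinearEquiv.symm_apply_apply, mul_one]
  · intro a b ha hb f hf g hg hne
    have hmem : ∀ {j : ℕ} {f : R}, k ≤ j → f ∈ H.modularForms j → H.psi j f ∈ H.invariants k := by
      intro j f hj hf
      rw [HomographicAlgebra.invariants_eq_fixedSpace]
      exact H.psi_mem_fixedSpace hf (by exact_mod_cast hj)
    -- The witnesses come from ψ_a(f) and ψ_b(g). If their products agreed, the coefficient of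
    -- degree a + b + 2 of the commutator, which is -½ times the bracket, would vanish.
    refine ⟨T ⟨_, hmem ha hf⟩, T ⟨_, hmem hb hg⟩, fun h => hne ?_⟩
    have h1 := congrArg (fun F => (T.symm F : QPDO H.delta)) h
    simp only [hstar, LinearEquiv.symm_apply_apply] at h1
    have h2 := H.coeff_commutator_psi a b f g
    rw [h1, sub_self, QPDO.coeff_zero] at h2
    exact (smul_eq_zero.mp h2.symm).resolve_left (by norm_num)
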